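/- Let $T>0$, $v_{\min}>0$, let $v:[0,T]\to[v_{\min},+\infty[$ be Lipschitz continuous and $g\in C^1(\mathbb R;\mathbb R)$. Let $u_o,\tilde u_o\in (L^1\cap BV)(\mathbb R_+;\mathbb R)$ and $u_b,\tilde u_b\in (L^1\cap BV)([0,T];\mathbb R)$, where $\mathbb{R}_+=\,]0,+\infty[$. For essentially bounded functions $w_\ell$ on intervals $I_\ell$ write $$\mathcal U(w_1,w_2)=\bigl[\min_\ell \operatorname{ess\,inf}_{I_\ell} w_\ell,\ \max_\ell \operatorname{ess\,sup}_{I_\ell} w_\ell\bigr].$$ Write $s^+=\max\{s,0\}$, $s^-=\max\{-s,0\}$; $\operatorname{sgn}^+(s)=1$ if $s>0$ and $0$ otherwise; $\operatorname{sgn}^-(s)=-1$ if $s<0$ and $0$ otherwise. A *solution* of the problem $$\partial_t u+\partial_x f(t,u)=0 \ \text{ on } [0,T]\times\mathbb R_+,\qquad u(0,x)=u_o(x),\qquad u(t,0)=u_b(t)$$ is a map $u\in L^\infty([0,T]\times\mathbb R_+;\mathbb R)$, with final slice $u(T,\cdot)\in L^\infty(\mathbb R_+;\mathbb R)$, such that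 for every $k\in\mathcal U(u_o,u_b)$, every $\phi\in C^1_c(\mathbb R\times\mathbb R;[0,+\infty[)$ and both choices of the sign $\pm$ $$\begin{aligned} &\int_0^T\!\!\int_{\mathbb R_+}\Bigl\{(u-k)^\pm\,\partial_t\phi+\operatorname{sgn}^\pm(u-k)\,\bigl(f(t,u)-f(t,k)\bigr)\,\partial_x\phi\Bigr\}\,dx\,dt +\int_{\mathbb R_+}(u_o(x)-k)^\pm\phi(0,x)\,dx\\ &\quad-\int_{\mathbb R_+}(u(T,x)-k)^\pm\phi(T,x)\,dx +\|\partial_u f\|_{L^\infty([0,T]\times\mathcal U(u_o,u_b))}\int_0^T(u_b(t)-k)^\pm\phi(t,0)\,dt\ \ge 0 . \end{aligned}$$ (In particular, every $u$ that satisfies these inequalities for all $k\in\mathbb R$ is a solution.) Let $u$ and $\tilde u$ be solutions for the flux $f(t,u)=v(t)\,g(u)$ and the data $(u_o,u_b)$ and $(\tilde u_o,\tilde u_b)$ respectively, and assume that both admit a trace for $x\to0+$ for a.e. $t\in[0,T]$, i.e. for a.e. $t$ there is $\ell\in\mathbb R$ with $\lim_{\varepsilon\to0+}\frac1\varepsilon\int_0^\varepsilon|u(t,x)-\ell|\,dx=0$,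 and likewise for $\tilde u$. Then $u$ and $\tilde u$ have versions in $C([0,T];L^\infty(\mathbb R_+)\text{ weak-}*)$, with the same slices as $u$, respectively $\tilde u$, for a.e. $t$ and for $t=T$ (the slices of such a version are unique up to null sets, and $u(t)$, $\tilde u(t)$ denote them below), and for all $t\in[0,T]$ $$\|u(t)-\tilde u(t)\|_{L^1(\mathbb R_+)}\le\|u_o-\tilde u_o\|_{L^1(\mathbb R_+)}+\|v\|_{L^\infty([0,t])}\,\|g'\|_{L^\infty(\mathcal U)}\,\|u_b-\tilde u_b\|_{L^1([0,t])},\qquad \mathcal U=\mathcal U\bigl({u_b}_{|[0,t]},{\tilde u_b}_{|[0,t]}\bigr).$$ In particular, if $u_o=\tilde u_o$ a.e. and $u_b=\tilde u_b$ a.e., then $u=\tilde u$ a.e. on $[0,T]\times\mathbb R_+$. -/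

import Mathlib

open MeasureTheory Set Filter Topology
open scoped ENNReal

namespace HalfLineIBVP

noncomputable section

/-- `L¹ ∩ BV` on a real interval `I`: integrable, and almost everywhere equal on `I` to a function
of bounded variation (that is, the essential variation on `I` is finite). -/
def MemL1BV (w : ℝ → ℝ) (I : Set ℝ) : Prop :=
  IntegrableOn w I ∧ ∃ w' : ℝ → ℝ, w' =ᵐ[volume.restrict I] w ∧ BoundedVariationOn w' I

/-- The closed interval `𝒰(w₁, w₂)` spanned by the essential values of `w₁` on `I₁` and
of `w₂` on `I₂`. -/
def essHull (w₁ : ℝ → ℝ) (I₁ : Set ℝ) (w₂ : ℝ → ℝ) (I₂ : Set ℝ) : Set ℝ :=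
  Icc (min (essInf w₁ (volume.restrict I₁)) (essInf w₂ (volume.restrict I₂)))
    (max (essSup w₁ (volume.restrict I₁)) (essSup w₂ (volume.restrict I₂)))

/-- The positive part `s⁺`. -/
def pos (s : ℝ) : ℝ := max s 0

/-- The negative part `s⁻`. -/
def neg (s : ℝ) : ℝ := max (-s) 0

/-- `sgn⁺`. -/
def sgnPos (s : ℝ) : ℝ := if 0 < s then 1 else 0

/-- `sgn⁻`. -/
def sgnNeg (s : ℝ) : ℝ := if s < 0 then -1 else 0

/-- The norm `‖∂_u f‖` in `L^∞([0,T] × 𝒰)`, with `𝒰 = 𝒰(u_o, u_b|[0,T])`. -/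
def fluxLip (T : ℝ) (f : ℝ → ℝ → ℝ) (uo ub : ℝ → ℝ) : ℝ :=
  (eLpNorm (fun p : ℝ × ℝ => deriv (f p.1) p.2) ∞
    (volume.restrict (Icc 0 T ×ˢ essHull uo (Ioi 0) ub (Icc 0 T)))).toReal

/-- The left-hand side of the entropy inequality for the level `k` and the test function `φ`;
`(η, σ)` is `(s⁺, sgn⁺)` or `(s⁻, sgn⁻)`. -/
def entropyForm (T : ℝ) (f : ℝ → ℝ → ℝ) (uo ub : ℝ → ℝ) (u : ℝ → ℝ → ℝ)
    (η σ : ℝ → ℝ) (k : ℝ) (φ : ℝ × ℝ → ℝ) : ℝ :=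
  (∫ p in Icc 0 T ×ˢ Ioi 0,
      (η (u p.1 p.2 - k) * deriv (fun s => φ (s, p.2)) p.1
        + σ (u p.1 p.2 - k) * (f p.1 (u p.1 p.2) - f p.1 k) * deriv (fun y => φ (p.1, y)) p.2))
    + (∫ x in Ioi 0, η (uo x - k) * φ (0, x))
    - (∫ x in Ioi 0, η (u T x - k) * φ (T, x))
    + fluxLip T f uo ub * ∫ t in Icc 0 T, η (ub t - k) * φ (t, 0)

/-- Solutions of `∂_t u + ∂_x f(t,u) = 0` on `[0,T] × ℝ₊`, `u(0,·) = u_o`, `u(·,0) = u_b`.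
The entropy inequalities are only asked at the levels `k ∈ 𝒰(u_o, u_b)`, the range covered by the
constant `‖∂_u f‖` of `fluxLip`. A map which satisfies them for all `k : ℝ` is a fortiori a
solution (`isSolution_of_forall_level`), but for a flux which is not globally Lipschitz, such as
`f(u) = u (1 - u)`, there is in general no such map.
The field `memLp_final` says that the time slice `u(T,·)`, which enters the inequality, is
a function in `L^∞`. -/
structure IsSolution (T : ℝ) (f : ℝ → ℝ → ℝ) (uo ub : ℝ → ℝ) (u : ℝ → ℝ → ℝ) : Prop where
  memLp : MemLp (fun p : ℝ × ℝ => u p.1 p.2) ∞ (volume.restrict (Icc 0 T ×ˢ Ioi 0))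
  memLp_final : MemLp (u T) ∞ (volume.restrict (Ioi 0))
  entropy : ∀ k ∈ essHull uo (Ioi 0) ub (Icc 0 T),
    ∀ φ : ℝ × ℝ → ℝ, ContDiff ℝ 1 φ → HasCompactSupport φ → (∀ p, 0 ≤ φ p) →
      0 ≤ entropyForm T f uo ub u pos sgnPos k φ ∧ 0 ≤ entropyForm T f uo ub u neg sgnNeg k φ

theorem isSolution_of_forall_level {T : ℝ} {f : ℝ → ℝ → ℝ} {uo ub : ℝ → ℝ} {u : ℝ → ℝ → ℝ}
    (h₁ : MemLp (fun p : ℝ × ℝ => u p.1 p.2) ∞ (volume.restrict (Icc 0 T ×ˢ Ioi 0)))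
    (h₂ : MemLp (u T) ∞ (volume.restrict (Ioi 0)))
    (h₃ : ∀ k : ℝ, ∀ φ : ℝ × ℝ → ℝ, ContDiff ℝ 1 φ → HasCompactSupport φ → (∀ p, 0 ≤ φ p) →
      0 ≤ entropyForm T f uo ub u pos sgnPos k φ ∧
        0 ≤ entropyForm T f uo ub u neg sgnNeg k φ) :
    IsSolution T f uo ub u :=
  ⟨h₁, h₂, fun k _ => h₃ k⟩

/-- `u` admits a trace for `x → 0+` for a.e. `t ∈ [0,T]`, in the sense of averages; for a bounded
`u` this holds in particular wherever the (essential) limit of `u(t,x)` for `x → 0+` exists. -/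
def HasTrace (T : ℝ) (u : ℝ → ℝ → ℝ) : Prop :=
  ∀ᵐ t ∂(volume.restrict (Icc 0 T)), ∃ ℓ : ℝ,
    Tendsto (fun ε : ℝ => ε⁻¹ * ∫ x in Ioc 0 ε, |u t x - ℓ|) (𝓝[>] 0) (𝓝 0)

/-- `w` is the weakly-* continuous in time version of `u`, which gives a meaning to the slice
`u(t)` for every `t ∈ [0,T]`: it has the same slices as `u` for a.e. `t` and at the final
time, and `w ∈ C([0,T]; L^∞(ℝ₊) weak-*)`. Its slices are unique up to null sets. -/
structure IsTimeVersion (T : ℝ) (u w : ℝ → ℝ → ℝ) : Prop where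
  ae_eq : ∀ᵐ t ∂(volume.restrict (Icc 0 T)), w t =ᵐ[volume.restrict (Ioi 0)] u t
  final_eq : w T =ᵐ[volume.restrict (Ioi 0)] u T
  memLp : ∀ t ∈ Icc 0 T, MemLp (w t) ∞ (volume.restrict (Ioi 0))
  continuousOn : ∀ ψ : ℝ → ℝ, IntegrableOn ψ (Ioi 0) →
    ContinuousOn (fun t => ∫ x in Ioi 0, w t x * ψ x) (Icc 0 T)

end

end HalfLineIBVP

/-! The proof is Kružkov's doubling of variables in the open half-line. What crosses `x = 0` is then
controlled by the Bardos–Le Roux–Nédélec condition, which bounds the entropy flux between two traces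
by the boundary data alone.

Range of a solution. At the top level `M` of the data, both data terms of the inequality for `(u -
M)⁺` vanish. Testing with `e^{-t}` times a cut-off whose edge retreats at the maximal speed of
propagation forces `(u - M)⁺ = 0`; the bottom level `m` is symmetric (`ae_eq_zero_of_subsolution`,
`IsSolution.mem_Icc`). For `u` with values in `[m, M]`, a level outside this interval gives the
inequality of the nearest endpoint plus the integral of a constant state, which is zero. Hence all
levels become available. Extending `u` by its initial datum before `0`, by its final slice after
`T`, and `v` by zero, absorbs the initial and final terms into the equation: the extension is a
Kružkov solution on `ℝ × ℝ₊` (`IsSolution.isKruzkovSolution`).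

Interior. Doubling the variables gives Kato's inequality for two such extensions
(`IsKruzkovSolution.kato`). The extended speed `V` jumps at `0` and `T`, so the error coming from
`V(t) - V(s)` is controlled by continuity of translations in `L¹`, with a mollifier much narrower in
time than in space.

Boundary. Test functions concentrated at `x = 0` give `V (g (max τ k) - g k) ≤ L (u_b - k)⁺` for the
trace `τ`, and its mirror image (`IsTrace.ae_flux_le`). For `k ≥ u_b` the right side is zero and `V
> 0` divides out, so neither `L` nor `v` matters: `τ` is admissible for `u_b` and `g`. A discussion
of the order of the two traces and the two boundary values then bounds the Kružkov flux of the
traces by the Lipschitz constant of `g` between the boundary values times `|u_b - ũ_b|`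
(`IsAdmissibleTrace.sub_le`).

Estimate. Kato's inequality with a trapezoidal cut-off bounds averages of `‖u - ũ‖_{L¹(0,X)}` over
short time intervals ending at `t₀` (`IsKruzkovSolution.average_le`). To reach each single time, a
weak-* continuous version is built as the space derivative of a time-continuous primitive
(`IsKruzkovSolution.exists_weakStar_continuous`). Since the `L¹` norm is lower semicontinuous for
weak-* convergence, the averaged bound passes to its slices
(`IsWeakStarVersion.setIntegral_abs_sub_le`). -/

namespace HalfLineIBVP

/-! ### Partial derivatives of functions on the plane -/

/-- The derivative with respect to the first variable. -/
noncomputable def derivFst (φ : ℝ × ℝ → ℝ) (p : ℝ × ℝ) : ℝ := deriv (fun s => φ (s, p.2)) p.1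

/-- The derivative with respect to the second variable. -/
noncomputable def derivSnd (φ : ℝ × ℝ → ℝ) (p : ℝ × ℝ) : ℝ := deriv (fun y => φ (p.1, y)) p.2

theorem hasDerivAt_fderiv_fst {φ : ℝ × ℝ → ℝ} (hφ : ContDiff ℝ 1 φ) (p : ℝ × ℝ) :
    HasDerivAt (fun s => φ (s, p.2)) (fderiv ℝ φ p (1, 0)) p.1 := by
  have h1 : HasFDerivAt φ (fderiv ℝ φ p) p := (hφ.differentiable one_ne_zero p).hasFDerivAt
  have h2 : HasDerivAt (fun s : ℝ => (s, p.2)) ((1 : ℝ), (0 : ℝ)) p.1 :=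
    (hasDerivAt_id p.1).prodMk (hasDerivAt_const _ _)
  exact HasFDerivAt.comp_hasDerivAt (f := fun s : ℝ => (s, p.2)) (l := φ) p.1 h1 h2

theorem hasDerivAt_fderiv_snd {φ : ℝ × ℝ → ℝ} (hφ : ContDiff ℝ 1 φ) (p : ℝ × ℝ) :
    HasDerivAt (fun y => φ (p.1, y)) (fderiv ℝ φ p (0, 1)) p.2 := by
  have h1 : HasFDerivAt φ (fderiv ℝ φ p) p := (hφ.differentiable one_ne_zero p).hasFDerivAt
  have h2 : HasDerivAt (fun y : ℝ => (p.1, y)) ((0 : ℝ), (1 : ℝ)) p.2 :=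
    (hasDerivAt_const _ _).prodMk (hasDerivAt_id p.2)
  exact HasFDerivAt.comp_hasDerivAt (f := fun y : ℝ => (p.1, y)) (l := φ) p.2 h1 h2

theorem derivFst_eq {φ : ℝ × ℝ → ℝ} (hφ : ContDiff ℝ 1 φ) :
    derivFst φ = fun p => fderiv ℝ φ p (1, 0) :=
  funext fun p => (hasDerivAt_fderiv_fst hφ p).deriv

theorem derivSnd_eq {φ : ℝ × ℝ → ℝ} (hφ : ContDiff ℝ 1 φ) :
    derivSnd φ = fun p => fderiv ℝ φ p (0, 1) :=
  funext fun p => (hasDerivAt_fderiv_snd hφ p).deriv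

theorem hasDerivAt_derivFst {φ : ℝ × ℝ → ℝ} (hφ : ContDiff ℝ 1 φ) (p : ℝ × ℝ) :
    HasDerivAt (fun s => φ (s, p.2)) (derivFst φ p) p.1 :=
  (hasDerivAt_fderiv_fst hφ p).differentiableAt.hasDerivAt

theorem hasDerivAt_derivSnd {φ : ℝ × ℝ → ℝ} (hφ : ContDiff ℝ 1 φ) (p : ℝ × ℝ) :
    HasDerivAt (fun y => φ (p.1, y)) (derivSnd φ p) p.2 :=
  (hasDerivAt_fderiv_snd hφ p).differentiableAt.hasDerivAt

theorem continuous_derivFst {φ : ℝ × ℝ → ℝ} (hφ : ContDiff ℝ 1 φ) : Continuous (derivFst φ) := by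
  rw [derivFst_eq hφ]
  exact (hφ.continuous_fderiv one_ne_zero).clm_apply continuous_const

theorem continuous_derivSnd {φ : ℝ × ℝ → ℝ} (hφ : ContDiff ℝ 1 φ) : Continuous (derivSnd φ) := by
  rw [derivSnd_eq hφ]
  exact (hφ.continuous_fderiv one_ne_zero).clm_apply continuous_const

theorem hasCompactSupport_derivFst {φ : ℝ × ℝ → ℝ} (hφ : ContDiff ℝ 1 φ)
    (hc : HasCompactSupport φ) : HasCompactSupport (derivFst φ) := by
  rw [derivFst_eq hφ]
  exact hc.fderiv_apply (𝕜 := ℝ) _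

theorem hasCompactSupport_derivSnd {φ : ℝ × ℝ → ℝ} (hφ : ContDiff ℝ 1 φ)
    (hc : HasCompactSupport φ) : HasCompactSupport (derivSnd φ) := by
  rw [derivSnd_eq hφ]
  exact hc.fderiv_apply (𝕜 := ℝ) _

theorem derivFst_eq_zero_of_lt {φ : ℝ × ℝ → ℝ} {ε : ℝ} (h : ∀ p : ℝ × ℝ, p.2 < ε → φ p = 0)
    {p : ℝ × ℝ} (hp : p.2 < ε) : derivFst φ p = 0 := by
  have : (fun s => φ (s, p.2)) = fun _ => 0 := funext fun s => h _ hp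
  simp [derivFst, this]

theorem derivSnd_eq_zero_of_lt {φ : ℝ × ℝ → ℝ} {ε : ℝ} (h : ∀ p : ℝ × ℝ, p.2 < ε → φ p = 0)
    {p : ℝ × ℝ} (hp : p.2 < ε) : derivSnd φ p = 0 := by
  have : (fun y => φ (p.1, y)) =ᶠ[𝓝 p.2] fun _ => 0 := by
    filter_upwards [Iio_mem_nhds hp] with y hy using h _ hy
  simp [derivSnd, this.deriv_eq]

/-- A bounded measurable function times a continuous function with compact support is
integrable. -/
theorem integrable_bdd_mul {E : Type*} [TopologicalSpace E] [MeasurableSpace E] [BorelSpace E]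
    {μ : Measure E} [IsFiniteMeasureOnCompacts μ] {f w : E → ℝ} {C : ℝ}
    (hf : AEStronglyMeasurable f μ) (hC : ∀ x, |f x| ≤ C) (hw : Continuous w)
    (hc : HasCompactSupport w) : Integrable (fun x => f x * w x) μ :=
  (hw.integrable_of_hasCompactSupport hc).bdd_mul hf (Eventually.of_forall hC)

/-! ### Continuity of translations in `L¹` -/

/-- Approximation by a continuous function with compact support, for which uniform continuity
suffices. It will be applied both to the solution and to the discontinuous speed `V`. -/
theorem tendsto_integral_abs_translate_sub {E : Type*} [NormedAddCommGroup E] [MeasurableSpace E]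
    [BorelSpace E] [ProperSpace E] {μ : Measure E} [μ.IsAddHaarMeasure] {f : E → ℝ}
    (hf : Integrable f μ) :
    Tendsto (fun h => ∫ x, |f (x - h) - f x| ∂μ) (𝓝 0) (𝓝 0) := by
  rw [Metric.tendsto_nhds]
  intro ε hε
  obtain ⟨w, hwc, hfw, hw, hwi⟩ :=
    hf.exists_hasCompactSupport_integral_sub_le (ε := ε / 4) (by positivity)
  have htr : ∀ h : E, Integrable (fun x => f (x - h)) μ := fun h => hf.comp_sub_right h
  have htw : ∀ h : E, Integrable (fun x => w (x - h)) μ := fun h => hwi.comp_sub_right h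
  -- For `‖h‖ < 1`, both `w` and its translate vanish outside this neighbourhood, so the modulus of
  -- continuity is integrated over a set of finite measure `c` only.
  set K : Set E := Metric.cthickening 1 (tsupport w) with hK
  have hKc : IsCompact K := hwc.isCompact.cthickening
  have hKf : μ K ≠ ∞ := hKc.measure_lt_top.ne
  set c : ℝ := μ.real K with hcdef
  have hunif : UniformContinuous w := hw.uniformContinuous_of_tendsto_cocompact (x := 0)
    (hwc.is_zero_at_infty)
  obtain ⟨δ, hδ, hδw⟩ := Metric.uniformContinuous_iff.1 hunif (ε / (4 * (c + 1)))
    (by positivity)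
  filter_upwards [Metric.ball_mem_nhds (0 : E) (lt_min hδ one_pos)] with h hh
  rw [mem_ball_zero_iff, lt_min_iff] at hh
  rw [Real.dist_eq, sub_zero, abs_of_nonneg (integral_nonneg fun x => abs_nonneg _)]
  have h1 : ∫ x, |f (x - h) - w (x - h)| ∂μ ≤ ε / 4 := by
    rw [integral_sub_right_eq_self (fun x => |f x - w x|) h]
    simpa [Real.norm_eq_abs] using hfw
  have h3 : ∫ x, |w x - f x| ∂μ ≤ ε / 4 := by
    simpa [Real.norm_eq_abs, abs_sub_comm] using hfw
  have h2 : ∫ x, |w (x - h) - w x| ∂μ ≤ ε / 4 := by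
    have hb : ∀ x, |w (x - h) - w x| ≤ K.indicator (fun _ => ε / (4 * (c + 1))) x := by
      intro x
      by_cases hx : x ∈ K
      · rw [indicator_of_mem hx]
        have := hδw (a := x - h) (b := x) (by simpa [dist_eq_norm] using hh.1)
        exact (le_of_lt (by simpa [Real.dist_eq] using this))
      · rw [indicator_of_notMem hx]
        have hx1 : x ∉ tsupport w := fun hx' => hx (Metric.self_subset_cthickening _ hx')
        have hx2 : x - h ∉ tsupport w := fun hx' => hx <|
          Metric.mem_cthickening_of_dist_le x (x - h) 1 _ hx' (by simpa [dist_eq_norm] using hh.2.le)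
        simp [image_eq_zero_of_notMem_tsupport hx1, image_eq_zero_of_notMem_tsupport hx2]
    have hKm : MeasurableSet K := Metric.isClosed_cthickening.measurableSet
    calc ∫ x, |w (x - h) - w x| ∂μ
        ≤ ∫ x, K.indicator (fun _ => ε / (4 * (c + 1))) x ∂μ := by
          refine integral_mono ((htw h).sub hwi).abs ?_ hb
          exact (integrable_indicator_iff hKm).2 (integrableOn_const hKf)
      _ = c * (ε / (4 * (c + 1))) := by
          rw [integral_indicator hKm, setIntegral_const, smul_eq_mul]
      _ ≤ ε / 4 := by
          have hc0 : 0 ≤ c := measureReal_nonneg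
          rw [← mul_div_assoc, div_le_div_iff₀ (by positivity) (by positivity)]
          nlinarith
  calc ∫ x, |f (x - h) - f x| ∂μ
      ≤ ∫ x, (|f (x - h) - w (x - h)| + |w (x - h) - w x| + |w x - f x|) ∂μ := by
        refine integral_mono ((htr h).sub hf).abs ((((htr h).sub (htw h)).abs.add
          ((htw h).sub hwi).abs).add (hwi.sub hf).abs) fun x => ?_
        have := abs_sub_le (f (x - h)) (w (x - h)) (f x)
        have := abs_sub_le (w (x - h)) (w x) (f x)
        simp only
        linarith
    _ = ∫ x, |f (x - h) - w (x - h)| ∂μ + ∫ x, |w (x - h) - w x| ∂μ + ∫ x, |w x - f x| ∂μ := by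
        rw [integral_add, integral_add]
        · exact ((htr h).sub (htw h)).abs
        · exact ((htw h).sub hwi).abs
        · exact ((htr h).sub (htw h)).abs.add ((htw h).sub hwi).abs
        · exact (hwi.sub hf).abs
    _ < ε := by linarith

/-! ### The Kružkov flux -/

/-- The Kružkov flux `sgn (a - k) (g a - g k)`, written as a continuous function. -/
def kflux (g : ℝ → ℝ) (a k : ℝ) : ℝ := g (max a k) - g (min a k)

theorem kflux_comm (g : ℝ → ℝ) (a k : ℝ) : kflux g a k = kflux g k a := by
  simp [kflux, max_comm, min_comm]

theorem pos_add_neg (s : ℝ) : pos s + neg s = |s| := by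
  simp only [pos, neg]
  rcases le_total 0 s with h | h
  · rw [max_eq_left h, max_eq_right (by linarith), abs_of_nonneg h, add_zero]
  · rw [max_eq_right h, max_eq_left (by linarith), abs_of_nonpos h, zero_add]

/-- The jump of the sign is cancelled by the zero of the flux difference at `a = k`. The entropy
flux becomes a continuous function of `a`, and the two one-sided fluxes add up to `kflux`. -/
theorem sgnPos_mul (g : ℝ → ℝ) (c a k : ℝ) :
    sgnPos (a - k) * (c * g a - c * g k) = c * (g (max a k) - g k) := by
  unfold sgnPos
  split_ifs with h
  · rw [max_eq_left (by linarith)]; ring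
  · rw [max_eq_right (by linarith)]; ring

theorem sgnNeg_mul (g : ℝ → ℝ) (c a k : ℝ) :
    sgnNeg (a - k) * (c * g a - c * g k) = c * (g k - g (min a k)) := by
  unfold sgnNeg
  split_ifs with h
  · rw [min_eq_left (by linarith)]; ring
  · rw [min_eq_right (by linarith)]; ring

/-- A `C¹` flux is only locally Lipschitz; every state that occurs lies in a fixed `[-C, C]`, and
this `N` acts there as a bound for the speed of propagation. -/
theorem exists_lipschitz_bound {g : ℝ → ℝ} (hg : ContDiff ℝ 1 g) (C : ℝ) :
    ∃ N, 0 ≤ N ∧ ∀ a b, |a| ≤ C → |b| ≤ C → |g a - g b| ≤ N * |a - b| := by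
  obtain ⟨N, hN⟩ := (isCompact_Icc (a := -C) (b := C)).exists_bound_of_continuousOn
    (hg.continuous_deriv le_rfl).continuousOn
  refine ⟨max N 0, le_max_right _ _, fun a b ha hb => ?_⟩
  have := (convex_Icc (-C) C).norm_image_sub_le_of_norm_deriv_le (f := g) (C := max N 0)
    (fun x _ => hg.differentiable one_ne_zero x) (fun x hx => (hN x hx).trans (le_max_left _ _))
    (abs_le.1 hb) (abs_le.1 ha)
  simpa [Real.norm_eq_abs] using this

theorem abs_max_le {a b C : ℝ} (ha : |a| ≤ C) (hb : |b| ≤ C) : |max a b| ≤ C := by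
  rcases max_choice a b with h | h <;> rw [h] <;> assumption

theorem abs_min_le {a b C : ℝ} (ha : |a| ≤ C) (hb : |b| ≤ C) : |min a b| ≤ C := by
  rcases min_choice a b with h | h <;> rw [h] <;> assumption

theorem abs_kflux_le {g : ℝ → ℝ} {C N : ℝ}
    (hN : ∀ a b, |a| ≤ C → |b| ≤ C → |g a - g b| ≤ N * |a - b|) {a b : ℝ} (ha : |a| ≤ C)
    (hb : |b| ≤ C) : |kflux g a b| ≤ N * |a - b| := by
  have := hN _ _ (abs_max_le ha hb) (abs_min_le ha hb)
  rwa [max_sub_min_eq_abs, abs_abs, abs_sub_comm b a] at this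

theorem abs_kflux_sub_le {g : ℝ → ℝ} {C N : ℝ} (hN0 : 0 ≤ N)
    (hN : ∀ a b, |a| ≤ C → |b| ≤ C → |g a - g b| ≤ N * |a - b|) {a b a' b' : ℝ} (ha : |a| ≤ C)
    (hb : |b| ≤ C) (ha' : |a'| ≤ C) (hb' : |b'| ≤ C) :
    |kflux g a b - kflux g a' b'| ≤ 2 * N * (|a - a'| + |b - b'|) := by
  have h1 := hN _ _ (abs_max_le ha hb) (abs_max_le ha' hb')
  have h2 := hN _ _ (abs_min_le ha hb) (abs_min_le ha' hb')
  have h3 : |max a b - max a' b'| ≤ |a - a'| + |b - b'| :=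
    (abs_max_sub_max_le_max _ _ _ _).trans
      (max_le_add_of_nonneg (abs_nonneg _) (abs_nonneg _))
  have h4 : |min a b - min a' b'| ≤ |a - a'| + |b - b'| :=
    (abs_min_sub_min_le_max _ _ _ _).trans
      (max_le_add_of_nonneg (abs_nonneg _) (abs_nonneg _))
  have h5 : |kflux g a b - kflux g a' b'| ≤
      |g (max a b) - g (max a' b')| + |g (min a b) - g (min a' b')| := by
    unfold kflux
    have := abs_sub (g (max a b) - g (max a' b')) (g (min a b) - g (min a' b'))
    calc _ = |g (max a b) - g (max a' b') - (g (min a b) - g (min a' b'))| := by congr 1; ring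
      _ ≤ _ := this
  nlinarith

theorem continuous_kflux {g : ℝ → ℝ} (hg : Continuous g) :
    Continuous fun p : ℝ × ℝ => kflux g p.1 p.2 := by
  unfold kflux
  fun_prop

/-! ### Smooth cut-offs -/

/-- A smooth monotone function equal to `0` on `(-∞, 0]` and to `1` on `[1, ∞)`. -/
noncomputable abbrev ramp : ℝ → ℝ := Real.smoothTransition

theorem contDiff_ramp : ContDiff ℝ 1 ramp := Real.smoothTransition.contDiff (n := 1)

theorem hasDerivAt_ramp (x : ℝ) : HasDerivAt ramp (deriv ramp x) x :=
  (contDiff_ramp.differentiable one_ne_zero x).hasDerivAt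

theorem deriv_ramp_nonneg (x : ℝ) : 0 ≤ deriv ramp x :=
  Real.smoothTransition.monotone.deriv_nonneg

theorem continuous_deriv_ramp : Continuous (deriv ramp) := contDiff_ramp.continuous_deriv le_rfl

theorem deriv_ramp_of_lt {x : ℝ} (hx : x < 0) : deriv ramp x = 0 := by
  have : ramp =ᶠ[𝓝 x] fun _ => 0 := by
    filter_upwards [Iio_mem_nhds hx] with y hy using
      Real.smoothTransition.zero_of_nonpos (le_of_lt hy)
  simp [this.deriv_eq]

theorem deriv_ramp_of_gt {x : ℝ} (hx : 1 < x) : deriv ramp x = 0 := by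
  have : ramp =ᶠ[𝓝 x] fun _ => 1 := by
    filter_upwards [Ioi_mem_nhds hx] with y hy using
      Real.smoothTransition.one_of_one_le (le_of_lt hy)
  simp [this.deriv_eq]

theorem hasCompactSupport_deriv_ramp : HasCompactSupport (deriv ramp) := by
  refine HasCompactSupport.intro (isCompact_Icc (a := (0 : ℝ)) (b := 1)) fun x hx => ?_
  rw [mem_Icc, not_and_or, not_le, not_le] at hx
  exact hx.elim deriv_ramp_of_lt deriv_ramp_of_gt

theorem integrable_deriv_ramp : Integrable (deriv ramp) :=
  continuous_deriv_ramp.integrable_of_hasCompactSupport hasCompactSupport_deriv_ramp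

theorem integral_deriv_ramp : ∫ x, deriv ramp x = 1 := by
  have h : ∫ x in (0 : ℝ)..1, deriv ramp x = ramp 1 - ramp 0 :=
    intervalIntegral.integral_deriv_eq_sub (fun x _ => contDiff_ramp.differentiable one_ne_zero x)
      (continuous_deriv_ramp.intervalIntegrable _ _)
  rw [ramp, Real.smoothTransition.one, Real.smoothTransition.zero, sub_zero,
    intervalIntegral.integral_of_le zero_le_one, ← integral_Icc_eq_integral_Ioc] at h
  rw [← h, setIntegral_eq_integral_of_forall_compl_eq_zero]
  intro x hx
  rw [mem_Icc, not_and_or, not_le, not_le] at hx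
  exact hx.elim deriv_ramp_of_lt deriv_ramp_of_gt

theorem exists_deriv_ramp_le : ∃ c, 0 < c ∧ ∀ x, deriv ramp x ≤ c := by
  obtain ⟨c, hc⟩ := hasCompactSupport_deriv_ramp.exists_bound_of_continuous continuous_deriv_ramp
  exact ⟨max c 1, by positivity,
    fun x => (le_abs_self _).trans ((hc x).trans (le_max_left _ _))⟩

/-! ### Entropy solutions on `ℝ × ℝ₊` and the doubling of variables -/

/-- Bounded measurable Kružkov entropy solutions of `∂_t U + V(t) ∂_x g(U) = 0` on `ℝ × ℝ₊`, without
boundary condition. -/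
structure IsKruzkovSolution (g V : ℝ → ℝ) (C : ℝ) (U : ℝ × ℝ → ℝ) : Prop where
  measurable : Measurable U
  bdd : ∀ p, |U p| ≤ C
  entropy : ∀ (k : ℝ) (φ : ℝ × ℝ → ℝ), ContDiff ℝ 1 φ → HasCompactSupport φ → (∀ p, 0 ≤ φ p) →
    (∃ ε > 0, ∀ p : ℝ × ℝ, p.2 < ε → φ p = 0) →
    0 ≤ ∫ p, (|U p - k| * derivFst φ p + V p.1 * kflux g (U p) k * derivSnd φ p)

theorem hasCompactSupport_mul_sub {E : Type*} [NormedAddCommGroup E] {a b : E → ℝ}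
    (ha : HasCompactSupport a) (hb : HasCompactSupport b) :
    HasCompactSupport (fun z : E × E => a z.1 * b (z.1 - z.2)) := by
  refine HasCompactSupport.intro (ha.isCompact.prod
    ((ha.isCompact.prod hb.isCompact).image continuous_sub)) fun z hz => ?_
  by_contra h
  rw [mul_eq_zero, not_or] at h
  refine hz ⟨subset_tsupport _ h.1, ?_⟩
  exact ⟨(z.1, z.1 - z.2), ⟨subset_tsupport _ h.1, subset_tsupport _ h.2⟩, sub_sub_cancel _ _⟩

theorem hasCompactSupport_mul_prod {E F : Type*} [TopologicalSpace E] [TopologicalSpace F]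
    [R1Space E] [R1Space F] {a : E → ℝ} {b : F → ℝ}
    (ha : HasCompactSupport a) (hb : HasCompactSupport b) :
    HasCompactSupport (fun z : E × F => a z.1 * b z.2) := by
  refine HasCompactSupport.intro (ha.isCompact.prod hb.isCompact) fun z hz => ?_
  by_contra h
  rw [mul_eq_zero, not_or] at h
  exact hz ⟨subset_tsupport _ h.1, subset_tsupport _ h.2⟩

/-- The doubled entropy inequality, in the variables `p` and `z = p - q`. -/
theorem doubled_inequality {g V : ℝ → ℝ} {C Cv : ℝ} {U U' : ℝ × ℝ → ℝ} (hg : ContDiff ℝ 1 g)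
    (hVm : Measurable V) (hVb : ∀ t, |V t| ≤ Cv) (hU : IsKruzkovSolution g V C U)
    (hU' : IsKruzkovSolution g V C U') {φ : ℝ × ℝ → ℝ} (hφ : ContDiff ℝ 1 φ)
    (hφc : HasCompactSupport φ) (hφ0 : ∀ p, 0 ≤ φ p) {ε : ℝ} (hε : 0 < ε)
    (hφε : ∀ p : ℝ × ℝ, p.2 < ε → φ p = 0) {ρ₁ ρ₂ : ℝ → ℝ} (h₁ : ContDiff ℝ 1 ρ₁)
    (h₂ : ContDiff ℝ 1 ρ₂) (h₁c : HasCompactSupport ρ₁) (h₂c : HasCompactSupport ρ₂)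
    (h₁0 : ∀ x, 0 ≤ ρ₁ x) (h₂0 : ∀ x, 0 ≤ ρ₂ x) (h₂ε : ∀ x, ε / 2 ≤ |x| → ρ₂ x = 0) :
    Integrable (fun z : ℝ × ℝ => ρ₁ z.1 * ρ₂ z.2 *
        (∫ p, (|U p - U' (p - z)| * derivFst φ p
          + V p.1 * kflux g (U p) (U' (p - z)) * derivSnd φ p))
        + ρ₁ z.1 * deriv ρ₂ z.2 *
          ∫ p : ℝ × ℝ, (V p.1 - V (p.1 - z.1)) * kflux g (U p) (U' (p - z)) * φ p) ∧
    0 ≤ ∫ z : ℝ × ℝ, (ρ₁ z.1 * ρ₂ z.2 *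
        (∫ p, (|U p - U' (p - z)| * derivFst φ p
          + V p.1 * kflux g (U p) (U' (p - z)) * derivSnd φ p))
        + ρ₁ z.1 * deriv ρ₂ z.2 *
          ∫ p : ℝ × ℝ, (V p.1 - V (p.1 - z.1)) * kflux g (U p) (U' (p - z)) * φ p) := by
  obtain ⟨N, hN0, hN⟩ := exists_lipschitz_bound hg C
  have hC0 : 0 ≤ C := (abs_nonneg _).trans (hU.bdd 0)
  have hCv0 : 0 ≤ Cv := (abs_nonneg _).trans (hVb 0)
  set ρ : ℝ × ℝ → ℝ := fun z => ρ₁ z.1 * ρ₂ z.2 with hρ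
  have hρd : ContDiff ℝ 1 ρ := (h₁.comp contDiff_fst).mul (h₂.comp contDiff_snd)
  have hρc : HasCompactSupport ρ := hasCompactSupport_mul_prod h₁c h₂c
  have hρ0 : ∀ z, 0 ≤ ρ z := fun z => mul_nonneg (h₁0 _) (h₂0 _)
  have hdF : derivFst ρ = fun z => deriv ρ₁ z.1 * ρ₂ z.2 := by
    funext z
    change deriv (fun s => ρ₁ s * ρ₂ z.2) z.1 = _
    exact (((h₁.differentiable one_ne_zero _).hasDerivAt).mul_const _).deriv
  have hdS : derivSnd ρ = fun z => ρ₁ z.1 * deriv ρ₂ z.2 := by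
    funext z
    change deriv (fun y => ρ₁ z.1 * ρ₂ y) z.2 = _
    exact (((h₂.differentiable one_ne_zero _).hasDerivAt).const_mul _).deriv
  have cφ := hφ.continuous
  have cFφ := continuous_derivFst hφ
  have cSφ := continuous_derivSnd hφ
  have cρ := hρd.continuous
  have cFρ := continuous_derivFst hρd
  have cSρ := continuous_derivSnd hρd
  have kFφ := hasCompactSupport_derivFst hφ hφc
  have kSφ := hasCompactSupport_derivSnd hφ hφc
  have kFρ := hasCompactSupport_derivFst hρd hρc
  have kSρ := hasCompactSupport_derivSnd hρd hρc
  have mk : Measurable fun p : ℝ × ℝ => kflux g p.1 p.2 :=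
    (continuous_kflux hg.continuous).measurable
  have bk : ∀ p q, |kflux g (U p) (U' q)| ≤ N * (2 * C) := fun p q =>
    (abs_kflux_le hN (hU.bdd p) (hU'.bdd q)).trans <| by
      gcongr
      exact (abs_sub _ _).trans (by linarith [hU.bdd p, hU'.bdd q])
  have ba : ∀ p q, |(|U p - U' q|)| ≤ 2 * C := fun p q => by
    rw [abs_abs]
    exact (abs_sub _ _).trans (by linarith [hU.bdd p, hU'.bdd q])
  -- the two families of entropy inequalities
  set F₁ : (ℝ × ℝ) × (ℝ × ℝ) → ℝ := fun w =>
    |U w.1 - U' w.2| * (derivFst φ w.1 * ρ (w.1 - w.2) + φ w.1 * derivFst ρ (w.1 - w.2))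
    + V w.1.1 * kflux g (U w.1) (U' w.2) *
      (derivSnd φ w.1 * ρ (w.1 - w.2) + φ w.1 * derivSnd ρ (w.1 - w.2)) with hF₁
  set F₂ : (ℝ × ℝ) × (ℝ × ℝ) → ℝ := fun w =>
    |U w.1 - U' w.2| * (φ w.1 * (-derivFst ρ (w.1 - w.2)))
    + V w.2.1 * kflux g (U w.1) (U' w.2) * (φ w.1 * (-derivSnd ρ (w.1 - w.2))) with hF₂
  have mU : Measurable fun w : (ℝ × ℝ) × (ℝ × ℝ) => U w.1 := hU.measurable.comp measurable_fst
  have mU' : Measurable fun w : (ℝ × ℝ) × (ℝ × ℝ) => U' w.2 := hU'.measurable.comp measurable_snd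
  have mA : Measurable fun w : (ℝ × ℝ) × (ℝ × ℝ) => |U w.1 - U' w.2| :=
    (continuous_abs.measurable).comp (mU.sub mU')
  have mK : Measurable fun w : (ℝ × ℝ) × (ℝ × ℝ) => kflux g (U w.1) (U' w.2) :=
    mk.comp (mU.prodMk mU')
  have bVK : ∀ (t : ℝ) p q, |V t * kflux g (U p) (U' q)| ≤ Cv * (N * (2 * C)) := fun t p q => by
    rw [abs_mul]
    exact mul_le_mul (hVb _) (bk _ _) (abs_nonneg _) hCv0
  have iF₁ : Integrable F₁ := by
    refine Integrable.add ?_ ?_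
    · refine integrable_bdd_mul mA.aestronglyMeasurable (fun w => ba _ _) (by fun_prop) ?_
      exact (hasCompactSupport_mul_sub kFφ hρc).add (hasCompactSupport_mul_sub hφc kFρ)
    · refine integrable_bdd_mul ((hVm.comp (measurable_fst.comp measurable_fst)).mul
        mK).aestronglyMeasurable (fun w => bVK _ _ _) (by fun_prop) ?_
      exact (hasCompactSupport_mul_sub kSφ hρc).add (hasCompactSupport_mul_sub hφc kSρ)
  have iF₂ : Integrable F₂ := by
    refine Integrable.add ?_ ?_
    · refine integrable_bdd_mul mA.aestronglyMeasurable (fun w => ba _ _) (by fun_prop) ?_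
      exact hasCompactSupport_mul_sub (b := fun z => -derivFst ρ z) hφc kFρ.neg
    · refine integrable_bdd_mul ((hVm.comp (measurable_fst.comp measurable_snd)).mul
        mK).aestronglyMeasurable (fun w => bVK _ _ _) (by fun_prop) ?_
      exact hasCompactSupport_mul_sub (b := fun z => -derivSnd ρ z) hφc kSρ.neg
  have pF₁ : 0 ≤ ∫ w, F₁ w := by
    rw [Measure.volume_eq_prod, integral_prod_symm _ iF₁]
    refine integral_nonneg fun q => ?_
    have hd : ContDiff ℝ 1 fun p => φ p * ρ (p - q) :=
      hφ.mul (hρd.comp (contDiff_id.sub contDiff_const))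
    have := hU.entropy (U' q) (fun p => φ p * ρ (p - q)) hd hφc.mul_right
      (fun p => mul_nonneg (hφ0 _) (hρ0 _)) ⟨ε, hε, fun p hp => by simp [hφε p hp]⟩
    refine this.trans_eq (integral_congr_ae (Eventually.of_forall fun p => ?_))
    have e1 : derivFst (fun p => φ p * ρ (p - q)) p
        = derivFst φ p * ρ (p - q) + φ p * derivFst ρ (p - q) :=
      ((hasDerivAt_derivFst hφ p).mul
        ((hasDerivAt_derivFst hρd (p - q)).comp_sub_const p.1 q.1)).deriv
    have e2 : derivSnd (fun p => φ p * ρ (p - q)) p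
        = derivSnd φ p * ρ (p - q) + φ p * derivSnd ρ (p - q) :=
      ((hasDerivAt_derivSnd hφ p).mul
        ((hasDerivAt_derivSnd hρd (p - q)).comp_sub_const p.2 q.2)).deriv
    simp only [e1, e2, hF₁]
  have pF₂ : 0 ≤ ∫ w, F₂ w := by
    rw [Measure.volume_eq_prod, integral_prod _ iF₂]
    refine integral_nonneg fun p => ?_
    have hd : ContDiff ℝ 1 fun q => φ p * ρ (p - q) :=
      contDiff_const.mul (hρd.comp (contDiff_const.sub contDiff_id))
    have hc : HasCompactSupport fun q => φ p * ρ (p - q) :=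
      (hρc.comp_homeomorph (Homeomorph.subLeft p)).mul_left
    -- In the variable `q` the test function must also vanish near the boundary. If `φ p ≠ 0` then
    -- `p.2 ≥ ε`, and the kernel keeps `q.2` within `ε / 2` of `p.2`.
    have := hU'.entropy (U p) (fun q => φ p * ρ (p - q)) hd hc
      (fun p => mul_nonneg (hφ0 _) (hρ0 _)) ⟨ε / 2, by positivity, fun q hq => by
        by_cases hp : p.2 < ε
        · simp [hφε p hp]
        · have : ρ₂ (p.2 - q.2) = 0 := h₂ε _ (by
            rw [abs_of_nonneg] <;> linarith)
          simp [hρ, this]⟩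
    refine this.trans_eq (integral_congr_ae (Eventually.of_forall fun q => ?_))
    have e1 : derivFst (fun q => φ p * ρ (p - q)) q = φ p * (-derivFst ρ (p - q)) :=
      (((hasDerivAt_derivFst hρd (p - q)).comp_const_sub p.1 q.1).const_mul (φ p)).deriv
    have e2 : derivSnd (fun q => φ p * ρ (p - q)) q = φ p * (-derivSnd ρ (p - q)) :=
      (((hasDerivAt_derivSnd hρd (p - q)).comp_const_sub p.2 q.2).const_mul (φ p)).deriv
    simp only [e1, e2, hF₂, abs_sub_comm (U' q), kflux_comm g (U' q)]
  -- the sum of the two, in the new variables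
  set H : (ℝ × ℝ) × (ℝ × ℝ) → ℝ := fun w =>
    |U w.1 - U' (w.1 - w.2)| * (derivFst φ w.1 * ρ w.2)
    + V w.1.1 * kflux g (U w.1) (U' (w.1 - w.2)) * (derivSnd φ w.1 * ρ w.2)
    + (V w.1.1 - V (w.1.1 - w.2.1)) * kflux g (U w.1) (U' (w.1 - w.2)) *
      (φ w.1 * derivSnd ρ w.2) with hH
  have mU'' : Measurable fun w : (ℝ × ℝ) × (ℝ × ℝ) => U' (w.1 - w.2) :=
    hU'.measurable.comp (measurable_fst.sub measurable_snd)
  have mK' : Measurable fun w : (ℝ × ℝ) × (ℝ × ℝ) => kflux g (U w.1) (U' (w.1 - w.2)) :=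
    mk.comp (mU.prodMk mU'')
  have mV : Measurable fun w : (ℝ × ℝ) × (ℝ × ℝ) => V w.1.1 :=
    hVm.comp (measurable_fst.comp measurable_fst)
  have mV' : Measurable fun w : (ℝ × ℝ) × (ℝ × ℝ) => V (w.1.1 - w.2.1) :=
    hVm.comp ((measurable_fst.comp measurable_fst).sub (measurable_fst.comp measurable_snd))
  have iH : Integrable H := by
    refine (Integrable.add ?_ ?_).add ?_
    · refine integrable_bdd_mul ((continuous_abs.measurable).comp
        (mU.sub mU'')).aestronglyMeasurable (fun w => ba _ _) (by fun_prop) ?_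
      exact hasCompactSupport_mul_prod kFφ hρc
    · exact integrable_bdd_mul (mV.mul mK').aestronglyMeasurable (fun w => bVK _ _ _) (by fun_prop)
        (hasCompactSupport_mul_prod kSφ hρc)
    · refine integrable_bdd_mul (C := 2 * (Cv * (N * (2 * C)))) ((mV.sub mV').mul
        mK').aestronglyMeasurable (fun w => ?_) (by fun_prop) (hasCompactSupport_mul_prod hφc kSρ)
      rw [sub_mul]
      have b1 := bVK w.1.1 w.1 (w.1 - w.2)
      have b2 := bVK (w.1.1 - w.2.1) w.1 (w.1 - w.2)
      exact (abs_sub _ _).trans (by linarith)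
  -- Because `φ` depends on `p` alone, the time derivatives of `ρ` cancel in the sum. Its space
  -- derivatives survive with the factor `V(p.1) - V(q.1)` only. Then `q = p - z` for fixed `p`.
  have hsum : ∫ w, (F₁ w + F₂ w) = ∫ w, H w := by
    rw [Measure.volume_eq_prod, integral_prod (fun w => F₁ w + F₂ w) (iF₁.add iF₂),
      integral_prod _ iH]
    refine integral_congr_ae (Eventually.of_forall fun p => ?_)
    simp only
    rw [← integral_sub_left_eq_self (fun q => F₁ (p, q) + F₂ (p, q)) _ p]
    refine integral_congr_ae (Eventually.of_forall fun z => ?_)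
    simp only [hF₁, hF₂, hH, sub_sub_cancel, Prod.fst_sub]
    ring
  have hin : ∀ᵐ z : ℝ × ℝ, ∫ p, H (p, z) = ρ₁ z.1 * ρ₂ z.2 *
        (∫ p, (|U p - U' (p - z)| * derivFst φ p
          + V p.1 * kflux g (U p) (U' (p - z)) * derivSnd φ p))
        + ρ₁ z.1 * deriv ρ₂ z.2 *
          ∫ p : ℝ × ℝ, (V p.1 - V (p.1 - z.1)) * kflux g (U p) (U' (p - z)) * φ p := by
    refine Eventually.of_forall fun z => ?_
    have mUz : Measurable fun p : ℝ × ℝ => U' (p - z) :=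
      hU'.measurable.comp (measurable_id.sub measurable_const)
    have mKz : Measurable fun p : ℝ × ℝ => kflux g (U p) (U' (p - z)) :=
      mk.comp (hU.measurable.prodMk mUz)
    have j1 : Integrable fun p => |U p - U' (p - z)| * derivFst φ p :=
      integrable_bdd_mul ((continuous_abs.measurable).comp
        (hU.measurable.sub mUz)).aestronglyMeasurable (fun w => ba _ _) cFφ kFφ
    have j2 : Integrable fun p => V p.1 * kflux g (U p) (U' (p - z)) * derivSnd φ p :=
      integrable_bdd_mul ((hVm.comp measurable_fst).mul mKz).aestronglyMeasurable
        (fun w => bVK _ _ _) cSφ kSφ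
    have j3 : Integrable fun p : ℝ × ℝ =>
        (V p.1 - V (p.1 - z.1)) * kflux g (U p) (U' (p - z)) * φ p := by
      refine integrable_bdd_mul (C := 2 * (Cv * (N * (2 * C)))) (((hVm.comp measurable_fst).sub
        (hVm.comp (measurable_fst.sub measurable_const))).mul mKz).aestronglyMeasurable
        (fun w => ?_) cφ hφc
      rw [sub_mul]
      exact (abs_sub _ _).trans (by linarith [bVK w.1 w (w - z), bVK (w.1 - z.1) w (w - z)])
    have j12 : Integrable fun p => |U p - U' (p - z)| * derivFst φ p
        + V p.1 * kflux g (U p) (U' (p - z)) * derivSnd φ p := j1.add j2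
    rw [← integral_const_mul, ← integral_const_mul, ← integral_add (j12.const_mul _)
      (j3.const_mul _)]
    refine integral_congr_ae (Eventually.of_forall fun p => ?_)
    simp only [hH, hdS]
    simp only [hρ]
    ring
  have hI := iH.integral_prod_right
  refine ⟨hI.congr hin, ?_⟩
  rw [← integral_congr_ae hin, ← integral_prod_symm _ iH, ← Measure.volume_eq_prod, ← hsum,
    integral_add iF₁ iF₂]
  exact add_nonneg pF₁ pF₂

/-- Local version of the continuity of translations in `L¹`. -/
theorem tendsto_integral_abs_translate_sub_mul {E : Type*} [NormedAddCommGroup E]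
    [MeasurableSpace E] [BorelSpace E] [ProperSpace E] {μ : Measure E} [μ.IsAddHaarMeasure]
    {f w : E → ℝ} {C : ℝ} (hf : Measurable f) (hC : ∀ x, |f x| ≤ C) (hw : Continuous w)
    (hwc : HasCompactSupport w) :
    Tendsto (fun h => ∫ x, |f (x - h) - f x| * |w x| ∂μ) (𝓝 0) (𝓝 0) := by
  obtain ⟨D, hD⟩ := hwc.exists_bound_of_continuous hw
  set K : Set E := Metric.cthickening 1 (tsupport w) with hK
  have hKc : IsCompact K := hwc.isCompact.cthickening
  have hKm : MeasurableSet K := Metric.isClosed_cthickening.measurableSet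
  have hfi : Integrable (K.indicator f) μ := by
    rw [integrable_indicator_iff hKm]
    exact Measure.integrableOn_of_bounded (M := C) hKc.measure_lt_top.ne hf.aestronglyMeasurable
      (Eventually.of_forall hC)
  have hlim := (tendsto_integral_abs_translate_sub hfi).const_mul D
  rw [mul_zero] at hlim
  refine squeeze_zero' (Eventually.of_forall fun h => integral_nonneg fun x => by positivity) ?_
    hlim
  filter_upwards [Metric.ball_mem_nhds (0 : E) one_pos] with h hh
  rw [mem_ball_zero_iff] at hh
  rw [← integral_const_mul]
  have hsub : Integrable (fun x => |K.indicator f (x - h) - K.indicator f x|) μ :=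
    ((hfi.comp_sub_right h).sub hfi).abs
  refine integral_mono_of_nonneg (Eventually.of_forall fun x => by positivity)
    (hsub.const_mul D) (Eventually.of_forall fun x => ?_)
  simp only
  by_cases hx : x ∈ tsupport w
  · have hx1 : x ∈ K := Metric.self_subset_cthickening _ hx
    have hx2 : x - h ∈ K := Metric.mem_cthickening_of_dist_le (x - h) x 1 _ hx
      (by simpa [dist_eq_norm] using hh.le)
    rw [indicator_of_mem hx1, indicator_of_mem hx2, mul_comm]
    exact mul_le_mul_of_nonneg_right (hD x) (abs_nonneg _)
  · rw [image_eq_zero_of_notMem_tsupport hx, abs_zero, mul_zero]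
    exact mul_nonneg ((norm_nonneg _).trans (hD x)) (abs_nonneg _)

/-- Kato's inequality for two entropy solutions. -/
theorem IsKruzkovSolution.kato {g V : ℝ → ℝ} {C Cv : ℝ} {U U' : ℝ × ℝ → ℝ}
    (hU : IsKruzkovSolution g V C U) (hU' : IsKruzkovSolution g V C U') (hg : ContDiff ℝ 1 g)
    (hVm : Measurable V) (hVb : ∀ t, |V t| ≤ Cv) (hVi : Integrable V) {φ : ℝ × ℝ → ℝ}
    (hφ : ContDiff ℝ 1 φ) (hφc : HasCompactSupport φ) (hφ0 : ∀ p, 0 ≤ φ p) {ε : ℝ} (hε : 0 < ε)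
    (hφε : ∀ p : ℝ × ℝ, p.2 < ε → φ p = 0) :
    0 ≤ ∫ p, (|U p - U' p| * derivFst φ p + V p.1 * kflux g (U p) (U' p) * derivSnd φ p) := by
  obtain ⟨N, hN0, hN⟩ := exists_lipschitz_bound hg C
  have hC0 : 0 ≤ C := (abs_nonneg _).trans (hU.bdd 0)
  have hCv0 : 0 ≤ Cv := (abs_nonneg _).trans (hVb 0)
  have cFφ := continuous_derivFst hφ
  have cSφ := continuous_derivSnd hφ
  have kFφ := hasCompactSupport_derivFst hφ hφc
  have kSφ := hasCompactSupport_derivSnd hφ hφc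
  have mk : Measurable fun p : ℝ × ℝ => kflux g p.1 p.2 :=
    (continuous_kflux hg.continuous).measurable
  have bk : ∀ p q, |kflux g (U p) (U' q)| ≤ N * (2 * C) := fun p q =>
    (abs_kflux_le hN (hU.bdd p) (hU'.bdd q)).trans <| by
      gcongr
      exact (abs_sub _ _).trans (by linarith [hU.bdd p, hU'.bdd q])
  have ba : ∀ p q, |(|U p - U' q|)| ≤ 2 * C := fun p q => by
    rw [abs_abs]
    exact (abs_sub _ _).trans (by linarith [hU.bdd p, hU'.bdd q])
  have bVK : ∀ (t : ℝ) p q, |V t * kflux g (U p) (U' q)| ≤ Cv * (N * (2 * C)) := fun t p q => by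
    rw [abs_mul]
    exact mul_le_mul (hVb _) (bk _ _) (abs_nonneg _) hCv0
  set J : ℝ × ℝ → ℝ := fun z => ∫ p, (|U p - U' (p - z)| * derivFst φ p
    + V p.1 * kflux g (U p) (U' (p - z)) * derivSnd φ p) with hJ
  have hJi : ∀ z, Integrable fun p => |U p - U' (p - z)| * derivFst φ p
      + V p.1 * kflux g (U p) (U' (p - z)) * derivSnd φ p := by
    intro z
    have mUz : Measurable fun p : ℝ × ℝ => U' (p - z) :=
      hU'.measurable.comp (measurable_id.sub measurable_const)
    exact (integrable_bdd_mul ((continuous_abs.measurable).comp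
        (hU.measurable.sub mUz)).aestronglyMeasurable (fun w => ba _ _) cFφ kFφ).add
      (integrable_bdd_mul ((hVm.comp measurable_fst).mul
        (mk.comp (hU.measurable.prodMk mUz))).aestronglyMeasurable (fun w => bVK _ _ _) cSφ kSφ)
  -- continuity of `J` at the origin
  have hJlim : Tendsto (fun z => |J z - J 0|) (𝓝 0) (𝓝 0) := by
    have l1 := tendsto_integral_abs_translate_sub_mul (μ := volume) hU'.measurable hU'.bdd cFφ kFφ
    have l2 := tendsto_integral_abs_translate_sub_mul (μ := volume) hU'.measurable hU'.bdd cSφ kSφ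
    have l3 := l1.add (l2.const_mul (Cv * (2 * N)))
    rw [mul_zero, add_zero] at l3
    refine squeeze_zero (fun z => abs_nonneg _) (fun z => ?_) l3
    have mUz : Measurable fun p : ℝ × ℝ => |U' (p - z) - U' p| :=
      continuous_abs.measurable.comp
        ((hU'.measurable.comp (measurable_id.sub measurable_const)).sub hU'.measurable)
    have bUz : ∀ p, |(|U' (p - z) - U' p|)| ≤ 2 * C := fun p => by
      rw [abs_abs]
      exact (abs_sub _ _).trans (by linarith [hU'.bdd p, hU'.bdd (p - z)])
    have i1 : Integrable fun p => |U' (p - z) - U' p| * |derivFst φ p| :=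
      integrable_bdd_mul mUz.aestronglyMeasurable bUz cFφ.abs kFφ.abs
    have i2 : Integrable fun p => |U' (p - z) - U' p| * |derivSnd φ p| :=
      integrable_bdd_mul mUz.aestronglyMeasurable bUz cSφ.abs kSφ.abs
    rw [hJ]
    simp only
    rw [← integral_sub (hJi z) (hJi 0), ← integral_const_mul, ← integral_add i1 (i2.const_mul _)]
    refine (abs_integral_le_integral_abs).trans
      (integral_mono ((hJi z).sub (hJi 0)).abs (i1.add (i2.const_mul _)) fun p => ?_)
    simp only [sub_zero]
    set a := U p
    set b := U' (p - z)
    set c := U' p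
    have e1 : |(|a - b| - |a - c|) * derivFst φ p| ≤ |b - c| * |derivFst φ p| := by
      rw [abs_mul]
      refine mul_le_mul_of_nonneg_right ?_ (abs_nonneg _)
      have := abs_abs_sub_abs_le_abs_sub (a - b) (a - c)
      rwa [show a - b - (a - c) = -(b - c) by ring, abs_neg] at this
    have e2 : |V p.1 * (kflux g a b - kflux g a c) * derivSnd φ p| ≤
        Cv * (2 * N) * (|b - c| * |derivSnd φ p|) := by
      have := abs_kflux_sub_le hN0 hN (hU.bdd p) (hU'.bdd (p - z)) (hU.bdd p) (hU'.bdd p)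
      rw [sub_self, abs_zero, zero_add] at this
      rw [abs_mul, abs_mul]
      calc |V p.1| * |kflux g a b - kflux g a c| * |derivSnd φ p|
          ≤ Cv * (2 * N * |b - c|) * |derivSnd φ p| := by
            refine mul_le_mul_of_nonneg_right ?_ (abs_nonneg _)
            exact mul_le_mul (hVb _) this (abs_nonneg _) hCv0
        _ = _ := by ring
    calc |(|a - b|) * derivFst φ p + V p.1 * kflux g a b * derivSnd φ p
          - (|a - c| * derivFst φ p + V p.1 * kflux g a c * derivSnd φ p)|
        = |(|a - b| - |a - c|) * derivFst φ p
          + V p.1 * (kflux g a b - kflux g a c) * derivSnd φ p| := by congr 1; ring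
      _ ≤ _ := (abs_add_le _ _).trans (add_le_add e1 e2)
  suffices h : ∀ η > 0, 0 ≤ J 0 + η by
    have := le_of_forall_pos_le_add h
    simpa [hJ] using this
  intro η hη
  -- Half of `η` pays for the distance from `J z` to `J 0`, the other half for the time dependence
  -- of the flux. The bound `ε / 2` on the space radius is the one required by the doubling.
  obtain ⟨r, hr, hrJ⟩ := Metric.tendsto_nhds_nhds.1 hJlim (η / 2) (by positivity)
  set r' := min r (ε / 2) with hr'
  have hr'0 : 0 < r' := lt_min hr (by positivity)
  let b₂ : ContDiffBump (0 : ℝ) := ⟨r' / 2, r', by positivity, by linarith⟩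
  set ρ₂ := b₂.normed volume with hρ₂
  have h₂ : ContDiff ℝ 1 ρ₂ := b₂.contDiff_normed
  have h₂z : ∀ x, r' ≤ |x| → ρ₂ x = 0 := fun x hx => by
    by_contra h
    have : x ∈ Function.support ρ₂ := h
    rw [hρ₂, b₂.support_normed_eq, mem_ball_zero_iff, Real.norm_eq_abs] at this
    exact absurd this (not_lt.2 hx)
  have h₂c : HasCompactSupport ρ₂ := b₂.hasCompactSupport_normed
  have c₂' : Continuous (deriv ρ₂) := h₂.continuous_deriv le_rfl
  have i₂' : Integrable fun x => |deriv ρ₂ x| :=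
    (c₂'.integrable_of_hasCompactSupport h₂c.deriv).abs
  set Q := ∫ x, |deriv ρ₂ x| with hQ
  have hQ0 : 0 ≤ Q := integral_nonneg fun x => abs_nonneg _
  -- the remainder due to the dependence of the flux on time
  obtain ⟨R, hR⟩ := hφc.isCompact.isBounded.subset_closedBall 0
  obtain ⟨Mφ, hMφ⟩ := hφc.exists_bound_of_continuous hφ.continuous
  have hMφ0 : 0 ≤ Mφ := (norm_nonneg _).trans (hMφ 0)
  set I : Set ℝ := Icc (-R) R with hI
  -- Bounds for the flux and for `φ`, times the length of the space interval containing the support.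
  -- The time integral of `|V(t - z.1) - V(t)|` is kept whole, over `ℝ`.
  set A := N * (2 * C) * Mφ * volume.real I with hA
  have hA0 : 0 ≤ A := by positivity
  have hK : ∀ z : ℝ × ℝ,
      |∫ p : ℝ × ℝ, (V p.1 - V (p.1 - z.1)) * kflux g (U p) (U' (p - z)) * φ p|
        ≤ A * ∫ t, |V (t - z.1) - V t| := by
    intro z
    have iV : Integrable fun t => |V (t - z.1) - V t| := ((hVi.comp_sub_right z.1).sub hVi).abs
    have iI : Integrable (I.indicator fun _ => (1 : ℝ)) :=
      (integrable_indicator_iff measurableSet_Icc).2 (integrableOn_const measure_Icc_lt_top.ne)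
    have iprod : Integrable fun p : ℝ × ℝ =>
        |V (p.1 - z.1) - V p.1| * I.indicator (fun _ => (1 : ℝ)) p.2 := iV.mul_prod iI
    have hval : ∫ p : ℝ × ℝ, |V (p.1 - z.1) - V p.1| * I.indicator (fun _ => (1 : ℝ)) p.2
        = (∫ t, |V (t - z.1) - V t|) * volume.real I := by
      rw [Measure.volume_eq_prod, integral_prod_mul (fun t => |V (t - z.1) - V t|)
        (I.indicator fun _ => (1 : ℝ)), integral_indicator measurableSet_Icc, setIntegral_const,
        smul_eq_mul, mul_one]
    calc |∫ p : ℝ × ℝ, (V p.1 - V (p.1 - z.1)) * kflux g (U p) (U' (p - z)) * φ p|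
        ≤ ∫ p : ℝ × ℝ, N * (2 * C) * Mφ *
            (|V (p.1 - z.1) - V p.1| * I.indicator (fun _ => (1 : ℝ)) p.2) := by
          refine (abs_integral_le_integral_abs).trans (integral_mono_of_nonneg
            (Eventually.of_forall fun p => abs_nonneg _) (iprod.const_mul _)
            (Eventually.of_forall fun p => ?_))
          simp only
          by_cases hp : p ∈ tsupport φ
          · have hp' : p.2 ∈ I := by
              have := hR hp
              rw [mem_closedBall_zero_iff, Prod.norm_def, max_le_iff] at this
              exact abs_le.1 this.2
            rw [indicator_of_mem hp', mul_one, abs_mul, abs_mul, abs_sub_comm (V p.1)]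
            calc |V (p.1 - z.1) - V p.1| * |kflux g (U p) (U' (p - z))| * |φ p|
                ≤ |V (p.1 - z.1) - V p.1| * (N * (2 * C)) * Mφ := by
                  gcongr
                  · exact bk _ _
                  · exact hMφ p
              _ = _ := by ring
          · rw [image_eq_zero_of_notMem_tsupport hp, mul_zero, abs_zero]
            have : 0 ≤ I.indicator (fun _ => (1 : ℝ)) p.2 :=
              indicator_nonneg (fun _ _ => zero_le_one) _
            positivity
      _ = _ := by rw [integral_const_mul, hval, hA]; ring
  have hVlim := (tendsto_integral_abs_translate_sub (μ := volume) hVi).const_mul A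
  rw [mul_zero] at hVlim
  -- The error carries the factor `Q = ∫ |ρ₂'|`, which grows as the space kernel narrows. The time
  -- kernel is therefore chosen last, narrow enough to beat the `Q` already fixed; `Q + 1` avoids
  -- dividing by zero.
  obtain ⟨δ, hδ, hδV⟩ := Metric.tendsto_nhds_nhds.1 hVlim (η / (2 * (Q + 1))) (by positivity)
  set δ' := min δ r with hδ'
  have hδ'0 : 0 < δ' := lt_min hδ hr
  let b₁ : ContDiffBump (0 : ℝ) := ⟨δ' / 2, δ', by positivity, by linarith⟩
  set ρ₁ := b₁.normed volume with hρ₁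
  have h₁z : ∀ x, δ' ≤ |x| → ρ₁ x = 0 := fun x hx => by
    by_contra h
    have : x ∈ Function.support ρ₁ := h
    rw [hρ₁, b₁.support_normed_eq, mem_ball_zero_iff, Real.norm_eq_abs] at this
    exact absurd this (not_lt.2 hx)
  have h₁ : ContDiff ℝ 1 ρ₁ := b₁.contDiff_normed
  have h₁c : HasCompactSupport ρ₁ := b₁.hasCompactSupport_normed
  have h₁0 : ∀ x, 0 ≤ ρ₁ x := b₁.nonneg_normed
  have h₂0 : ∀ x, 0 ≤ ρ₂ x := b₂.nonneg_normed
  have i₁ : Integrable ρ₁ := h₁.continuous.integrable_of_hasCompactSupport h₁c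
  have i₂ : Integrable ρ₂ := h₂.continuous.integrable_of_hasCompactSupport h₂c
  obtain ⟨hint, hnn⟩ := doubled_inequality hg hVm hVb hU hU' hφ hφc hφ0 hε hφε h₁ h₂ h₁c h₂c h₁0 h₂0
    (fun x hx => h₂z x ((min_le_right _ _).trans hx))
  have iρ : Integrable fun z : ℝ × ℝ => ρ₁ z.1 * ρ₂ z.2 := i₁.mul_prod i₂
  have iρ' : Integrable fun z : ℝ × ℝ => ρ₁ z.1 * |deriv ρ₂ z.2| := i₁.mul_prod i₂'
  calc (0 : ℝ) ≤ _ := hnn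
    _ ≤ ∫ z : ℝ × ℝ, (ρ₁ z.1 * ρ₂ z.2 * (J 0 + η / 2)
          + ρ₁ z.1 * |deriv ρ₂ z.2| * (η / (2 * (Q + 1)))) := by
        refine integral_mono hint ((iρ.mul_const _).add (iρ'.mul_const _)) fun z => ?_
        simp only
        by_cases hz1 : δ' ≤ |z.1|
        · simp [h₁z _ hz1]
        push Not at hz1
        refine add_le_add ?_ ?_
        · by_cases hz2 : r' ≤ |z.2|
          · simp [h₂z _ hz2]
          push Not at hz2
          refine mul_le_mul_of_nonneg_left ?_ (mul_nonneg (h₁0 _) (h₂0 _))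
          have hz : dist z 0 < r := by
            rw [dist_zero_right, Prod.norm_def, max_lt_iff]
            exact ⟨hz1.trans_le (min_le_right _ _), hz2.trans_le (min_le_left _ _)⟩
          have := hrJ hz
          rw [Real.dist_eq, sub_zero, abs_abs] at this
          have := (abs_lt.1 this).2
          change J z ≤ _
          linarith
        · rw [mul_assoc, mul_assoc]
          refine mul_le_mul_of_nonneg_left ?_ (h₁0 _)
          have hz : dist z.1 0 < δ := by
            rw [dist_zero_right]
            exact hz1.trans_le (min_le_left _ _)
          have h3 := hδV hz
          rw [Real.dist_eq, sub_zero] at h3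
          have h4 := (hK z).trans ((le_abs_self _).trans h3.le)
          refine (le_abs_self _).trans ?_
          rw [abs_mul]
          exact mul_le_mul_of_nonneg_left h4 (abs_nonneg _)
    _ = (J 0 + η / 2) + Q * (η / (2 * (Q + 1))) := by
        rw [integral_add (iρ.mul_const _) (iρ'.mul_const _), integral_mul_const,
          integral_mul_const, Measure.volume_eq_prod, integral_prod_mul ρ₁ ρ₂,
          integral_prod_mul ρ₁ (fun x => |deriv ρ₂ x|), hρ₁, b₁.integral_normed, hρ₂,
          b₂.integral_normed, ← hρ₂, ← hQ]
        ring
    _ ≤ J 0 + η := by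
        have : Q * (η / (2 * (Q + 1))) ≤ η / 2 := by
          rw [← mul_div_assoc, div_le_div_iff₀ (by positivity) (by positivity)]
          nlinarith
        linarith

/-! ### The maximum principle -/

theorem integrable_ae_bdd_mul {E : Type*} [TopologicalSpace E] [MeasurableSpace E] [BorelSpace E]
    {μ : Measure E} [IsFiniteMeasureOnCompacts μ] {f w : E → ℝ} {C : ℝ}
    (hf : AEStronglyMeasurable f μ) (hC : ∀ᵐ x ∂μ, |f x| ≤ C) (hw : Continuous w)
    (hc : HasCompactSupport w) : Integrable (fun x => f x * w x) μ :=
  (hw.integrable_of_hasCompactSupport hc).bdd_mul hf hC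

theorem _root_.HasCompactSupport.slice_fst {φ : ℝ × ℝ → ℝ} (hc : HasCompactSupport φ) (t : ℝ) :
    HasCompactSupport fun x => φ (t, x) := by
  refine HasCompactSupport.intro (hc.isCompact.image continuous_snd) fun x hx => ?_
  by_contra h
  exact hx ⟨(t, x), subset_tsupport _ h, rfl⟩

theorem _root_.HasCompactSupport.slice_snd {φ : ℝ × ℝ → ℝ} (hc : HasCompactSupport φ) (x : ℝ) :
    HasCompactSupport fun t => φ (t, x) := by
  refine HasCompactSupport.intro (hc.isCompact.image continuous_fst) fun t ht => ?_
  by_contra h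
  exact ht ⟨(t, x), subset_tsupport _ h, rfl⟩

/-- A nonnegative `E` with `∂_t E + ∂_x Fl ≤ 0` and `|Fl| ≤ N E` on `[0,T] × ℝ₊`, which vanishes
at the initial time and on the boundary, vanishes. -/
theorem ae_eq_zero_of_subsolution {T N C : ℝ} (hN : 0 ≤ N) {E Fl : ℝ × ℝ → ℝ} {ET : ℝ → ℝ}
    (hE0 : ∀ p, 0 ≤ E p) (hEm : AEStronglyMeasurable E (volume.restrict (Icc 0 T ×ˢ Ioi 0)))
    (hEb : ∀ᵐ p ∂(volume.restrict (Icc 0 T ×ˢ Ioi 0)), E p ≤ C)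
    (hFm : AEStronglyMeasurable Fl (volume.restrict (Icc 0 T ×ˢ Ioi 0)))
    (hFl : ∀ᵐ p ∂(volume.restrict (Icc 0 T ×ˢ Ioi 0)), |Fl p| ≤ N * E p)
    (hET0 : ∀ x, 0 ≤ ET x) (hETm : AEStronglyMeasurable ET (volume.restrict (Ioi 0)))
    (hETb : ∀ᵐ x ∂(volume.restrict (Ioi 0)), ET x ≤ C)
    (h : ∀ φ : ℝ × ℝ → ℝ, ContDiff ℝ 1 φ → HasCompactSupport φ → (∀ p, 0 ≤ φ p) →
      0 ≤ (∫ p in Icc 0 T ×ˢ Ioi 0, (E p * derivFst φ p + Fl p * derivSnd φ p))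
        - ∫ x in Ioi 0, ET x * φ (T, x)) (hT : 0 ≤ T) :
    (∀ᵐ p ∂(volume.restrict (Icc 0 T ×ˢ Ioi 0)), E p = 0) ∧
      ∀ᵐ x ∂(volume.restrict (Ioi 0)), ET x = 0 := by
  have hS : MeasurableSet (Icc 0 T ×ˢ Ioi (0 : ℝ)) := measurableSet_Icc.prod measurableSet_Ioi
  -- The edge `x + N t = n + 1` of the cut-off moves inward at speed `N`. As `|Fl| ≤ N E`, what
  -- crosses it has a favourable sign.
  set θ : ℕ → ℝ × ℝ → ℝ := fun n p => ramp (n + 1 - (p.2 + N * p.1)) with hθ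
  have hr1 : ContDiff ℝ 1 ramp := contDiff_ramp
  have key : ∀ n : ℕ, (∀ᵐ p ∂(volume.restrict (Icc 0 T ×ˢ Ioi 0)),
        E p * (Real.exp (-p.1) * θ n p) = 0) ∧
      ∀ᵐ x ∂(volume.restrict (Ioi 0)), ET x * (Real.exp (-T) * θ n (T, x)) = 0 := by
    intro n
    -- The three extra ramps equal `1` near `[0,T] × ℝ₊` and only make the support compact. The
    -- decaying exponential produces the term `-E φ`, which makes the inequality strict enough to
    -- conclude.
    set φ : ℝ × ℝ → ℝ := fun p => Real.exp (-p.1) * θ n p *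
      (ramp (p.1 + 2) * ramp (T + 2 - p.1) * ramp (p.2 + 2)) with hφdef
    have hθd : ContDiff ℝ 1 (θ n) := hr1.comp (by fun_prop)
    have hψd : ContDiff ℝ 1 fun p : ℝ × ℝ => Real.exp (-p.1) * θ n p :=
      (Real.contDiff_exp.comp contDiff_fst.neg).mul hθd
    have hφ : ContDiff ℝ 1 φ := by
      refine hψd.mul ((ContDiff.mul ?_ ?_).mul ?_)
      · exact hr1.comp (by fun_prop)
      · exact hr1.comp (by fun_prop)
      · exact hr1.comp (by fun_prop)
    have hθ0 : ∀ p, 0 ≤ θ n p := fun p => Real.smoothTransition.nonneg _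
    have hφ0 : ∀ p, 0 ≤ φ p := fun p => by
      have h1 := Real.smoothTransition.nonneg (p.1 + 2)
      have h2 := Real.smoothTransition.nonneg (T + 2 - p.1)
      have h3 := Real.smoothTransition.nonneg (p.2 + 2)
      have h4 := hθ0 p
      have h5 := (Real.exp_pos (-p.1)).le
      simp only [hφdef, ramp]
      positivity
    have hφc : HasCompactSupport φ := by
      refine HasCompactSupport.intro (K := Icc (-2) (T + 2) ×ˢ Icc (-2) (n + 1 + 2 * N))
        (isCompact_Icc.prod isCompact_Icc) fun p hp => ?_
      by_contra hne
      simp only [hφdef, mul_eq_zero, not_or, hθ, ramp,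
        Real.smoothTransition.zero_iff_nonpos, not_le] at hne
      obtain ⟨⟨-, h1⟩, ⟨h2, h3⟩, h4⟩ := hne
      refine hp ⟨⟨by linarith, by linarith⟩, ⟨by linarith, ?_⟩⟩
      nlinarith
    have heq : ∀ p : ℝ × ℝ, p.1 ∈ Icc 0 T → 0 < p.2 →
        φ =ᶠ[𝓝 p] fun p => Real.exp (-p.1) * θ n p := by
      intro p hp1 hp2
      have h1 : ∀ᶠ q : ℝ × ℝ in 𝓝 p, -1 < q.1 :=
        continuousAt_fst.eventually_const_lt (by linarith [hp1.1])
      have h2 : ∀ᶠ q : ℝ × ℝ in 𝓝 p, q.1 < T + 1 :=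
        continuousAt_fst.eventually_lt_const (by linarith [hp1.2])
      have h3 : ∀ᶠ q : ℝ × ℝ in 𝓝 p, 0 < q.2 := continuousAt_snd.eventually_const_lt hp2
      filter_upwards [h1, h2, h3] with q q1 q2 q3
      simp only [hφdef, ramp]
      rw [Real.smoothTransition.one_of_one_le (by linarith : 1 ≤ q.1 + 2),
        Real.smoothTransition.one_of_one_le (by linarith : 1 ≤ T + 2 - q.1),
        Real.smoothTransition.one_of_one_le (by linarith : 1 ≤ q.2 + 2)]
      ring
    have hF : ∀ p : ℝ × ℝ, p.1 ∈ Icc 0 T → 0 < p.2 → derivFst φ p = -(Real.exp (-p.1) * θ n p)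
        - N * (Real.exp (-p.1) * deriv ramp (n + 1 - (p.2 + N * p.1))) := by
      intro p hp1 hp2
      have e : (fun s => φ (s, p.2)) =ᶠ[𝓝 p.1] fun s => Real.exp (-s) * θ n (s, p.2) :=
        (Continuous.prodMk continuous_id continuous_const).continuousAt.eventually (heq p hp1 hp2)
      unfold derivFst
      rw [e.deriv_eq]
      have d1 : HasDerivAt (fun s : ℝ => (n : ℝ) + 1 - (p.2 + N * s)) (-(N * 1)) p.1 :=
        (((hasDerivAt_id p.1).const_mul N).const_add p.2).const_sub _
      have d2 := (hasDerivAt_ramp (n + 1 - (p.2 + N * p.1))).comp p.1 d1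
      have d3 := (hasDerivAt_neg p.1).exp.mul d2
      rw [show (fun s => Real.exp (-s) * θ n (s, p.2)) = (fun s => Real.exp (-s)) *
        (ramp ∘ fun s : ℝ => (n : ℝ) + 1 - (p.2 + N * s)) from rfl, d3.deriv]
      simp only [hθ, Function.comp_apply]
      ring
    have hG : ∀ p : ℝ × ℝ, p.1 ∈ Icc 0 T → 0 < p.2 → derivSnd φ p =
        -(Real.exp (-p.1) * deriv ramp (n + 1 - (p.2 + N * p.1))) := by
      intro p hp1 hp2
      have e : (fun y => φ (p.1, y)) =ᶠ[𝓝 p.2] fun y => Real.exp (-p.1) * θ n (p.1, y) :=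
        (Continuous.prodMk continuous_const continuous_id).continuousAt.eventually (heq p hp1 hp2)
      unfold derivSnd
      rw [e.deriv_eq]
      have d1 : HasDerivAt (fun y : ℝ => (n : ℝ) + 1 - (y + N * p.1)) (-1) p.2 :=
        ((hasDerivAt_id p.2).add_const (N * p.1)).const_sub _
      have d2 := (hasDerivAt_ramp (n + 1 - (p.2 + N * p.1))).comp p.2 d1
      have d3 := d2.const_mul (Real.exp (-p.1))
      rw [show (fun y => Real.exp (-p.1) * θ n (p.1, y)) = (fun y => Real.exp (-p.1) *
        (ramp ∘ fun y : ℝ => (n : ℝ) + 1 - (y + N * p.1)) y) from rfl, d3.deriv]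
      ring
    have i1 : IntegrableOn (fun p => E p * derivFst φ p + Fl p * derivSnd φ p)
        (Icc 0 T ×ˢ Ioi 0) := by
      refine (integrable_ae_bdd_mul (C := C) hEm ?_ (continuous_derivFst hφ)
        (hasCompactSupport_derivFst hφ hφc)).add (integrable_ae_bdd_mul (C := N * C) hFm ?_
        (continuous_derivSnd hφ) (hasCompactSupport_derivSnd hφ hφc))
      · filter_upwards [hEb] with p hp using by rwa [abs_of_nonneg (hE0 p)]
      · filter_upwards [hEb, hFl] with p hp1 hp2 using
          hp2.trans (mul_le_mul_of_nonneg_left hp1 hN)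
    have i2 : IntegrableOn (fun p => E p * φ p) (Icc 0 T ×ˢ Ioi 0) := by
      refine integrable_ae_bdd_mul (C := C) hEm ?_ hφ.continuous hφc
      filter_upwards [hEb] with p hp using by rwa [abs_of_nonneg (hE0 p)]
    have i3 : IntegrableOn (fun x => ET x * φ (T, x)) (Ioi 0) := by
      refine integrable_ae_bdd_mul (C := C) hETm ?_ (hφ.continuous.comp (by fun_prop))
        (hφc.slice_fst T)
      filter_upwards [hETb] with p hp using by rwa [abs_of_nonneg (hET0 p)]
    -- The difference of the two integrands is `-e^{-t} r' (N E + Fl) ≤ 0`, with `r'` the derivative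
    -- of the ramp. So `∫ E φ` plus the final term is at most zero, while both are nonnegative.
    have hle : ∫ p in Icc 0 T ×ˢ Ioi 0, (E p * derivFst φ p + Fl p * derivSnd φ p)
        ≤ ∫ p in Icc 0 T ×ˢ Ioi 0, -(E p * φ p) := by
      refine integral_mono_ae i1 i2.neg ?_
      filter_upwards [hFl, ae_restrict_mem hS] with p hp hpS
      rw [hF p hpS.1 hpS.2, hG p hpS.1 hpS.2, (heq p hpS.1 hpS.2).eq_of_nhds]
      have hd : 0 ≤ Real.exp (-p.1) * deriv ramp (n + 1 - (p.2 + N * p.1)) :=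
        mul_nonneg (Real.exp_pos _).le (deriv_ramp_nonneg _)
      have := (abs_le.1 hp).1
      nlinarith
    have hmain := h φ hφ hφc hφ0
    have z1 : 0 ≤ ∫ p in Icc 0 T ×ˢ Ioi 0, E p * φ p :=
      integral_nonneg fun p => mul_nonneg (hE0 p) (hφ0 p)
    have z2 : 0 ≤ ∫ x in Ioi 0, ET x * φ (T, x) :=
      integral_nonneg fun p => mul_nonneg (hET0 p) (hφ0 _)
    rw [integral_neg] at hle
    constructor
    · have := (integral_eq_zero_iff_of_nonneg (fun p => mul_nonneg (hE0 p) (hφ0 p)) i2).1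
        (by linarith)
      filter_upwards [this, ae_restrict_mem hS] with p hp hpS
      have e := (heq p hpS.1 hpS.2).eq_of_nhds
      rw [← e]
      exact hp
    · have := (integral_eq_zero_iff_of_nonneg (fun p => mul_nonneg (hET0 p) (hφ0 (T, p))) i3).1
        (by linarith)
      filter_upwards [this, ae_restrict_mem measurableSet_Ioi] with x hx hxS
      have e := (heq (T, x) ⟨hT, le_rfl⟩ hxS).eq_of_nhds
      simp only at e
      rw [← e]
      exact hx
  constructor
  · filter_upwards [ae_all_iff.2 fun n => (key n).1] with p hp
    obtain ⟨n, hn⟩ := exists_nat_gt (p.2 + N * p.1)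
    have := hp n
    rw [hθ] at this
    simp only [ramp] at this
    rw [Real.smoothTransition.one_of_one_le (by linarith), mul_one] at this
    exact (mul_eq_zero.1 this).resolve_right (Real.exp_pos _).ne'
  · filter_upwards [ae_all_iff.2 fun n => (key n).2] with x hx
    obtain ⟨n, hn⟩ := exists_nat_gt (x + N * T)
    have := hx n
    rw [hθ] at this
    simp only [ramp] at this
    rw [Real.smoothTransition.one_of_one_le (by linarith), mul_one] at this
    exact (mul_eq_zero.1 this).resolve_right (Real.exp_pos _).ne'

/-! ### The range of a solution, and its extension to all times -/

/-- The data of a problem with flux `v(t) g(u)`: `V` extends `v` by zero outside `[0,T]`, and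
`[m, M]` is the interval spanned by the initial and boundary data. -/
structure IsProblem (T Cv : ℝ) (v V g uo ub : ℝ → ℝ) (m M : ℝ) : Prop where
  T_pos : 0 < T
  eq_of_mem : ∀ t ∈ Icc 0 T, V t = v t
  eq_zero : ∀ t, t ∉ Icc 0 T → V t = 0
  meas : Measurable V
  bdd : ∀ t, |V t| ≤ Cv
  contDiff : ContDiff ℝ 1 g
  hull : essHull uo (Ioi 0) ub (Icc 0 T) = Icc m M
  uo_mem : ∀ᵐ x ∂(volume.restrict (Ioi 0)), uo x ∈ Icc m M
  uo_meas : AEStronglyMeasurable uo (volume.restrict (Ioi 0))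
  ub_mem : ∀ᵐ t ∂(volume.restrict (Icc 0 T)), ub t ∈ Icc m M
  ub_meas : AEStronglyMeasurable ub (volume.restrict (Icc 0 T))

section Problem

variable {T Cv m M : ℝ} {v V g uo ub : ℝ → ℝ} {u : ℝ → ℝ → ℝ} {U : ℝ × ℝ → ℝ}

/-- This passes to the continuous form of the flux, to the extended speed, and to an arbitrary
representative `U`, which can be chosen measurable and with values in `[m, M]` everywhere. -/
theorem entropyForm_pos (hP : IsProblem T Cv v V g uo ub m M)
    (hU : ∀ᵐ p ∂(volume.restrict (Icc 0 T ×ˢ Ioi 0)), U p = u p.1 p.2) (k : ℝ) (φ : ℝ × ℝ → ℝ) :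
    entropyForm T (fun t r => v t * g r) uo ub u pos sgnPos k φ =
      (∫ p in Icc 0 T ×ˢ Ioi 0, (pos (U p - k) * derivFst φ p
        + V p.1 * (g (max (U p) k) - g k) * derivSnd φ p))
      + (∫ x in Ioi 0, pos (uo x - k) * φ (0, x)) - (∫ x in Ioi 0, pos (u T x - k) * φ (T, x))
      + fluxLip T (fun t r => v t * g r) uo ub * ∫ t in Icc 0 T, pos (ub t - k) * φ (t, 0) := by
  unfold entropyForm
  congr 3
  refine integral_congr_ae ?_
  filter_upwards [hU, ae_restrict_mem (measurableSet_Icc.prod measurableSet_Ioi)] with p hp hpS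
  rw [hp, sgnPos_mul, hP.eq_of_mem _ hpS.1]
  rfl

theorem entropyForm_neg (hP : IsProblem T Cv v V g uo ub m M)
    (hU : ∀ᵐ p ∂(volume.restrict (Icc 0 T ×ˢ Ioi 0)), U p = u p.1 p.2) (k : ℝ) (φ : ℝ × ℝ → ℝ) :
    entropyForm T (fun t r => v t * g r) uo ub u neg sgnNeg k φ =
      (∫ p in Icc 0 T ×ˢ Ioi 0, (neg (U p - k) * derivFst φ p
        + V p.1 * (g k - g (min (U p) k)) * derivSnd φ p))
      + (∫ x in Ioi 0, neg (uo x - k) * φ (0, x)) - (∫ x in Ioi 0, neg (u T x - k) * φ (T, x))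
      + fluxLip T (fun t r => v t * g r) uo ub * ∫ t in Icc 0 T, neg (ub t - k) * φ (t, 0) := by
  unfold entropyForm
  congr 3
  refine integral_congr_ae ?_
  filter_upwards [hU, ae_restrict_mem (measurableSet_Icc.prod measurableSet_Ioi)] with p hp hpS
  rw [hp, sgnNeg_mul, hP.eq_of_mem _ hpS.1]
  rfl

theorem pos_nonneg (s : ℝ) : 0 ≤ pos s := le_max_right _ _

theorem neg_nonneg' (s : ℝ) : 0 ≤ neg s := le_max_right _ _

theorem pos_le_abs (s : ℝ) : pos s ≤ |s| := max_le (le_abs_self _) (abs_nonneg _)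

theorem neg_le_abs' (s : ℝ) : neg s ≤ |s| := max_le (neg_le_abs _) (abs_nonneg _)

theorem continuous_pos : Continuous pos := continuous_id.max continuous_const

theorem continuous_neg' : Continuous neg := continuous_neg.max continuous_const

theorem max_sub_eq_pos (a k : ℝ) : max a k - k = pos (a - k) := by
  rw [pos, ← max_sub_sub_right, sub_self]

theorem sub_min_eq_neg (a k : ℝ) : k - min a k = neg (a - k) := by
  rw [neg, neg_sub]
  rcases le_total a k with h | h
  · rw [min_eq_left h, max_eq_left (by linarith)]
  · rw [min_eq_right h, max_eq_right (by linarith), sub_self]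

theorem pos_eq_zero_iff {s : ℝ} : pos s = 0 ↔ s ≤ 0 := max_eq_right_iff

theorem neg_eq_zero_iff' {s : ℝ} : neg s = 0 ↔ 0 ≤ s := by
  rw [neg, max_eq_right_iff, neg_nonpos]

theorem IsProblem.le (hP : IsProblem T Cv v V g uo ub m M) : m ≤ M := by
  have : NeBot (ae (volume.restrict (Ioi (0 : ℝ)))) := by
    rw [ae_restrict_neBot]
    simp
  obtain ⟨x, hx⟩ := hP.uo_mem.exists
  exact hx.1.trans hx.2

theorem exists_bound_of_memLp_top {α : Type*} [MeasurableSpace α] {μ : Measure α} {f : α → ℝ}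
    (hf : MemLp f ∞ μ) : ∃ C, ∀ᵐ x ∂μ, |f x| ≤ C :=
  ⟨_, ae_le_lpNorm_exponent_top hf⟩

/-- A solution takes values in the interval spanned by the data. -/
theorem IsSolution.mem_Icc (hP : IsProblem T Cv v V g uo ub m M)
    (hu : IsSolution T (fun t r => v t * g r) uo ub u) :
    (∀ᵐ p : ℝ × ℝ ∂(volume.restrict (Icc 0 T ×ˢ Ioi 0)), u p.1 p.2 ∈ Icc m M) ∧
      ∀ᵐ x ∂(volume.restrict (Ioi 0)), u T x ∈ Icc m M := by
  obtain ⟨C₁, hC₁⟩ := exists_bound_of_memLp_top hu.memLp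
  obtain ⟨C₂, hC₂⟩ := exists_bound_of_memLp_top hu.memLp_final
  -- At this stage `u` may still leave `[m, M]`, so the Lipschitz constant of `g` is taken on an
  -- interval containing the whole range of `u` as well as the two levels.
  set C := max (max C₁ C₂) (max |m| |M|) with hC
  have hCm : |m| ≤ C := (le_max_left _ _).trans (le_max_right _ _)
  have hCM : |M| ≤ C := (le_max_right _ _).trans (le_max_right _ _)
  have hb₁ : ∀ᵐ p : ℝ × ℝ ∂(volume.restrict (Icc 0 T ×ˢ Ioi 0)), |u p.1 p.2| ≤ C := by
    filter_upwards [hC₁] with p hp using hp.trans ((le_max_left _ _).trans (le_max_left _ _))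
  have hb₂ : ∀ᵐ x ∂(volume.restrict (Ioi 0)), |u T x| ≤ C := by
    filter_upwards [hC₂] with p hp using hp.trans ((le_max_right _ _).trans (le_max_left _ _))
  obtain ⟨N, hN0, hN⟩ := exists_lipschitz_bound hP.contDiff C
  have hCv0 : 0 ≤ Cv := (abs_nonneg _).trans (hP.bdd 0)
  have hmM := hP.le
  have hgc := hP.contDiff.continuous
  have hum := hu.memLp.1
  have huTm := hu.memLp_final.1
  have hVm : AEStronglyMeasurable (fun p : ℝ × ℝ => V p.1)
      (volume.restrict (Icc 0 T ×ˢ Ioi 0)) := (hP.meas.comp measurable_fst).aestronglyMeasurable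
  -- Level `M` is the largest one at which the inequality is available, and it is the one that
  -- removes both data terms, since the data are at most `M` almost everywhere.
  have up := ae_eq_zero_of_subsolution (T := T) (N := Cv * N) (C := 2 * C) (by positivity)
    (E := fun p => pos (u p.1 p.2 - M)) (ET := fun x => pos (u T x - M))
    (Fl := fun p => V p.1 * (g (max (u p.1 p.2) M) - g M))
    (fun p => pos_nonneg _)
    (continuous_pos.comp_aestronglyMeasurable (hum.sub aestronglyMeasurable_const))
    (by
      filter_upwards [hb₁] with p hp
      exact (pos_le_abs _).trans ((abs_sub _ _).trans (by linarith)))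
    (hVm.mul ((hgc.comp_aestronglyMeasurable
      ((continuous_id.max continuous_const).comp_aestronglyMeasurable hum)).sub
        aestronglyMeasurable_const))
    (by
      filter_upwards [hb₁] with p hp
      have := hN _ _ (abs_max_le hp hCM) hCM
      rw [max_sub_eq_pos, abs_of_nonneg (pos_nonneg _)] at this
      rw [abs_mul, mul_assoc]
      exact mul_le_mul (hP.bdd _) this (abs_nonneg _) hCv0)
    (fun p => pos_nonneg _)
    (continuous_pos.comp_aestronglyMeasurable (huTm.sub aestronglyMeasurable_const))
    (by
      filter_upwards [hb₂] with p hp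
      exact (pos_le_abs _).trans ((abs_sub _ _).trans (by linarith)))
    (by
      intro φ hφ hφc hφ0
      have h := (hu.entropy M (hP.hull ▸ ⟨hmM, le_rfl⟩) φ hφ hφc hφ0).1
      rw [entropyForm_pos hP (Eventually.of_forall fun _ => rfl)] at h
      have z1 : ∫ x in Ioi 0, pos (uo x - M) * φ (0, x) = 0 := by
        refine integral_eq_zero_of_ae ?_
        filter_upwards [hP.uo_mem] with x hx
        simp [pos_eq_zero_iff.2 (sub_nonpos.2 hx.2)]
      have z2 : ∫ t in Icc 0 T, pos (ub t - M) * φ (t, 0) = 0 := by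
        refine integral_eq_zero_of_ae ?_
        filter_upwards [hP.ub_mem] with x hx
        simp [pos_eq_zero_iff.2 (sub_nonpos.2 hx.2)]
      rwa [z1, z2, mul_zero, add_zero, add_zero] at h) hP.T_pos.le
  have lo := ae_eq_zero_of_subsolution (T := T) (N := Cv * N) (C := 2 * C) (by positivity)
    (E := fun p => neg (u p.1 p.2 - m)) (ET := fun x => neg (u T x - m))
    (Fl := fun p => V p.1 * (g m - g (min (u p.1 p.2) m)))
    (fun p => neg_nonneg' _)
    (continuous_neg'.comp_aestronglyMeasurable (hum.sub aestronglyMeasurable_const))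
    (by
      filter_upwards [hb₁] with p hp
      exact (neg_le_abs' _).trans ((abs_sub _ _).trans (by linarith)))
    (hVm.mul (aestronglyMeasurable_const.sub (hgc.comp_aestronglyMeasurable
      ((continuous_id.min continuous_const).comp_aestronglyMeasurable hum))))
    (by
      filter_upwards [hb₁] with p hp
      have := hN _ _ hCm (abs_min_le hp hCm)
      rw [sub_min_eq_neg, abs_of_nonneg (neg_nonneg' _)] at this
      rw [abs_mul, mul_assoc]
      exact mul_le_mul (hP.bdd _) this (abs_nonneg _) hCv0)
    (fun p => neg_nonneg' _)
    (continuous_neg'.comp_aestronglyMeasurable (huTm.sub aestronglyMeasurable_const))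
    (by
      filter_upwards [hb₂] with p hp
      exact (neg_le_abs' _).trans ((abs_sub _ _).trans (by linarith)))
    (by
      intro φ hφ hφc hφ0
      have h := (hu.entropy m (hP.hull ▸ ⟨le_rfl, hmM⟩) φ hφ hφc hφ0).2
      rw [entropyForm_neg hP (Eventually.of_forall fun _ => rfl)] at h
      have z1 : ∫ x in Ioi 0, neg (uo x - m) * φ (0, x) = 0 := by
        refine integral_eq_zero_of_ae ?_
        filter_upwards [hP.uo_mem] with x hx
        simp [neg_eq_zero_iff'.2 (sub_nonneg.2 hx.1)]
      have z2 : ∫ t in Icc 0 T, neg (ub t - m) * φ (t, 0) = 0 := by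
        refine integral_eq_zero_of_ae ?_
        filter_upwards [hP.ub_mem] with x hx
        simp [neg_eq_zero_iff'.2 (sub_nonneg.2 hx.1)]
      rwa [z1, z2, mul_zero, add_zero, add_zero] at h) hP.T_pos.le
  constructor
  · filter_upwards [up.1, lo.1] with p h1 h2
    exact ⟨sub_nonneg.1 (neg_eq_zero_iff'.1 h2), sub_nonpos.1 (pos_eq_zero_iff.1 h1)⟩
  · filter_upwards [up.2, lo.2] with p h1 h2
    exact ⟨sub_nonneg.1 (neg_eq_zero_iff'.1 h2), sub_nonpos.1 (pos_eq_zero_iff.1 h1)⟩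

end Problem

/-! ### Measurable representatives, and integration of test functions along slices -/

theorem exists_measurable_clamp {α : Type*} [MeasurableSpace α] {μ : Measure α} {f : α → ℝ}
    {m M : ℝ} (hmM : m ≤ M) (hf : AEStronglyMeasurable f μ) (h : ∀ᵐ x ∂μ, f x ∈ Icc m M) :
    ∃ f' : α → ℝ, Measurable f' ∧ (∀ x, f' x ∈ Icc m M) ∧ f' =ᵐ[μ] f := by
  refine ⟨fun x => max m (min M (hf.mk f x)), ?_, fun x => ⟨le_max_left _ _,
    max_le hmM (min_le_left _ _)⟩, ?_⟩
  · exact measurable_const.max (measurable_const.min hf.stronglyMeasurable_mk.measurable)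
  · filter_upwards [h, hf.ae_eq_mk] with x h1 h2
    rw [← h2, min_eq_right h1.2, max_eq_right h1.1]

theorem abs_le_of_mem_Icc {m M C x : ℝ} (hm : |m| ≤ C) (hM : |M| ≤ C) (hx : x ∈ Icc m M) :
    |x| ≤ C :=
  abs_le.2 ⟨(abs_le.1 hm).1.trans hx.1, hx.2.trans (abs_le.1 hM).2⟩

theorem contDiff_slice_snd {φ : ℝ × ℝ → ℝ} (hφ : ContDiff ℝ 1 φ) (x : ℝ) :
    ContDiff ℝ 1 fun t => φ (t, x) := hφ.comp (contDiff_id.prodMk contDiff_const)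

theorem contDiff_slice_fst {φ : ℝ × ℝ → ℝ} (hφ : ContDiff ℝ 1 φ) (t : ℝ) :
    ContDiff ℝ 1 fun x => φ (t, x) := hφ.comp (contDiff_const.prodMk contDiff_id)

/-- For the time strips outside `[0,T]`, where the extended solution depends on `x` alone and the
time integral can be evaluated. -/
theorem setIntegral_prod_mul_derivFst {w : ℝ → ℝ} {C : ℝ} (hw : Measurable w)
    (hC : ∀ x, |w x| ≤ C) {φ : ℝ × ℝ → ℝ} (hφ : ContDiff ℝ 1 φ) (hφc : HasCompactSupport φ)
    (I J : Set ℝ) :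
    ∫ p in I ×ˢ J, w p.2 * derivFst φ p
      = ∫ x in J, w x * ∫ t in I, deriv (fun s => φ (s, x)) t := by
  have hi : Integrable fun p : ℝ × ℝ => w p.2 * derivFst φ p :=
    integrable_bdd_mul (hw.comp measurable_snd).aestronglyMeasurable (fun p => hC p.2)
      (continuous_derivFst hφ) (hasCompactSupport_derivFst hφ hφc)
  have hi' : Integrable (fun p : ℝ × ℝ => w p.2 * derivFst φ p)
      ((volume.restrict I).prod (volume.restrict J)) := by
    rw [Measure.prod_restrict]
    exact hi.integrableOn
  rw [Measure.volume_eq_prod, ← Measure.prod_restrict, integral_prod_symm _ hi']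
  refine integral_congr_ae (Eventually.of_forall fun x => ?_)
  simp only
  rw [integral_const_mul]
  rfl

theorem integral_derivFst_eq_zero {φ : ℝ × ℝ → ℝ} (hφ : ContDiff ℝ 1 φ)
    (hφc : HasCompactSupport φ) (c : ℝ) : ∫ p, c * derivFst φ p = 0 := by
  have h := setIntegral_prod_mul_derivFst (w := fun _ => c) measurable_const
    (fun _ => le_refl |c|) hφ hφc univ univ
  rw [univ_prod_univ, setIntegral_univ, setIntegral_univ] at h
  rw [h]
  refine integral_eq_zero_of_ae (Eventually.of_forall fun x => ?_)
  have hs := contDiff_slice_snd hφ x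
  have hc := hφc.slice_snd x
  have h1 := hc.integral_Iic_deriv_eq hs 0
  have h2 := hc.integral_Ioi_deriv_eq hs 0
  have hi : Integrable (deriv fun s => φ (s, x)) :=
    (hs.continuous_deriv le_rfl).integrable_of_hasCompactSupport hc.deriv
  have h3 := intervalIntegral.integral_Iic_add_Ioi (b := 0) hi.integrableOn hi.integrableOn
  simp only [Pi.zero_apply, setIntegral_univ]
  rw [← h3, h1, h2]
  ring

/-- Together with `integral_derivFst_eq_zero`, this says that constant states solve the equation:
`w` depends on time only, so each space integral is that of the derivative of a compactly supported
function. -/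
theorem integral_mul_derivSnd_eq_zero {w : ℝ → ℝ} {C : ℝ} (hw : Measurable w)
    (hC : ∀ x, |w x| ≤ C) {φ : ℝ × ℝ → ℝ} (hφ : ContDiff ℝ 1 φ) (hφc : HasCompactSupport φ) :
    ∫ p, w p.1 * derivSnd φ p = 0 := by
  have hi : Integrable fun p : ℝ × ℝ => w p.1 * derivSnd φ p :=
    integrable_bdd_mul (hw.comp measurable_fst).aestronglyMeasurable (fun p => hC p.1)
      (continuous_derivSnd hφ) (hasCompactSupport_derivSnd hφ hφc)
  rw [Measure.volume_eq_prod, integral_prod _ hi]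
  refine integral_eq_zero_of_ae (Eventually.of_forall fun t => ?_)
  have hs := contDiff_slice_fst hφ t
  have hc := hφc.slice_fst t
  have h1 := hc.integral_Iic_deriv_eq hs 0
  have h2 := hc.integral_Ioi_deriv_eq hs 0
  have hi : Integrable (deriv fun s => φ (t, s)) :=
    (hs.continuous_deriv le_rfl).integrable_of_hasCompactSupport hc.deriv
  have h3 := intervalIntegral.integral_Iic_add_Ioi (b := 0) hi.integrableOn hi.integrableOn
  simp only [Pi.zero_apply]
  rw [integral_const_mul]
  change w t * ∫ y, deriv (fun y => φ (t, y)) y = 0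
  rw [← h3, h1, h2]
  ring

/-- `U` is a measurable representative of `u` on `[0,T] × ℝ₊`, extended by the initial datum
for negative times and by the final slice for times after `T`. -/
structure IsExtension (T : ℝ) (uo : ℝ → ℝ) (u : ℝ → ℝ → ℝ) (m M : ℝ) (a c : ℝ → ℝ)
    (U : ℝ × ℝ → ℝ) : Prop where
  meas : Measurable U
  meas_init : Measurable a
  meas_final : Measurable c
  mem : ∀ p, U p ∈ Icc m M
  ae_eq : ∀ᵐ p : ℝ × ℝ ∂(volume.restrict (Icc 0 T ×ˢ Ioi 0)), U p = u p.1 p.2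
  init : ∀ t < 0, ∀ x, U (t, x) = a x
  final : ∀ t > T, ∀ x, U (t, x) = c x
  init_ae_eq : a =ᵐ[volume.restrict (Ioi 0)] uo
  final_ae_eq : c =ᵐ[volume.restrict (Ioi 0)] u T

section Problem

variable {T Cv m M : ℝ} {v V g uo ub a c : ℝ → ℝ} {u : ℝ → ℝ → ℝ} {U : ℝ × ℝ → ℝ}

/-- By the maximum principle, clamping changes `u` and its data on null sets only. The bounds then
hold at every point, which spares later almost-everywhere arguments on slices. -/
theorem IsSolution.exists_isExtension (hP : IsProblem T Cv v V g uo ub m M)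
    (hu : IsSolution T (fun t r => v t * g r) uo ub u) :
    ∃ a c U, IsExtension T uo u m M a c U := by
  obtain ⟨h1, h2⟩ := hu.mem_Icc hP
  obtain ⟨a, ma, ha, ea⟩ := exists_measurable_clamp hP.le hP.uo_meas hP.uo_mem
  obtain ⟨b, mb, hb, eb⟩ := exists_measurable_clamp hP.le hu.memLp.1 h1
  obtain ⟨c, mc, hc, ec⟩ := exists_measurable_clamp hP.le hu.memLp_final.1 h2
  refine ⟨a, c, fun p => if p.1 < 0 then a p.2 else if p.1 ≤ T then b p else c p.2,
    ?_, ma, mc, ?_, ?_, ?_, ?_, ea, ec⟩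
  · exact Measurable.ite (measurableSet_lt measurable_fst measurable_const)
      (ma.comp measurable_snd) (Measurable.ite (measurableSet_le measurable_fst measurable_const)
        mb (mc.comp measurable_snd))
  · intro p
    split_ifs
    · exact ha _
    · exact hb _
    · exact hc _
  · filter_upwards [eb, ae_restrict_mem (measurableSet_Icc.prod measurableSet_Ioi)] with p hp hpS
    rw [if_neg (not_lt.2 hpS.1.1), if_pos hpS.1.2, hp]
  · intro t ht x
    simp [ht]
  · intro t ht x
    have : ¬ t < 0 := not_lt.2 (hP.T_pos.le.trans ht.le)
    simp [this, not_le.2 ht]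

/-- The extension is a Kružkov solution on `ℝ × ℝ₊`, for all levels. -/
theorem IsSolution.isKruzkovSolution (hP : IsProblem T Cv v V g uo ub m M)
    (hu : IsSolution T (fun t r => v t * g r) uo ub u) (hU : IsExtension T uo u m M a c U) {C : ℝ}
    (hCm : |m| ≤ C) (hCM : |M| ≤ C) : IsKruzkovSolution g V C U := by
  have hUC : ∀ p, |U p| ≤ C := fun p => abs_le_of_mem_Icc hCm hCM (hU.mem p)
  refine ⟨hU.meas, hUC, ?_⟩
  intro k φ hφ hφc hφ0 ⟨ε, hε, hφε⟩
  obtain ⟨z1, z2⟩ := hu.mem_Icc hP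
  have hCv0 : 0 ≤ Cv := (abs_nonneg _).trans (hP.bdd 0)
  have cF := continuous_derivFst hφ
  have cS := continuous_derivSnd hφ
  have kF := hasCompactSupport_derivFst hφ hφc
  have kS := hasCompactSupport_derivSnd hφ hφc
  have hgc := hP.contDiff.continuous
  have mV : Measurable fun p : ℝ × ℝ => V p.1 := hP.meas.comp measurable_fst
  have hT := hP.T_pos
  -- bounded continuous functions of `U` times derivatives of `φ` are integrable
  have bcont : ∀ h : ℝ → ℝ, Continuous h → ∃ D, 0 ≤ D ∧ ∀ x ∈ Icc m M, |h x| ≤ D := fun h hh => by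
    obtain ⟨D, hD⟩ := (isCompact_Icc (a := m) (b := M)).exists_bound_of_continuousOn hh.continuousOn
    exact ⟨max D 0, le_max_right _ _, fun x hx => (hD x hx).trans (le_max_left _ _)⟩
  have iF : ∀ h : ℝ → ℝ, Continuous h → Integrable fun p => h (U p) * derivFst φ p :=
    fun h hh => by
      obtain ⟨D, -, hD⟩ := bcont h hh
      exact integrable_bdd_mul (hh.measurable.comp hU.meas).aestronglyMeasurable
        (fun p => hD _ (hU.mem p)) cF kF
  have iS : ∀ h : ℝ → ℝ, Continuous h → Integrable fun p => V p.1 * h (U p) * derivSnd φ p :=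
    fun h hh => by
      obtain ⟨D, hD0, hD⟩ := bcont h hh
      refine integrable_bdd_mul (C := Cv * D)
        (mV.mul (hh.measurable.comp hU.meas)).aestronglyMeasurable (fun p => ?_) cS kS
      rw [abs_mul]
      exact mul_le_mul (hP.bdd _) (hD _ (hU.mem p)) (abs_nonneg _) hCv0
  have ck : ∀ k, Continuous fun r => kflux g r k := fun k =>
    (continuous_kflux hgc).comp (continuous_id.prodMk continuous_const)
  have iI : ∀ k, Integrable fun p =>
      |U p - k| * derivFst φ p + V p.1 * kflux g (U p) k * derivSnd φ p := fun k =>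
    (iF (fun r => |r - k|) (by fun_prop)).add (iS _ (ck k))
  have i0 : ∀ (h w : ℝ → ℝ) (t : ℝ), Continuous h → AEStronglyMeasurable w (volume.restrict (Ioi 0)) →
      (∀ᵐ x ∂(volume.restrict (Ioi 0)), w x ∈ Icc m M) →
      Integrable (fun x => h (w x) * φ (t, x)) (volume.restrict (Ioi 0)) := fun h w t hh mw hw => by
    obtain ⟨D, -, hD⟩ := bcont h hh
    refine integrable_ae_bdd_mul (C := D) (hh.comp_aestronglyMeasurable mw) ?_
      (hφ.continuous.comp (by fun_prop)) (hφc.slice_fst t)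
    filter_upwards [hw] with x hx using hD _ hx
  -- levels in `[m, M]`
  have hmid : ∀ k ∈ Icc m M,
      0 ≤ ∫ p, (|U p - k| * derivFst φ p + V p.1 * kflux g (U p) k * derivSnd φ p) := by
    intro k hk
    -- The boundary terms disappear because `φ` vanishes near `x = 0`. Adding the two one-sided
    -- inequalities gives the one for `|u - k|`.
    obtain ⟨e1, e2⟩ := hu.entropy k (hP.hull ▸ hk) φ hφ hφc hφ0
    rw [entropyForm_pos hP hU.ae_eq] at e1
    rw [entropyForm_neg hP hU.ae_eq] at e2
    have hb0 : ∀ t, φ (t, 0) = 0 := fun t => hφε _ hε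
    simp only [hb0, mul_zero, integral_zero, add_zero] at e1 e2
    have s1 : (∫ p in Icc 0 T ×ˢ Ioi 0, (pos (U p - k) * derivFst φ p
          + V p.1 * (g (max (U p) k) - g k) * derivSnd φ p))
        + (∫ p in Icc 0 T ×ˢ Ioi 0, (neg (U p - k) * derivFst φ p
          + V p.1 * (g k - g (min (U p) k)) * derivSnd φ p))
        = ∫ p in Icc 0 T ×ˢ Ioi 0,
          (|U p - k| * derivFst φ p + V p.1 * kflux g (U p) k * derivSnd φ p) := by
      rw [← integral_add]
      · refine integral_congr_ae (Eventually.of_forall fun p => ?_)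
        simp only [← pos_add_neg, kflux]
        ring
      · exact ((iF (fun r => pos (r - k)) (continuous_pos.comp (by fun_prop))).add
          (iS (fun r => g (max r k) - g k) (by fun_prop))).integrableOn
      · exact ((iF (fun r => neg (r - k)) (continuous_neg'.comp (by fun_prop))).add
          (iS (fun r => g k - g (min r k)) (by fun_prop))).integrableOn
    have s2 : ∀ (t : ℝ) (w : ℝ → ℝ), AEStronglyMeasurable w (volume.restrict (Ioi 0)) →
        (∀ᵐ x ∂(volume.restrict (Ioi 0)), w x ∈ Icc m M) →
        (∫ x in Ioi 0, pos (w x - k) * φ (t, x)) + (∫ x in Ioi 0, neg (w x - k) * φ (t, x))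
        = ∫ x in Ioi 0, |w x - k| * φ (t, x) := by
      intro t w mw hw
      rw [← integral_add]
      · refine integral_congr_ae (Eventually.of_forall fun p => ?_)
        simp only [← pos_add_neg]
        ring
      · exact i0 (fun r => pos (r - k)) w t (continuous_pos.comp (by fun_prop)) mw hw
      · exact i0 (fun r => neg (r - k)) w t (continuous_neg'.comp (by fun_prop)) mw hw
    have s2o := s2 0 uo hP.uo_meas hP.uo_mem
    have s2T := s2 T (u T) hu.memLp_final.1 z2
    set F : ℝ × ℝ → ℝ := fun p =>
      |U p - k| * derivFst φ p + V p.1 * kflux g (U p) k * derivSnd φ p with hF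
    have hFi : Integrable F := iI k
    have m1 : MeasurableSet (Iio (0 : ℝ) ×ˢ Ioi (0 : ℝ)) := measurableSet_Iio.prod measurableSet_Ioi
    have m2 : MeasurableSet (Icc (0 : ℝ) T ×ˢ Ioi (0 : ℝ)) := measurableSet_Icc.prod measurableSet_Ioi
    have m3 : MeasurableSet (Ioi T ×ˢ Ioi (0 : ℝ)) := measurableSet_Ioi.prod measurableSet_Ioi
    -- On the outer strips `V = 0` and `U` is independent of time, so only `|U - k| ∂ₜφ` remains
    -- there. It integrates to the initial term for `t < 0` and to minus the final term for `t > T`.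
    have hsplit : ∫ p, F p = (∫ p in Iio (0 : ℝ) ×ˢ Ioi (0 : ℝ), F p)
        + (∫ p in Icc 0 T ×ˢ Ioi 0, F p) + ∫ p in Ioi T ×ˢ Ioi (0 : ℝ), F p := by
      have d1 : Disjoint (Iio (0 : ℝ) ×ˢ Ioi (0 : ℝ)) (Icc 0 T ×ˢ Ioi 0) := by
        rw [disjoint_left]
        rintro p hp hq
        exact absurd hq.1.1 (not_le.2 hp.1)
      have d2 : Disjoint (Iio (0 : ℝ) ×ˢ Ioi (0 : ℝ) ∪ Icc 0 T ×ˢ Ioi 0) (Ioi T ×ˢ Ioi (0 : ℝ)) := by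
        rw [disjoint_left]
        rintro p (hp | hp) hq
        · exact absurd (hp.1.trans hT) (not_lt.2 (le_of_lt hq.1))
        · exact absurd hp.1.2 (not_le.2 hq.1)
      rw [← setIntegral_union d1 m2 hFi.integrableOn hFi.integrableOn,
        ← setIntegral_union d2 m3 hFi.integrableOn hFi.integrableOn,
        setIntegral_eq_integral_of_forall_compl_eq_zero]
      intro p hp
      have hp2 : p.2 < ε := by
        by_contra h
        have h2 : 0 < p.2 := hε.trans_le (not_lt.1 h)
        refine hp ?_
        rcases lt_or_ge p.1 0 with h0 | h0
        · exact Or.inl (Or.inl ⟨h0, h2⟩)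
        · rcases le_or_gt p.1 T with h3 | h3
          · exact Or.inl (Or.inr ⟨⟨h0, h3⟩, h2⟩)
          · exact Or.inr ⟨h3, h2⟩
      simp [hF, derivFst_eq_zero_of_lt hφε hp2, derivSnd_eq_zero_of_lt hφε hp2]
    have hba : ∀ w : ℝ → ℝ, (∀ x, w x ∈ Icc m M) → ∀ x, |(|w x - k|)| ≤ 2 * C := fun w hw x => by
      rw [abs_abs]
      refine (abs_sub _ _).trans ?_
      linarith [abs_le_of_mem_Icc hCm hCM hk, abs_le_of_mem_Icc hCm hCM (hw x)]
    have t1 : ∫ p in Iio (0 : ℝ) ×ˢ Ioi (0 : ℝ), F p = ∫ x in Ioi 0, |uo x - k| * φ (0, x) := by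
      have e : ∫ p in Iio (0 : ℝ) ×ˢ Ioi (0 : ℝ), F p
          = ∫ p in Iio (0 : ℝ) ×ˢ Ioi (0 : ℝ), |a p.2 - k| * derivFst φ p := by
        refine setIntegral_congr_fun m1 fun p hp => ?_
        simp only [hF]
        rw [hP.eq_zero p.1 (fun h => absurd h.1 (not_le.2 hp.1)), ← hU.init p.1 hp.1 p.2]
        ring
      rw [e, setIntegral_prod_mul_derivFst (w := fun x => |a x - k|)
        (continuous_abs.measurable.comp (hU.meas_init.sub_const k))
        (hba a fun x => hU.init (-1) (by norm_num) x ▸ hU.mem _) hφ hφc]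
      refine integral_congr_ae ?_
      filter_upwards [hU.init_ae_eq] with x hx
      rw [hx, ← integral_Iic_eq_integral_Iio,
        (hφc.slice_snd x).integral_Iic_deriv_eq (contDiff_slice_snd hφ x)]
    have t3 : ∫ p in Ioi T ×ˢ Ioi (0 : ℝ), F p = -∫ x in Ioi 0, |u T x - k| * φ (T, x) := by
      have e : ∫ p in Ioi T ×ˢ Ioi (0 : ℝ), F p
          = ∫ p in Ioi T ×ˢ Ioi (0 : ℝ), |c p.2 - k| * derivFst φ p := by
        refine setIntegral_congr_fun m3 fun p hp => ?_
        simp only [hF]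
        rw [hP.eq_zero p.1 (fun h => absurd h.2 (not_le.2 hp.1)), ← hU.final p.1 hp.1 p.2]
        ring
      rw [e, setIntegral_prod_mul_derivFst (w := fun x => |c x - k|)
        (continuous_abs.measurable.comp (hU.meas_final.sub_const k))
        (hba c fun x => hU.final (T + 1) (by simp) x ▸ hU.mem _) hφ hφc, ← integral_neg]
      refine integral_congr_ae ?_
      filter_upwards [hU.final_ae_eq] with x hx
      rw [hx, (hφc.slice_snd x).integral_Ioi_deriv_eq (contDiff_slice_snd hφ x)]
      ring
    rw [hsplit, t1, t3]
    linarith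
  -- all levels
  have hshift : ∀ k k' : ℝ, ∫ p, ((k - k') * derivFst φ p + V p.1 * (g k - g k') * derivSnd φ p)
      = 0 := by
    intro k k'
    have j1 := integral_derivFst_eq_zero hφ hφc (k - k')
    have j2 := integral_mul_derivSnd_eq_zero (w := fun t => V t * (g k - g k'))
      (C := Cv * |g k - g k'|) (hP.meas.mul_const _) (fun t => by
        rw [abs_mul]
        exact mul_le_mul_of_nonneg_right (hP.bdd t) (abs_nonneg _)) hφ hφc
    rw [integral_add, j1, j2, add_zero]
    · exact iF (fun _ => k - k') continuous_const
    · exact iS (fun _ => g k - g k') continuous_const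
  have iC : ∀ k k' : ℝ, Integrable fun p : ℝ × ℝ =>
      (k - k') * derivFst φ p + V p.1 * (g k - g k') * derivSnd φ p := fun k k' =>
    (iF (fun _ => k - k') continuous_const).add (iS (fun _ => g k - g k') continuous_const)
  have hmM := hP.le
  -- For `k < m` the signs of `U - k` and `U - m` agree everywhere, so the two integrands differ by
  -- that of a constant state, whose integral is zero by `hshift`. Likewise for `k > M`.
  rcases lt_or_ge k m with hkm | hkm
  · have e : ∫ p, (|U p - k| * derivFst φ p + V p.1 * kflux g (U p) k * derivSnd φ p)
        = (∫ p, (|U p - m| * derivFst φ p + V p.1 * kflux g (U p) m * derivSnd φ p))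
        + ∫ p, ((m - k) * derivFst φ p + V p.1 * (g m - g k) * derivSnd φ p) := by
      rw [← integral_add (iI m) (iC m k)]
      refine integral_congr_ae (Eventually.of_forall fun p => ?_)
      have hp := (hU.mem p).1
      simp only [kflux]
      rw [abs_of_nonneg (by linarith), abs_of_nonneg (by linarith), max_eq_left (by linarith),
        min_eq_right (by linarith), max_eq_left hp, min_eq_right hp]
      ring
    rw [e, hshift, add_zero]
    exact hmid m ⟨le_rfl, hmM⟩
  rcases lt_or_ge M k with hMk | hMk
  · have e : ∫ p, (|U p - k| * derivFst φ p + V p.1 * kflux g (U p) k * derivSnd φ p)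
        = (∫ p, (|U p - M| * derivFst φ p + V p.1 * kflux g (U p) M * derivSnd φ p))
        + ∫ p, ((k - M) * derivFst φ p + V p.1 * (g k - g M) * derivSnd φ p) := by
      rw [← integral_add (iI M) (iC k M)]
      refine integral_congr_ae (Eventually.of_forall fun p => ?_)
      have hp := (hU.mem p).2
      simp only [kflux]
      rw [abs_of_nonpos (by linarith), abs_of_nonpos (by linarith), max_eq_right (by linarith),
        min_eq_left (by linarith), max_eq_right hp, min_eq_left hp]
      ring
    rw [e, hshift, add_zero]
    exact hmid M ⟨hmM, le_rfl⟩
  exact hmid k ⟨hkm, hMk⟩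

end Problem

/-! ### Boundary layers and traces -/

/-- The derivative of the cut-off `x ↦ ramp (x / ε - 1)`: a smooth kernel of mass one, supported
in `[ε, 2ε]`. -/
noncomputable def layer (ε x : ℝ) : ℝ := ε⁻¹ * deriv ramp (x / ε - 1)

theorem continuous_layer (ε : ℝ) : Continuous (layer ε) :=
  continuous_const.mul (continuous_deriv_ramp.comp (by fun_prop))

theorem layer_nonneg {ε : ℝ} (hε : 0 < ε) (x : ℝ) : 0 ≤ layer ε x :=
  mul_nonneg (inv_nonneg.2 hε.le) (deriv_ramp_nonneg _)

theorem layer_of_lt {ε x : ℝ} (hε : 0 < ε) (hx : x < ε) : layer ε x = 0 := by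
  rw [layer, deriv_ramp_of_lt, mul_zero]
  rw [sub_neg, div_lt_one hε]
  exact hx

theorem layer_of_gt {ε x : ℝ} (hε : 0 < ε) (hx : 2 * ε < x) : layer ε x = 0 := by
  rw [layer, deriv_ramp_of_gt, mul_zero]
  rw [lt_sub_iff_add_lt, lt_div_iff₀ hε]
  linarith

theorem hasDerivAt_ramp_div {ε : ℝ} (x : ℝ) :
    HasDerivAt (fun y => ramp (y / ε - 1)) (layer ε x) x := by
  have h := (hasDerivAt_ramp (x / ε - 1)).comp x (((hasDerivAt_id x).div_const ε).sub_const 1)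
  convert! h using 1
  rw [layer, one_div, mul_comm]

theorem hasCompactSupport_layer {ε : ℝ} (hε : 0 < ε) : HasCompactSupport (layer ε) := by
  refine HasCompactSupport.intro (isCompact_Icc (a := ε) (b := 2 * ε)) fun x hx => ?_
  rw [mem_Icc, not_and_or, not_le, not_le] at hx
  exact hx.elim (layer_of_lt hε) (layer_of_gt hε)

theorem integrable_layer {ε : ℝ} (hε : 0 < ε) : Integrable (layer ε) :=
  (continuous_layer ε).integrable_of_hasCompactSupport (hasCompactSupport_layer hε)

theorem integral_layer {ε : ℝ} (hε : 0 < ε) : ∫ x, layer ε x = 1 := by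
  unfold layer
  rw [integral_const_mul, Measure.integral_comp_div (fun y => deriv ramp (y - 1)) ε,
    integral_sub_right_eq_self (deriv ramp) 1, integral_deriv_ramp, abs_of_pos hε, smul_eq_mul,
    mul_one, inv_mul_cancel₀ hε.ne']

theorem integrable_layer_mul {ε D : ℝ} (hε : 0 < ε) {h : ℝ → ℝ} (hm : Measurable h)
    (hD : ∀ x, |h x| ≤ D) : Integrable fun x => layer ε x * h x := by
  simpa only [mul_comm] using integrable_bdd_mul (μ := volume) hm.aestronglyMeasurable hD
    (continuous_layer ε) (hasCompactSupport_layer hε)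

/-- Convergence of the averages near `0` implies convergence of the boundary layer integrals. -/
theorem tendsto_integral_layer_mul {h : ℝ → ℝ} {D c₀ : ℝ} (hm : Measurable h)
    (hD : ∀ x, |h x| ≤ D)
    (hlim : Tendsto (fun ε : ℝ => ε⁻¹ * ∫ x in Ioc 0 ε, |h x - c₀|) (𝓝[>] 0) (𝓝 0)) :
    Tendsto (fun ε => ∫ x, layer ε x * h x) (𝓝[>] 0) (𝓝 c₀) := by
  obtain ⟨c, hc, hcle⟩ := exists_deriv_ramp_le
  have hscale : Tendsto (fun ε : ℝ => 2 * ε) (𝓝[>] 0) (𝓝[>] 0) := by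
    refine tendsto_nhdsWithin_iff.2 ⟨?_, ?_⟩
    · have : Tendsto (fun ε : ℝ => 2 * ε) (𝓝 0) (𝓝 (2 * 0)) := tendsto_id.const_mul 2
      rw [mul_zero] at this
      exact this.mono_left nhdsWithin_le_nhds
    · filter_upwards [self_mem_nhdsWithin] with ε hε
      simpa using hε
  -- The kernel is at most `c / ε` and lives in `(0, 2ε]`, whence `2 c` times the average over `(0,
  -- 2ε]`.
  have hl2 := (hlim.comp hscale).const_mul (2 * c)
  rw [mul_zero] at hl2
  rw [tendsto_iff_norm_sub_tendsto_zero]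
  refine squeeze_zero' (Eventually.of_forall fun ε => norm_nonneg _) ?_ hl2
  filter_upwards [self_mem_nhdsWithin] with ε (hε : 0 < ε)
  have hb : ∀ x, |(|h x - c₀|)| ≤ D + |c₀| := fun x => by
    rw [abs_abs]
    exact (abs_sub _ _).trans (by linarith [hD x])
  have mh : Measurable fun x => |h x - c₀| := continuous_abs.measurable.comp (hm.sub_const c₀)
  have e : (∫ x, layer ε x * h x) - c₀ = ∫ x, layer ε x * (h x - c₀) := by
    have e1 : ∫ x, layer ε x * c₀ = c₀ := by
      rw [integral_mul_const, integral_layer hε, one_mul]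
    rw [← e1, ← integral_sub (integrable_layer_mul hε hm hD) ((integrable_layer hε).mul_const _),
      e1]
    refine integral_congr_ae (Eventually.of_forall fun x => ?_)
    simp only
    ring
  have hint : IntegrableOn (fun x => |h x - c₀|) (Ioc 0 (2 * ε)) :=
    Measure.integrableOn_of_bounded (M := D + |c₀|) measure_Ioc_lt_top.ne mh.aestronglyMeasurable
      (Eventually.of_forall hb)
  rw [e, Real.norm_eq_abs]
  calc |∫ x, layer ε x * (h x - c₀)| ≤ ∫ x, layer ε x * |h x - c₀| := by
        refine (abs_integral_le_integral_abs).trans_eq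
          (integral_congr_ae (Eventually.of_forall fun x => ?_))
        simp only
        rw [abs_mul, abs_of_nonneg (layer_nonneg hε x)]
    _ ≤ ∫ x, (Ioc 0 (2 * ε)).indicator (fun x => ε⁻¹ * c * |h x - c₀|) x := by
        refine integral_mono (integrable_layer_mul hε mh hb)
          ((integrable_indicator_iff measurableSet_Ioc).2 (hint.const_mul _)) fun x => ?_
        simp only
        by_cases hx : x ∈ Ioc 0 (2 * ε)
        · rw [indicator_of_mem hx]
          refine mul_le_mul_of_nonneg_right ?_ (abs_nonneg _)
          exact mul_le_mul_of_nonneg_left (hcle _) (inv_nonneg.2 hε.le)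
        · rw [indicator_of_notMem hx]
          rw [mem_Ioc, not_and_or, not_lt, not_le] at hx
          rcases hx with hx | hx
          · rw [layer_of_lt hε (hx.trans_lt hε), zero_mul]
          · rw [layer_of_gt hε hx, zero_mul]
    _ = _ := by
        rw [integral_indicator measurableSet_Ioc, integral_const_mul]
        simp only [Function.comp_apply, mul_inv]
        ring

/-- Traces pass through Lipschitz functions of two states. In particular the Kružkov flux of two
solutions has as trace the Kružkov flux of their traces. -/
theorem tendsto_average_of_le {h a b : ℝ → ℝ} {c₀ α β D N : ℝ} (ha : Measurable a)
    (hb : Measurable b) (haD : ∀ x, |a x| ≤ D) (hbD : ∀ x, |b x| ≤ D)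
    (hle : ∀ x, |h x - c₀| ≤ N * (|a x - α| + |b x - β|))
    (hla : Tendsto (fun ε : ℝ => ε⁻¹ * ∫ x in Ioc 0 ε, |a x - α|) (𝓝[>] 0) (𝓝 0))
    (hlb : Tendsto (fun ε : ℝ => ε⁻¹ * ∫ x in Ioc 0 ε, |b x - β|) (𝓝[>] 0) (𝓝 0)) :
    Tendsto (fun ε : ℝ => ε⁻¹ * ∫ x in Ioc 0 ε, |h x - c₀|) (𝓝[>] 0) (𝓝 0) := by
  have hl := (hla.add hlb).const_mul N
  rw [add_zero, mul_zero] at hl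
  have hi : ∀ (f : ℝ → ℝ) (γ ε : ℝ), Measurable f → (∀ x, |f x| ≤ D) →
      IntegrableOn (fun x => |f x - γ|) (Ioc 0 ε) := fun f γ ε hf hfD =>
    Measure.integrableOn_of_bounded (M := D + |γ|) measure_Ioc_lt_top.ne
      (continuous_abs.measurable.comp (hf.sub_const γ)).aestronglyMeasurable
      (Eventually.of_forall fun x => by
        rw [Real.norm_eq_abs, abs_abs]
        exact (abs_sub _ _).trans (by linarith [hfD x]))
  refine squeeze_zero' ?_ ?_ hl
  · filter_upwards [self_mem_nhdsWithin] with ε (hε : 0 < ε)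
    exact mul_nonneg (inv_nonneg.2 hε.le) (integral_nonneg fun x => abs_nonneg _)
  · filter_upwards [self_mem_nhdsWithin] with ε (hε : 0 < ε)
    have : ∫ x in Ioc 0 ε, |h x - c₀| ≤ N * ((∫ x in Ioc 0 ε, |a x - α|)
        + ∫ x in Ioc 0 ε, |b x - β|) := by
      rw [← integral_add (hi a α ε ha haD) (hi b β ε hb hbD), ← integral_const_mul]
      exact integral_mono_of_nonneg (Eventually.of_forall fun x => abs_nonneg _)
        (((hi a α ε ha haD).add (hi b β ε hb hbD)).const_mul N)
        (Eventually.of_forall fun x => hle x)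
    calc ε⁻¹ * ∫ x in Ioc 0 ε, |h x - c₀| ≤ ε⁻¹ * (N * ((∫ x in Ioc 0 ε, |a x - α|)
        + ∫ x in Ioc 0 ε, |b x - β|)) := mul_le_mul_of_nonneg_left this (inv_nonneg.2 hε.le)
      _ = _ := by ring

/-- `τ` is the trace of `U` for `x → 0+` on `[0,T]`. -/
def IsTrace (T : ℝ) (U : ℝ × ℝ → ℝ) (τ : ℝ → ℝ) : Prop :=
  ∀ᵐ t ∂(volume.restrict (Icc 0 T)),
    Tendsto (fun ε : ℝ => ε⁻¹ * ∫ x in Ioc 0 ε, |U (t, x) - τ t|) (𝓝[>] 0) (𝓝 0)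

section Problem

variable {T Cv m M : ℝ} {v V g uo ub a c : ℝ → ℝ} {u : ℝ → ℝ → ℝ} {U : ℝ × ℝ → ℝ} {τ : ℝ → ℝ}

theorem IsExtension.ae_slice_eq (hU : IsExtension T uo u m M a c U) :
    ∀ᵐ t ∂(volume.restrict (Icc 0 T)), ∀ᵐ x ∂(volume.restrict (Ioi 0)), U (t, x) = u t x := by
  have h := hU.ae_eq
  rw [Measure.volume_eq_prod, ← Measure.prod_restrict] at h
  exact Measure.ae_ae_of_ae_prod h

/-- For almost every `t` the slices of `U` and `u` have the same averages. The value is selected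
separately at each `t`; `0` is a dummy value on the exceptional null set. -/
theorem IsExtension.exists_isTrace (hU : IsExtension T uo u m M a c U) (h : HasTrace T u) :
    ∃ τ, IsTrace T U τ := by
  have h' : ∀ᵐ t ∂(volume.restrict (Icc 0 T)), ∃ ℓ : ℝ,
      Tendsto (fun ε : ℝ => ε⁻¹ * ∫ x in Ioc 0 ε, |U (t, x) - ℓ|) (𝓝[>] 0) (𝓝 0) := by
    filter_upwards [h, hU.ae_slice_eq] with t ⟨ℓ, hℓ⟩ ht
    refine ⟨ℓ, hℓ.congr fun ε => ?_⟩
    congr 1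
    refine integral_congr_ae ?_
    filter_upwards [ae_restrict_of_ae_restrict_of_subset Ioc_subset_Ioi_self ht] with x hx
    rw [hx]
  classical
  refine ⟨fun t => if hh : ∃ ℓ : ℝ, Tendsto (fun ε : ℝ => ε⁻¹ * ∫ x in Ioc 0 ε, |U (t, x) - ℓ|)
    (𝓝[>] 0) (𝓝 0) then hh.choose else 0, ?_⟩
  filter_upwards [h'] with t ht
  simp only [dif_pos ht]
  exact ht.choose_spec

theorem IsTrace.tendsto_layer {C : ℝ} (hτ : IsTrace T U τ) (hUm : Measurable U)
    (hUb : ∀ p, |U p| ≤ C) : ∀ᵐ t ∂(volume.restrict (Icc 0 T)),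
      Tendsto (fun ε => ∫ x, layer ε x * U (t, x)) (𝓝[>] 0) (𝓝 (τ t)) := by
  filter_upwards [hτ] with t ht
  exact tendsto_integral_layer_mul (hUm.comp measurable_prodMk_left) (fun x => hUb _) ht

theorem measurable_integral_layer_mul (hUm : Measurable U) (ε : ℝ) :
    Measurable fun t => ∫ x, layer ε x * U (t, x) := by
  have : StronglyMeasurable (Function.uncurry fun t x => layer ε x * U (t, x)) :=
    (((continuous_layer ε).measurable.comp measurable_snd).mul hUm).stronglyMeasurable
  exact this.integral_prod_right.measurable

/-- The selection of the trace carries no measurability by itself; it is recovered by writing the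
trace as an almost everywhere limit of boundary layer integrals. -/
theorem IsTrace.aestronglyMeasurable {C : ℝ} (hτ : IsTrace T U τ) (hUm : Measurable U)
    (hUb : ∀ p, |U p| ≤ C) : AEStronglyMeasurable τ (volume.restrict (Icc 0 T)) :=
  aestronglyMeasurable_of_tendsto_ae (𝓝[>] 0)
    (fun ε => (measurable_integral_layer_mul hUm ε).aestronglyMeasurable)
    (hτ.tendsto_layer hUm hUb)

theorem IsTrace.mem_Icc (hτ : IsTrace T U τ) (hUm : Measurable U) (hUmem : ∀ p, U p ∈ Icc m M) :
    ∀ᵐ t ∂(volume.restrict (Icc 0 T)), τ t ∈ Icc m M := by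
  have hb : ∀ p, |U p| ≤ max |m| |M| := fun p =>
    abs_le_of_mem_Icc (le_max_left _ _) (le_max_right _ _) (hUmem p)
  filter_upwards [hτ.tendsto_layer hUm hb] with t ht
  refine isClosed_Icc.mem_of_tendsto ht ?_
  filter_upwards [self_mem_nhdsWithin] with ε (hε : 0 < ε)
  have hi := integrable_layer_mul hε (hUm.comp measurable_prodMk_left : Measurable fun x => U (t, x))
    (fun x => hb _)
  have hc : ∀ r : ℝ, ∫ x, layer ε x * r = r := fun r => by
    rw [integral_mul_const, integral_layer hε, one_mul]
  constructor
  · conv_lhs => rw [← hc m]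
    exact integral_mono ((integrable_layer hε).mul_const _) hi fun x =>
      mul_le_mul_of_nonneg_left (hUmem _).1 (layer_nonneg hε x)
  · conv_rhs => rw [← hc M]
    exact integral_mono hi ((integrable_layer hε).mul_const _) fun x =>
      mul_le_mul_of_nonneg_left (hUmem _).2 (layer_nonneg hε x)

end Problem

/-- Each mollification of `h` at `t` is a pairing with an admissible `χ`, hence nonnegative, and
mollifications converge almost everywhere by Lebesgue differentiation. -/
theorem ae_nonneg_of_forall_integral_mul_nonneg {h : ℝ → ℝ} (hi : Integrable h)
    (hχ : ∀ χ : ℝ → ℝ, ContDiff ℝ 1 χ → HasCompactSupport χ → (∀ t, 0 ≤ χ t) →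
      0 ≤ ∫ t, χ t * h t) : ∀ᵐ t, 0 ≤ h t := by
  let b : ℕ → ContDiffBump (0 : ℝ) := fun n =>
    ⟨1 / (n + 1 : ℝ) / 2, 1 / (n + 1 : ℝ), by positivity, half_lt_self (by positivity)⟩
  have h1 : Tendsto (fun n => (b n).rOut) atTop (𝓝 0) := tendsto_one_div_add_atTop_nhds_zero_nat
  have h2 : ∀ᶠ n in atTop, (b n).rOut ≤ 2 * (b n).rIn := Eventually.of_forall fun n => by
    change 1 / (n + 1 : ℝ) ≤ 2 * (1 / (n + 1 : ℝ) / 2)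
    linarith
  filter_upwards [ContDiffBump.ae_convolution_tendsto_right_of_locallyIntegrable (μ := volume) h1 h2
    hi.locallyIntegrable] with t ht
  refine ge_of_tendsto' ht fun n => ?_
  rw [convolution_eq_swap]
  have := hχ (fun s => (b n).normed volume (t - s))
    ((b n).contDiff_normed.comp (contDiff_const.sub contDiff_id))
    ((b n).hasCompactSupport_normed.comp_homeomorph (Homeomorph.subLeft t))
    (fun s => (b n).nonneg_normed _)
  simpa using this

/-! ### The boundary condition satisfied by the trace -/

/-- Boundary inequality satisfied by the trace, for an entropy `E` with flux `V(t) G`. -/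
theorem IsTrace.ae_flux_le {T Cv m M N L D : ℝ} {V τ E G Eo ET Eb : ℝ → ℝ} {U : ℝ × ℝ → ℝ}
    (hτ : IsTrace T U τ) (hVm : Measurable V) (hVb : ∀ t, |V t| ≤ Cv)
    (hUm : Measurable U) (hUmem : ∀ p, U p ∈ Icc m M) (hE : Continuous E) (hG : Continuous G)
    (hGN : ∀ x ∈ Icc m M, ∀ y ∈ Icc m M, |G x - G y| ≤ N * |x - y|)
    (hEo : ∀ᵐ x ∂(volume.restrict (Ioi 0)), |Eo x| ≤ D)
    (hET : ∀ᵐ x ∂(volume.restrict (Ioi 0)), |ET x| ≤ D)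
    (hEb : IntegrableOn Eb (Icc 0 T))
    (h : ∀ φ : ℝ × ℝ → ℝ, ContDiff ℝ 1 φ → HasCompactSupport φ → (∀ p, 0 ≤ φ p) →
      0 ≤ (∫ p in Icc 0 T ×ˢ Ioi 0,
          (E (U p) * derivFst φ p + V p.1 * G (U p) * derivSnd φ p))
        + (∫ x in Ioi 0, Eo x * φ (0, x)) - (∫ x in Ioi 0, ET x * φ (T, x))
        + L * ∫ t in Icc 0 T, Eb t * φ (t, 0)) :
    ∀ᵐ t ∂(volume.restrict (Icc 0 T)), V t * G (τ t) ≤ L * Eb t := by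
  have hCv0 : 0 ≤ Cv := (abs_nonneg _).trans (hVb 0)
  obtain ⟨DE, hDE⟩ := (isCompact_Icc (a := m) (b := M)).exists_bound_of_continuousOn hE.continuousOn
  obtain ⟨DG, hDG⟩ := (isCompact_Icc (a := m) (b := M)).exists_bound_of_continuousOn hG.continuousOn
  have hDE0 : 0 ≤ DE := (norm_nonneg _).trans (hDE _ (hUmem 0))
  have hDG0 : 0 ≤ DG := (norm_nonneg _).trans (hDG _ (hUmem 0))
  have hUb : ∀ p, |U p| ≤ max |m| |M| := fun p =>
    abs_le_of_mem_Icc (le_max_left _ _) (le_max_right _ _) (hUmem p)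
  have hτmem := hτ.mem_Icc hUm hUmem
  have hτm := hτ.aestronglyMeasurable hUm hUb
  have iVG : IntegrableOn (fun t => V t * G (τ t)) (Icc 0 T) := by
    refine Integrable.of_bound (C := Cv * DG) ?_ ?_
    · exact hVm.aestronglyMeasurable.mul (hG.comp_aestronglyMeasurable hτm)
    · filter_upwards [hτmem] with t ht
      rw [norm_mul]
      exact mul_le_mul (hVb t) (hDG _ ht) (norm_nonneg _) hCv0
  have iH : IntegrableOn (fun t => L * Eb t - V t * G (τ t)) (Icc 0 T) := (hEb.const_mul L).sub iVG
  suffices hs : ∀ᵐ t, 0 ≤ (Icc 0 T).indicator (fun t => L * Eb t - V t * G (τ t)) t by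
    rw [ae_restrict_iff' measurableSet_Icc]
    filter_upwards [hs] with t ht htT
    rw [indicator_of_mem htT] at ht
    linarith
  refine ae_nonneg_of_forall_integral_mul_nonneg
    ((integrable_indicator_iff measurableSet_Icc).2 iH) fun χ hχ hχc hχ0 => ?_
  have hχi : Integrable χ := hχ.continuous.integrable_of_hasCompactSupport hχc
  obtain ⟨Dχ, hDχ⟩ := hχc.exists_bound_of_continuous hχ.continuous
  have hDχ0 : 0 ≤ Dχ := (norm_nonneg _).trans (hDχ 0)
  -- Equal to `1` at the boundary and to `0` beyond `2ε`; the second ramp only truncates at negative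
  -- `x`. On `ℝ₊` its derivative is `-layer ε`, which concentrates the flux at `x = 0`.
  set β : ℝ → ℝ → ℝ := fun ε x => (1 - ramp (x / ε - 1)) * ramp (x + 2) with hβ
  have hβ1 : ∀ ε x, 0 ≤ β ε x := fun ε x =>
    mul_nonneg (sub_nonneg.2 (Real.smoothTransition.le_one _)) (Real.smoothTransition.nonneg _)
  have hβ2 : ∀ ε > 0, ∀ x ∈ Ioi (0 : ℝ), |β ε x| ≤ (Ioc 0 (2 * ε)).indicator (fun _ => 1) x := by
    intro ε hε x hx
    rw [abs_of_nonneg (hβ1 ε x)]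
    by_cases hx2 : x ∈ Ioc 0 (2 * ε)
    · rw [indicator_of_mem hx2]
      have h1 := Real.smoothTransition.nonneg (x / ε - 1)
      have h2 := Real.smoothTransition.le_one (x / ε - 1)
      have h3 := Real.smoothTransition.nonneg (x + 2)
      have h4 := Real.smoothTransition.le_one (x + 2)
      simp only [hβ, ramp]
      nlinarith
    · have : 2 * ε < x := by
        by_contra h'
        exact hx2 ⟨hx, not_lt.1 h'⟩
      have h1 : ramp (x / ε - 1) = 1 := Real.smoothTransition.one_of_one_le (by
        rw [le_sub_iff_add_le, le_div_iff₀ hε]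
        linarith)
      rw [indicator_of_notMem hx2]
      simp [hβ, h1]
  have hβd : ∀ ε, ContDiff ℝ 1 (β ε) := fun ε =>
    (contDiff_const.sub (contDiff_ramp.comp (by fun_prop))).mul (contDiff_ramp.comp (by fun_prop))
  have hβc : ∀ ε > 0, HasCompactSupport (β ε) := fun ε hε => by
    refine HasCompactSupport.intro (isCompact_Icc (a := -2) (b := 2 * ε)) fun x hx => ?_
    rw [Set.mem_Icc, not_and_or, not_le, not_le] at hx
    rcases hx with hx | hx
    · have : ramp (x + 2) = 0 := Real.smoothTransition.zero_of_nonpos (by linarith)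
      simp [hβ, this]
    · have h1 : ramp (x / ε - 1) = 1 := Real.smoothTransition.one_of_one_le (by
        rw [le_sub_iff_add_le, le_div_iff₀ hε]
        linarith)
      simp [hβ, h1]
  have hβ' : ∀ ε, ∀ x ∈ Ioi (0 : ℝ), deriv (β ε) x = -layer ε x := by
    intro ε x hx
    have : β ε =ᶠ[𝓝 x] fun y => 1 - ramp (y / ε - 1) := by
      filter_upwards [Ioi_mem_nhds (show (0 : ℝ) < x from hx)] with y (hy : 0 < y)
      have : ramp (y + 2) = 1 := Real.smoothTransition.one_of_one_le (by linarith)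
      simp [hβ, this]
    rw [this.deriv_eq]
    exact ((hasDerivAt_ramp_div x).const_sub 1).deriv
  -- the inequality for `φ(t,x) = χ(t) β_ε(x)`
  have hS : MeasurableSet (Icc 0 T ×ˢ Ioi (0 : ℝ)) := measurableSet_Icc.prod measurableSet_Ioi
  have mE : Measurable fun p => E (U p) := hE.measurable.comp hUm
  have mG : Measurable fun p => G (U p) := hG.measurable.comp hUm
  have bE : ∀ p, |E (U p)| ≤ DE := fun p => hDE _ (hUmem p)
  have bG : ∀ p, |G (U p)| ≤ DG := fun p => hDG _ (hUmem p)
  -- Coefficients of the three terms that do not see the boundary: time derivative, initial slice,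
  -- final slice. Each is supported in a strip of width `2ε`, hence of order `ε`.
  set A : ℝ := DE * (∫ t, |deriv χ t|) * 2 + D * Dχ * 2 + D * Dχ * 2 with hA
  have hind : ∀ ε : ℝ, IntegrableOn ((Ioc 0 (2 * ε)).indicator fun _ => (1 : ℝ)) (Ioi 0) :=
    fun ε => ((integrable_indicator_iff measurableSet_Ioc).2
      (integrableOn_const measure_Ioc_lt_top.ne)).integrableOn
  have hindv : ∀ ε > 0, ∫ x in Ioi 0, (Ioc 0 (2 * ε)).indicator (fun _ => (1 : ℝ)) x = 2 * ε := by
    intro ε hε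
    rw [setIntegral_indicator measurableSet_Ioc, inter_eq_right.2 Ioc_subset_Ioi_self,
      setIntegral_const, smul_eq_mul, mul_one, Real.volume_real_Ioc_of_le (by linarith), sub_zero]
  have hbdry : ∀ (w : ℝ → ℝ), (∀ᵐ x ∂(volume.restrict (Ioi 0)), |w x| ≤ D) → ∀ t, ∀ ε > 0,
      |∫ x in Ioi 0, w x * (χ t * β ε x)| ≤ D * Dχ * 2 * ε := by
    intro w hw t ε hε
    calc |∫ x in Ioi 0, w x * (χ t * β ε x)|
        ≤ ∫ x in Ioi 0, D * Dχ * (Ioc 0 (2 * ε)).indicator (fun _ => (1 : ℝ)) x := by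
          refine (abs_integral_le_integral_abs).trans (integral_mono_of_nonneg
            (Eventually.of_forall fun x => abs_nonneg _) ((hind ε).const_mul _) ?_)
          filter_upwards [hw, ae_restrict_mem measurableSet_Ioi] with x hx hx0
          rw [abs_mul, abs_mul, mul_assoc]
          have hD0 : 0 ≤ D := (abs_nonneg _).trans hx
          exact mul_le_mul hx (mul_le_mul (hDχ t) (hβ2 ε hε x hx0) (abs_nonneg _) hDχ0)
            (by positivity) hD0
      _ = D * Dχ * 2 * ε := by
          rw [integral_const_mul, hindv ε hε]
          ring
  have hχ'i : Integrable fun t => |deriv χ t| :=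
    ((hχ.continuous_deriv le_rfl).integrable_of_hasCompactSupport hχc.deriv).abs
  have hineq : ∀ ε > 0, (∫ t in Icc 0 T, χ t * (V t * ∫ x, layer ε x * G (U (t, x))))
      ≤ A * ε + L * ∫ t in Icc 0 T, Eb t * χ t := by
    intro ε hε
    set φ : ℝ × ℝ → ℝ := fun p => χ p.1 * β ε p.2 with hφ
    have hφd : ContDiff ℝ 1 φ := (hχ.comp contDiff_fst).mul ((hβd ε).comp contDiff_snd)
    have hφc : HasCompactSupport φ := hasCompactSupport_mul_prod hχc (hβc ε hε)
    have hmain := h φ hφd hφc fun p => mul_nonneg (hχ0 _) (hβ1 _ _)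
    have d1 : ∀ p, derivFst φ p = deriv χ p.1 * β ε p.2 := fun p => by
      change deriv (fun s => χ s * β ε p.2) p.1 = _
      exact (((hχ.differentiable one_ne_zero _).hasDerivAt).mul_const _).deriv
    have d2 : ∀ p, derivSnd φ p = χ p.1 * deriv (β ε) p.2 := fun p => by
      change deriv (fun y => χ p.1 * β ε y) p.2 = _
      exact ((((hβd ε).differentiable one_ne_zero _).hasDerivAt).const_mul _).deriv
    have i1 : Integrable fun p => E (U p) * derivFst φ p :=
      integrable_bdd_mul mE.aestronglyMeasurable bE (continuous_derivFst hφd)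
        (hasCompactSupport_derivFst hφd hφc)
    have i2 : Integrable fun p => V p.1 * G (U p) * derivSnd φ p := by
      refine integrable_bdd_mul (C := Cv * DG) ((hVm.comp measurable_fst).mul mG).aestronglyMeasurable
        (fun p => ?_) (continuous_derivSnd hφd) (hasCompactSupport_derivSnd hφd hφc)
      rw [abs_mul]
      exact mul_le_mul (hVb _) (bG p) (abs_nonneg _) hCv0
    have t1 : |∫ p in Icc 0 T ×ˢ Ioi 0, E (U p) * derivFst φ p|
        ≤ DE * (∫ t, |deriv χ t|) * 2 * ε := by
      have ip : Integrable (fun p : ℝ × ℝ => |deriv χ p.1| *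
          (Ioc 0 (2 * ε)).indicator (fun _ => (1 : ℝ)) p.2)
          ((volume.restrict (Icc 0 T)).prod (volume.restrict (Ioi 0))) :=
        (hχ'i.integrableOn (s := Icc 0 T)).mul_prod (hind ε)
      rw [Measure.volume_eq_prod, ← Measure.prod_restrict]
      calc |∫ p, E (U p) * derivFst φ p ∂((volume.restrict (Icc 0 T)).prod
              (volume.restrict (Ioi 0)))|
          ≤ ∫ p, DE * (|deriv χ p.1| * (Ioc 0 (2 * ε)).indicator (fun _ => (1 : ℝ)) p.2)
              ∂((volume.restrict (Icc 0 T)).prod (volume.restrict (Ioi 0))) := by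
            refine (abs_integral_le_integral_abs).trans (integral_mono_of_nonneg
              (Eventually.of_forall fun x => abs_nonneg _) (ip.const_mul _) ?_)
            rw [Measure.prod_restrict]
            filter_upwards [ae_restrict_mem hS] with p hp
            rw [d1, abs_mul, abs_mul]
            exact mul_le_mul (bE p) (mul_le_mul_of_nonneg_left (hβ2 ε hε p.2 hp.2) (abs_nonneg _))
              (by positivity) hDE0
        _ = DE * ((∫ t in Icc 0 T, |deriv χ t|) * (2 * ε)) := by
            rw [integral_const_mul, integral_prod_mul (fun t => |deriv χ t|)
              ((Ioc 0 (2 * ε)).indicator fun _ => (1 : ℝ)), hindv ε hε]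
        _ ≤ DE * ((∫ t, |deriv χ t|) * (2 * ε)) := by
            refine mul_le_mul_of_nonneg_left (mul_le_mul_of_nonneg_right ?_ (by positivity)) hDE0
            exact setIntegral_le_integral hχ'i (Eventually.of_forall fun t => abs_nonneg _)
        _ = _ := by ring
    have t2 : ∫ p in Icc 0 T ×ˢ Ioi 0, V p.1 * G (U p) * derivSnd φ p
        = -∫ t in Icc 0 T, χ t * (V t * ∫ x, layer ε x * G (U (t, x))) := by
      have i2' : Integrable (fun p => V p.1 * G (U p) * derivSnd φ p)
          ((volume.restrict (Icc 0 T)).prod (volume.restrict (Ioi 0))) := by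
        rw [Measure.prod_restrict]
        exact i2.integrableOn
      rw [Measure.volume_eq_prod, ← Measure.prod_restrict, integral_prod _ i2', ← integral_neg]
      refine integral_congr_ae (Eventually.of_forall fun t => ?_)
      simp only
      rw [← mul_assoc, ← setIntegral_eq_integral_of_forall_compl_eq_zero (s := Ioi 0)
        (f := fun x => layer ε x * G (U (t, x))), ← integral_const_mul, ← integral_neg]
      · refine setIntegral_congr_fun measurableSet_Ioi fun x hx => ?_
        simp only [d2, hβ' ε x hx]
        ring
      · intro x hx
        rw [layer_of_lt hε ((not_lt.1 hx).trans_lt hε), zero_mul]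
    have e4 : ∫ t in Icc 0 T, Eb t * φ (t, 0) = ∫ t in Icc 0 T, Eb t * χ t := by
      have hb0 : β ε 0 = 1 := by
        have h1 : ramp (0 / ε - 1) = 0 := Real.smoothTransition.zero_of_nonpos (by norm_num)
        have h2 : ramp (0 + 2) = 1 := Real.smoothTransition.one_of_one_le (by norm_num)
        simp only [hβ, h1, h2]
        norm_num
      simp [hφ, hb0]
    rw [integral_add i1.integrableOn i2.integrableOn, t2, e4] at hmain
    have b1 := (abs_le.1 t1).2
    have b2 := (abs_le.1 (hbdry Eo hEo 0 ε hε)).2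
    have b3 := (abs_le.1 (hbdry ET hET T ε hε)).1
    rw [hA]
    simp only [hφ] at hmain
    linarith
  -- passage to the limit
  have hlim : Tendsto (fun ε => ∫ t in Icc 0 T, χ t * (V t * ∫ x, layer ε x * G (U (t, x))))
      (𝓝[>] 0) (𝓝 (∫ t in Icc 0 T, χ t * (V t * G (τ t)))) := by
    refine tendsto_integral_filter_of_dominated_convergence (fun t => Dχ * (Cv * DG)) ?_ ?_ ?_ ?_
    · refine Eventually.of_forall fun ε => ?_
      exact (hχ.continuous.measurable.mul
        (hVm.mul (measurable_integral_layer_mul mG ε))).aestronglyMeasurable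
    · filter_upwards [self_mem_nhdsWithin] with ε (hε : 0 < ε)
      refine Eventually.of_forall fun t => ?_
      have : |∫ x, layer ε x * G (U (t, x))| ≤ DG := by
        calc |∫ x, layer ε x * G (U (t, x))| ≤ ∫ x, layer ε x * DG := by
              refine (abs_integral_le_integral_abs).trans (integral_mono_of_nonneg
                (Eventually.of_forall fun x => abs_nonneg _) ((integrable_layer hε).mul_const _)
                (Eventually.of_forall fun x => ?_))
              simp only
              rw [abs_mul, abs_of_nonneg (layer_nonneg hε x)]
              exact mul_le_mul_of_nonneg_left (bG _) (layer_nonneg hε x)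
          _ = DG := by rw [integral_mul_const, integral_layer hε, one_mul]
      rw [norm_mul, norm_mul]
      exact mul_le_mul (hDχ t) (mul_le_mul (hVb t) this (norm_nonneg _) hCv0)
        (by positivity) hDχ0
    · exact integrableOn_const measure_Icc_lt_top.ne
    · filter_upwards [hτ, hτmem] with t ht htm
      refine Tendsto.const_mul _ (Tendsto.const_mul _ ?_)
      -- The lemma for two states is used with both equal to `U`; `|N|` replaces `N`, whose sign is
      -- not prescribed.
      refine tendsto_integral_layer_mul (mG.comp measurable_prodMk_left) (fun x => bG _) ?_
      refine tendsto_average_of_le (a := fun x => U (t, x)) (b := fun x => U (t, x))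
        (α := τ t) (β := τ t) (N := |N|) (hUm.comp measurable_prodMk_left)
        (hUm.comp measurable_prodMk_left) (fun x => hUb _) (fun x => hUb _) (fun x => ?_) ht ht
      refine (hGN _ (hUmem _) _ htm).trans ?_
      have h1 := le_abs_self N
      have h2 := abs_nonneg (U (t, x) - τ t)
      nlinarith [abs_nonneg N]
  have hlim2 : Tendsto (fun ε : ℝ => A * ε + L * ∫ t in Icc 0 T, Eb t * χ t) (𝓝[>] 0)
      (𝓝 (A * 0 + L * ∫ t in Icc 0 T, Eb t * χ t)) :=
    ((tendsto_id.const_mul A).add_const _).mono_left nhdsWithin_le_nhds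
  have hfin := le_of_tendsto_of_tendsto hlim hlim2 (by
    filter_upwards [self_mem_nhdsWithin] with ε hε using hineq ε hε)
  have e : ∫ t, χ t * (Icc 0 T).indicator (fun t => L * Eb t - V t * G (τ t)) t
      = L * (∫ t in Icc 0 T, Eb t * χ t) - ∫ t in Icc 0 T, χ t * (V t * G (τ t)) := by
    have j1 : IntegrableOn (fun t => Eb t * χ t) (Icc 0 T) := by
      have : Integrable (fun t => χ t * Eb t) (volume.restrict (Icc 0 T)) :=
        hEb.bdd_mul (c := Dχ) hχ.continuous.aestronglyMeasurable (Eventually.of_forall hDχ)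
      exact this.congr (Eventually.of_forall fun t => mul_comm _ _)
    have j2 : IntegrableOn (fun t => χ t * (V t * G (τ t))) (Icc 0 T) :=
      iVG.bdd_mul (c := Dχ) hχ.continuous.aestronglyMeasurable (Eventually.of_forall hDχ)
    rw [← integral_const_mul, ← integral_sub (j1.const_mul L) j2,
      ← integral_indicator measurableSet_Icc]
    refine integral_congr_ae (Eventually.of_forall fun t => ?_)
    simp only [indicator]
    split_ifs <;> ring
  rw [e]
  linarith

/-- The Bardos–Le Roux–Nédélec condition between a boundary value `b` and a trace `τ`. -/
structure IsAdmissibleTrace (g : ℝ → ℝ) (m M b τ : ℝ) : Prop where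
  upper : ∀ k ∈ Icc m M, b ≤ k → g (max τ k) ≤ g k
  lower : ∀ k ∈ Icc m M, k ≤ b → g k ≤ g (min τ k)

section Problem

variable {T Cv m M : ℝ} {v V g uo ub a c : ℝ → ℝ} {u : ℝ → ℝ → ℝ} {U : ℝ × ℝ → ℝ} {τ : ℝ → ℝ}

/-- For one level the boundary inequality holds off a null set of times depending on the level. A
countable dense family of levels gives a common null set, and continuity in the level does the rest.
-/
theorem IsSolution.isAdmissibleTrace (hP : IsProblem T Cv v V g uo ub m M)
    (hv : ∀ t ∈ Icc 0 T, 0 < v t) (hu : IsSolution T (fun t r => v t * g r) uo ub u)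
    (hU : IsExtension T uo u m M a c U) (hτ : IsTrace T U τ) :
    ∀ᵐ t ∂(volume.restrict (Icc 0 T)), IsAdmissibleTrace g m M (ub t) (τ t) := by
  set C := max |m| |M| with hC
  have hmM := hP.le
  have hgc := hP.contDiff.continuous
  have bC : ∀ x ∈ Icc m M, |x| ≤ C := fun x hx =>
    abs_le_of_mem_Icc (le_max_left _ _) (le_max_right _ _) hx
  obtain ⟨N, hN0, hN⟩ := exists_lipschitz_bound hP.contDiff C
  obtain ⟨-, huT⟩ := hu.mem_Icc hP
  set L := fluxLip T (fun t r => v t * g r) uo ub with hL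
  -- Clamping rationals produces a countable family of levels inside `[m, M]` that is dense there,
  -- even if `m = M`.
  set cl : ℝ → ℝ := fun r => max m (min M r) with hcl
  have ccl : Continuous cl := by fun_prop
  have hclm : ∀ r, cl r ∈ Icc m M := fun r => ⟨le_max_left _ _, max_le hmM (min_le_left _ _)⟩
  have hcle : ∀ k ∈ Icc m M, cl k = k := fun k hk => by
    simp only [hcl]
    rw [min_eq_right hk.2, max_eq_right hk.1]
  have bdiff : ∀ x ∈ Icc m M, ∀ k ∈ Icc m M, |x - k| ≤ 2 * C := fun x hx k hk =>
    (abs_sub _ _).trans (by linarith [bC x hx, bC k hk])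
  have bpos : ∀ x ∈ Icc m M, ∀ k ∈ Icc m M, |pos (x - k)| ≤ 2 * C := fun x hx k hk => by
    rw [abs_of_nonneg (pos_nonneg _)]
    exact (pos_le_abs _).trans (bdiff x hx k hk)
  have bneg : ∀ x ∈ Icc m M, ∀ k ∈ Icc m M, |neg (x - k)| ≤ 2 * C := fun x hx k hk => by
    rw [abs_of_nonneg (neg_nonneg' _)]
    exact (neg_le_abs' _).trans (bdiff x hx k hk)
  have up : ∀ q : ℚ, ∀ᵐ t ∂(volume.restrict (Icc 0 T)),
      V t * (g (max (τ t) (cl q)) - g (cl q)) ≤ L * pos (ub t - cl q) := by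
    intro q
    have hk := hclm (q : ℝ)
    set k := cl (q : ℝ)
    refine hτ.ae_flux_le (E := fun r => pos (r - k)) (G := fun r => g (max r k) - g k)
      (Eo := fun x => pos (uo x - k)) (ET := fun x => pos (u T x - k)) (D := 2 * C) (N := N)
      hP.meas hP.bdd hU.meas hU.mem (continuous_pos.comp (by fun_prop)) (by fun_prop) ?_ ?_ ?_ ?_ ?_
    · intro x hx y hy
      rw [sub_sub_sub_cancel_right]
      refine (hN _ _ (abs_max_le (bC x hx) (bC k hk)) (abs_max_le (bC y hy) (bC k hk))).trans ?_
      refine mul_le_mul_of_nonneg_left ?_ hN0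
      exact abs_max_sub_max_le_abs x y k
    · filter_upwards [hP.uo_mem] with x hx using bpos _ hx _ hk
    · filter_upwards [huT] with x hx using bpos _ hx _ hk
    · refine Integrable.of_bound (C := 2 * C) (continuous_pos.comp_aestronglyMeasurable
        (hP.ub_meas.sub aestronglyMeasurable_const)) ?_
      filter_upwards [hP.ub_mem] with x hx using bpos _ hx _ hk
    · intro φ hφ hφc hφ0
      have h := (hu.entropy k (hP.hull ▸ hk) φ hφ hφc hφ0).1
      rwa [entropyForm_pos hP hU.ae_eq] at h
  have lo : ∀ q : ℚ, ∀ᵐ t ∂(volume.restrict (Icc 0 T)),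
      V t * (g (cl q) - g (min (τ t) (cl q))) ≤ L * neg (ub t - cl q) := by
    intro q
    have hk := hclm (q : ℝ)
    set k := cl (q : ℝ)
    refine hτ.ae_flux_le (E := fun r => neg (r - k)) (G := fun r => g k - g (min r k))
      (Eo := fun x => neg (uo x - k)) (ET := fun x => neg (u T x - k)) (D := 2 * C) (N := N)
      hP.meas hP.bdd hU.meas hU.mem (continuous_neg'.comp (by fun_prop)) (by fun_prop) ?_ ?_ ?_ ?_ ?_
    · intro x hx y hy
      rw [sub_sub_sub_cancel_left, abs_sub_comm]
      refine (hN _ _ (abs_min_le (bC x hx) (bC k hk)) (abs_min_le (bC y hy) (bC k hk))).trans ?_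
      refine mul_le_mul_of_nonneg_left ?_ hN0
      have := abs_min_sub_min_le_max x k y k
      rwa [sub_self, abs_zero, max_eq_left (abs_nonneg _)] at this
    · filter_upwards [hP.uo_mem] with x hx using bneg _ hx _ hk
    · filter_upwards [huT] with x hx using bneg _ hx _ hk
    · refine Integrable.of_bound (C := 2 * C) (continuous_neg'.comp_aestronglyMeasurable
        (hP.ub_meas.sub aestronglyMeasurable_const)) ?_
      filter_upwards [hP.ub_mem] with x hx using bneg _ hx _ hk
    · intro φ hφ hφc hφ0
      have h := (hu.entropy k (hP.hull ▸ hk) φ hφ hφc hφ0).2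
      rwa [entropyForm_neg hP hU.ae_eq] at h
  filter_upwards [ae_all_iff.2 up, ae_all_iff.2 lo, ae_restrict_mem measurableSet_Icc]
    with t h1 h2 ht
  have hVt : 0 < V t := by
    rw [hP.eq_of_mem t ht]
    exact hv t ht
  -- Both sides are continuous in `r`, so the rational case suffices. For `ub t ≤ k` the right side
  -- is zero, and the positive factor `V t` can be dropped.
  have h1' : ∀ r : ℝ, V t * (g (max (τ t) (cl r)) - g (cl r)) ≤ L * pos (ub t - cl r) := fun r =>
    Rat.denseRange_cast.induction_on r (isClosed_le (by fun_prop)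
      (continuous_const.mul (continuous_pos.comp (by fun_prop)))) h1
  have h2' : ∀ r : ℝ, V t * (g (cl r) - g (min (τ t) (cl r))) ≤ L * neg (ub t - cl r) := fun r =>
    Rat.denseRange_cast.induction_on r (isClosed_le (by fun_prop)
      (continuous_const.mul (continuous_neg'.comp (by fun_prop)))) h2
  constructor
  · intro k hk hbk
    have h := h1' k
    rw [hcle k hk, pos_eq_zero_iff.2 (sub_nonpos.2 hbk), mul_zero] at h
    by_contra hcon
    exact absurd h (not_le.2 (mul_pos hVt (by linarith)))
  · intro k hk hkb
    have h := h2' k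
    rw [hcle k hk, neg_eq_zero_iff'.2 (sub_nonneg.2 hkb), mul_zero] at h
    by_contra hcon
    exact absurd h (not_le.2 (mul_pos hVt (by linarith)))

end Problem

/-- The flux between two admissible traces is controlled by the boundary data only. -/
theorem IsAdmissibleTrace.sub_le {g : ℝ → ℝ} {m M m' M' b b' τ τ' G : ℝ}
    (h : IsAdmissibleTrace g m M b τ) (h' : IsAdmissibleTrace g m' M' b' τ') (hb : b ∈ Icc m M)
    (hτ : τ ∈ Icc m M) (hb' : b' ∈ Icc m' M') (hτ' : τ' ∈ Icc m' M') (hG0 : 0 ≤ G)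
    (hG : ∀ x ∈ uIcc b b', ∀ y ∈ uIcc b b', |g x - g y| ≤ G * |x - y|) (hle : τ' ≤ τ) :
    g τ - g τ' ≤ G * |b - b'| := by
  have hnn : 0 ≤ G * |b - b'| := by positivity
  have U1 : ∀ k, b ≤ k → k ≤ τ → g τ ≤ g k := fun k h1 h2 => by
    have := h.upper k ⟨hb.1.trans h1, h2.trans hτ.2⟩ h1
    rwa [max_eq_left h2] at this
  have L1 : ∀ k, τ' ≤ k → k ≤ b' → g k ≤ g τ' := fun k h1 h2 => by
    have := h'.lower k ⟨hτ'.1.trans h1, h2.trans hb'.2⟩ h2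
    rwa [min_eq_left h1] at this
  have est : ∀ x y, b' ≤ y → y ≤ x → x ≤ b → g x - g y ≤ G * |b - b'| := fun x y h1 h2 h3 => by
    have hx : x ∈ uIcc b b' := mem_uIcc.2 (Or.inr ⟨h1.trans h2, h3⟩)
    have hy : y ∈ uIcc b b' := mem_uIcc.2 (Or.inr ⟨h1, h2.trans h3⟩)
    refine (le_abs_self _).trans ((hG x hx y hy).trans (mul_le_mul_of_nonneg_left ?_ hG0))
    rw [abs_of_nonneg (by linarith), abs_of_nonneg (by linarith)]
    linarith
  -- If `τ > b`, `U1` lets the first state slide down from `τ` to `b` without decreasing `g`. If `τ'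
  -- < b'`, `L1` lets the second slide up from `τ'` to `b'` without increasing `g`. Should the
  -- states meet on the way, `g τ ≤ g τ'`. Otherwise they end at `x ≥ y` in `[b', b]`, and `est`
  -- applies.
  rcases le_total τ b with hτb | hτb <;> rcases le_total b' τ' with hτb' | hτb'
  · exact est τ τ' hτb' hle hτb
  · rcases le_total τ b' with h3 | h3
    · linarith [L1 τ hle h3]
    · linarith [L1 b' hτb' le_rfl, est τ b' le_rfl h3 hτb]
  · rcases le_total b τ' with h3 | h3
    · linarith [U1 τ' h3 hle]
    · linarith [U1 b le_rfl hτb, est b τ' hτb' h3 le_rfl]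
  · rcases le_total b b' with h3 | h3
    · have h1 := U1 (max b τ') (le_max_left _ _) (max_le hτb hle)
      have h2 := L1 (max b τ') (le_max_right _ _) (max_le h3 hτb')
      linarith
    · linarith [U1 b le_rfl hτb, L1 b' hτb' le_rfl, est b b' le_rfl h3 le_rfl]

theorem IsAdmissibleTrace.kflux_le {g : ℝ → ℝ} {m M m' M' b b' τ τ' G : ℝ}
    (h : IsAdmissibleTrace g m M b τ) (h' : IsAdmissibleTrace g m' M' b' τ') (hb : b ∈ Icc m M)
    (hτ : τ ∈ Icc m M) (hb' : b' ∈ Icc m' M') (hτ' : τ' ∈ Icc m' M') (hG0 : 0 ≤ G)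
    (hG : ∀ x ∈ uIcc b b', ∀ y ∈ uIcc b b', |g x - g y| ≤ G * |x - y|) :
    kflux g τ τ' ≤ G * |b - b'| := by
  unfold kflux
  rcases le_total τ' τ with hle | hle
  · rw [max_eq_left hle, min_eq_right hle]
    exact h.sub_le h' hb hτ hb' hτ' hG0 hG hle
  · rw [max_eq_right hle, min_eq_left hle, abs_sub_comm]
    rw [uIcc_comm] at hG
    exact h'.sub_le h hb' hτ' hb hτ hG0 hG hle

/-! ### The `L¹` estimate -/

section Estimate

variable {T Cv C : ℝ} {V g a a' τ τ' β : ℝ → ℝ} {U U' : ℝ × ℝ → ℝ}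

/-- The estimate for the averages in time, before the passage to the limit in the boundary
layer. -/
theorem IsKruzkovSolution.average_le_add_layer (hU : IsKruzkovSolution g V C U)
    (hU' : IsKruzkovSolution g V C U') (hg : ContDiff ℝ 1 g) (hVm : Measurable V)
    (hVb : ∀ t, |V t| ≤ Cv) (hVi : Integrable V) (hV0 : ∀ t, t ∉ Icc 0 T → V t = 0)
    (ha : ∀ t < 0, ∀ x, U (t, x) = a x) (ha' : ∀ t < 0, ∀ x, U' (t, x) = a' x)
    (hai : IntegrableOn (fun x => |a x - a' x|) (Ioi 0)) {t₀ h X ε : ℝ} (ht₀ : t₀ ∈ Icc 0 T)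
    (hh : 0 < h) (hh1 : h ≤ 1) (hX : 1 ≤ X) (hε : 0 < ε) (hε1 : 2 * ε ≤ 1) :
    (∫ t, layer h (t₀ + h - t) * ∫ x in Ioc 0 X, |U (t, x) - U' (t, x)|) ≤
      4 * C * ε + (∫ x in Ioi 0, |a x - a' x|)
      + ∫ t in Icc 0 T, ramp (t + 2) * ramp ((t₀ + h - t) / h - 1) *
          (V t * ∫ x, layer ε x * kflux g (U (t, x)) (U' (t, x))) := by
  obtain ⟨N₀, hN₀, hN⟩ := exists_lipschitz_bound hg C
  have hC0 : 0 ≤ C := (abs_nonneg _).trans (hU.bdd 0)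
  have hCv0 : 0 ≤ Cv := (abs_nonneg _).trans (hVb 0)
  have hT0 : 0 ≤ T := ht₀.1.trans ht₀.2
  set N := Cv * N₀ with hNdef
  have hN0 : 0 ≤ N := by positivity
  -- With this `R` the moving cut-off `θ` still equals `1` on `(0, X]` for every `t ≤ T`.
  set R := X + N * T with hR
  -- The time cut-off `χ` rises on `[-2, -1]`, where the solutions equal their initial data, and
  -- falls on `[t₀ - h, t₀]` with slope `-κ`. As `h ≤ 1` and `t₀ ≥ 0`, the fall starts no earlier
  -- than the rise has ended.
  set κ : ℝ → ℝ := fun t => layer h (t₀ + h - t) with hκ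
  set χ : ℝ → ℝ := fun t => ramp (t + 2) * ramp ((t₀ + h - t) / h - 1) with hχ
  set ψ : ℝ → ℝ := fun x => ramp (x / ε - 1) with hψ
  set θ : ℝ × ℝ → ℝ := fun p => ramp (R + 1 - (p.2 + N * p.1)) with hθ
  set θ' : ℝ × ℝ → ℝ := fun p => deriv ramp (R + 1 - (p.2 + N * p.1)) with hθ'
  set D : ℝ × ℝ → ℝ := fun p => |U p - U' p| with hD
  set q : ℝ × ℝ → ℝ := fun p => kflux g (U p) (U' p) with hq
  have r0 := Real.smoothTransition.nonneg
  have r1 := Real.smoothTransition.le_one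
  have κ0 : ∀ t, 0 ≤ κ t := fun t => layer_nonneg hh _
  have κz : ∀ t, κ t ≠ 0 → t ∈ Icc (t₀ - h) t₀ := fun t ht => by
    constructor
    · by_contra hc
      exact ht (layer_of_gt hh (by linarith))
    · by_contra hc
      exact ht (layer_of_lt hh (by linarith))
  have cκ : Continuous κ := (continuous_layer h).comp (by fun_prop)
  have iκ : Integrable κ := (integrable_layer hh).comp_sub_left (t₀ + h)
  have vκ : ∫ t, κ t = 1 := by
    rw [hκ, integral_sub_left_eq_self (layer h) _ (t₀ + h), integral_layer hh]
  -- the test function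
  set φ : ℝ × ℝ → ℝ := fun p => χ p.1 * ψ p.2 * θ p with hφ
  have dχ : ∀ t, HasDerivAt χ (deriv ramp (t + 2) - κ t) t := by
    intro t
    have d1 : HasDerivAt (fun t => ramp (t + 2)) (deriv ramp (t + 2)) t :=
      (hasDerivAt_ramp (t + 2)).comp_add_const t 2
    have d2 : HasDerivAt (fun t => ramp ((t₀ + h - t) / h - 1)) (-κ t) t :=
      (hasDerivAt_ramp_div (ε := h) (t₀ + h - t)).comp_const_sub (t₀ + h) t
    have d3 := d1.mul d2
    convert! d3 using 1
    have e1 : deriv ramp (t + 2) * ramp ((t₀ + h - t) / h - 1) = deriv ramp (t + 2) := by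
      rcases le_or_gt t (-1) with ht | ht
      · have : ramp ((t₀ + h - t) / h - 1) = 1 := Real.smoothTransition.one_of_one_le (by
          rw [le_sub_iff_add_le, le_div_iff₀ hh]
          linarith [ht₀.1])
        rw [this, mul_one]
      · rw [deriv_ramp_of_gt (by linarith), zero_mul]
    have e2 : ramp (t + 2) * -κ t = -κ t := by
      by_cases hk : κ t = 0
      · rw [hk, neg_zero, mul_zero]
      · have : ramp (t + 2) = 1 := Real.smoothTransition.one_of_one_le (by
          linarith [(κz t hk).1, ht₀.1])
        rw [this, one_mul]
    rw [e1, e2]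
    ring
  have cχ : ContDiff ℝ 1 χ :=
    (contDiff_ramp.comp (by fun_prop)).mul (contDiff_ramp.comp (by fun_prop))
  have cψ : ContDiff ℝ 1 ψ := contDiff_ramp.comp (by fun_prop)
  have cθ : ContDiff ℝ 1 θ := contDiff_ramp.comp (by fun_prop)
  have hφd : ContDiff ℝ 1 φ := ((cχ.comp contDiff_fst).mul (cψ.comp contDiff_snd)).mul cθ
  have χ0 : ∀ t, 0 ≤ χ t := fun t => mul_nonneg (r0 _) (r0 _)
  have ψ0 : ∀ x, 0 ≤ ψ x := fun x => r0 _
  have θ0 : ∀ p, 0 ≤ θ p := fun p => r0 _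
  have ψz : ∀ x ≤ ε, ψ x = 0 := fun x hx => Real.smoothTransition.zero_of_nonpos (by
    rw [sub_nonpos, div_le_one hε]
    exact hx)
  have hφc : HasCompactSupport φ := by
    refine HasCompactSupport.intro (K := Icc (-2) t₀ ×ˢ Icc 0 (R + 1 + 2 * N))
      (isCompact_Icc.prod isCompact_Icc) fun p hp => ?_
    by_contra hne
    simp only [hφ, hχ, hψ, hθ, mul_eq_zero, not_or, ramp,
      Real.smoothTransition.zero_iff_nonpos, not_le] at hne
    obtain ⟨⟨⟨h1, h2⟩, h3⟩, h4⟩ := hne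
    have h2' : p.1 ≤ t₀ := by
      have := (lt_div_iff₀ hh).1 (sub_pos.1 h2)
      linarith
    have h3' : 0 ≤ p.2 := by
      have := (lt_div_iff₀ hε).1 (sub_pos.1 h3)
      linarith
    exact hp ⟨⟨by linarith, h2'⟩, ⟨h3', by nlinarith⟩⟩
  have d1 : ∀ p, derivFst φ p = (deriv ramp (p.1 + 2) - κ p.1) * ψ p.2 * θ p
      - N * (χ p.1 * ψ p.2 * θ' p) := by
    intro p
    have e1 : HasDerivAt (fun s : ℝ => R + 1 - (p.2 + N * s)) (-(N * 1)) p.1 :=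
      (((hasDerivAt_id p.1).const_mul N).const_add p.2).const_sub _
    have e2 : HasDerivAt (fun s => θ (s, p.2)) (θ' p * (-(N * 1))) p.1 := by
      have := (hasDerivAt_ramp (R + 1 - (p.2 + N * p.1))).comp p.1 e1
      exact this
    have e3 : HasDerivAt (fun s => φ (s, p.2)) _ p.1 := ((dχ p.1).mul_const (ψ p.2)).mul e2
    rw [derivFst, e3.deriv]
    ring
  have d2 : ∀ p, derivSnd φ p = χ p.1 * layer ε p.2 * θ p - χ p.1 * ψ p.2 * θ' p := by
    intro p
    have e1 : HasDerivAt (fun y : ℝ => R + 1 - (y + N * p.1)) (-1) p.2 :=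
      ((hasDerivAt_id p.2).add_const (N * p.1)).const_sub _
    have e2 : HasDerivAt (fun y => θ (p.1, y)) (θ' p * (-1)) p.2 := by
      have := (hasDerivAt_ramp (R + 1 - (p.2 + N * p.1))).comp p.2 e1
      exact this
    have e3 : HasDerivAt (fun y => φ (p.1, y)) _ p.2 :=
      ((hasDerivAt_ramp_div (ε := ε) p.2).const_mul (χ p.1)).mul e2
    rw [derivSnd, e3.deriv]
    ring
  have kato := hU.kato hU' hg hVm hVb hVi hφd hφc
    (fun p => mul_nonneg (mul_nonneg (χ0 _) (ψ0 _)) (θ0 _)) hε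
    (fun p hp => by simp [hφ, ψz p.2 hp.le])
  -- measurability and bounds
  have mD : Measurable D := continuous_abs.measurable.comp (hU.measurable.sub hU'.measurable)
  have mq : Measurable q :=
    (continuous_kflux hg.continuous).measurable.comp (hU.measurable.prodMk hU'.measurable)
  have D0 : ∀ p, 0 ≤ D p := fun p => abs_nonneg _
  have bD : ∀ p, D p ≤ 2 * C := fun p =>
    (abs_sub _ _).trans (by linarith [hU.bdd p, hU'.bdd p])
  have bD' : ∀ p, |D p| ≤ 2 * C := fun p => by rw [abs_of_nonneg (D0 p)]; exact bD p
  have bVq : ∀ p, |V p.1 * q p| ≤ N * D p := fun p => by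
    rw [abs_mul, hNdef, mul_assoc]
    exact mul_le_mul (hVb _) (abs_kflux_le hN (hU.bdd p) (hU'.bdd p)) (abs_nonneg _) hCv0
  have bVq' : ∀ p, |V p.1 * q p| ≤ N * (2 * C) := fun p =>
    (bVq p).trans (mul_le_mul_of_nonneg_left (bD p) hN0)
  have mVq : Measurable fun p : ℝ × ℝ => V p.1 * q p := (hVm.comp measurable_fst).mul mq
  have ilayer : Integrable (layer ε) := integrable_layer hε
  set ι : Set ℝ → ℝ → ℝ := fun S => S.indicator fun _ => 1 with hι
  have iι : ∀ S : Set ℝ, MeasurableSet S → volume S ≠ ∞ → Integrable (ι S) := fun S hS hS' =>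
    (integrable_indicator_iff hS).2 (integrableOn_const hS')
  -- the three terms
  have iK : Integrable fun p => D p * derivFst φ p + V p.1 * q p * derivSnd φ p :=
    (integrable_bdd_mul mD.aestronglyMeasurable bD' (continuous_derivFst hφd)
      (hasCompactSupport_derivFst hφd hφc)).add (integrable_bdd_mul mVq.aestronglyMeasurable bVq'
      (continuous_derivSnd hφd) (hasCompactSupport_derivSnd hφd hφc))
  have i1 : Integrable fun p : ℝ × ℝ => D p * (κ p.1 * ι (Ioc 0 X) p.2) :=
    (iκ.mul_prod (iι _ measurableSet_Ioc measure_Ioc_lt_top.ne)).bdd_mul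
      mD.aestronglyMeasurable (Eventually.of_forall bD')
  have i2 : Integrable fun p : ℝ × ℝ => κ p.1 * ι (Ioc 0 (2 * ε)) p.2 :=
    iκ.mul_prod (iι _ measurableSet_Ioc measure_Ioc_lt_top.ne)
  have i3 : Integrable fun p : ℝ × ℝ =>
      deriv ramp (p.1 + 2) * (Ioi 0).indicator (fun x => |a x - a' x|) p.2 :=
    (integrable_deriv_ramp.comp_add_right 2).mul_prod
      ((integrable_indicator_iff measurableSet_Ioi).2 hai)
  have iχ : Integrable fun t => (Icc 0 T).indicator χ t := by
    rw [integrable_indicator_iff measurableSet_Icc]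
    exact cχ.continuous.continuousOn.integrableOn_Icc
  have i4 : Integrable fun p : ℝ × ℝ => V p.1 * q p * ((Icc 0 T).indicator χ p.1 * layer ε p.2) :=
    (iχ.mul_prod ilayer).bdd_mul mVq.aestronglyMeasurable (Eventually.of_forall bVq')
  -- Rise of `χ`: initial distance. Fall of `χ`: averaged distance on `(0, X]`, up to the strip `(0,
  -- 2ε]` where `ψ < 1` may occur and `D ≤ 2 C`. Slope of `ψ`: boundary flux. The slope of `θ` has a
  -- sign and is dropped.
  have hpt : ∀ p : ℝ × ℝ, D p * derivFst φ p + V p.1 * q p * derivSnd φ p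
      ≤ deriv ramp (p.1 + 2) * (Ioi 0).indicator (fun x => |a x - a' x|) p.2
        - D p * (κ p.1 * ι (Ioc 0 X) p.2) + 2 * C * (κ p.1 * ι (Ioc 0 (2 * ε)) p.2)
        + V p.1 * q p * ((Icc 0 T).indicator χ p.1 * layer ε p.2) := by
    intro p
    have s1 : D p * (deriv ramp (p.1 + 2) * ψ p.2 * θ p)
        ≤ deriv ramp (p.1 + 2) * (Ioi 0).indicator (fun x => |a x - a' x|) p.2 := by
      rcases le_or_gt p.2 0 with hx | hx
      · rw [ψz _ (hx.trans hε.le), indicator_of_notMem (show p.2 ∉ Ioi 0 from not_lt.2 hx)]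
        simp
      · rw [indicator_of_mem (show p.2 ∈ Ioi 0 from hx)]
        rcases le_or_gt p.1 (-1) with ht | ht
        · have e : D p = |a p.2 - a' p.2| := by
            simp only [hD]
            rw [← ha p.1 (by linarith) p.2, ← ha' p.1 (by linarith) p.2]
          rw [← e]
          have h3 : ψ p.2 * θ p ≤ 1 := mul_le_one₀ (r1 _) (θ0 p) (r1 _)
          have h4 := mul_nonneg (D0 p) (deriv_ramp_nonneg (p.1 + 2))
          nlinarith
        · rw [deriv_ramp_of_gt (by linarith)]
          simp
    have s2 : D p * (κ p.1 * ι (Ioc 0 X) p.2) - 2 * C * (κ p.1 * ι (Ioc 0 (2 * ε)) p.2)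
        ≤ D p * (κ p.1 * ψ p.2 * θ p) := by
      by_cases hk : κ p.1 = 0
      · rw [hk]
        simp
      have hk' := (κz p.1 hk).2
      have hk0 := κ0 p.1
      have rhs0 : 0 ≤ D p * (κ p.1 * ψ p.2 * θ p) :=
        mul_nonneg (D0 p) (mul_nonneg (mul_nonneg hk0 (ψ0 _)) (θ0 _))
      have ι0 : ∀ S x, 0 ≤ ι S x := fun S x => indicator_nonneg (fun _ _ => zero_le_one) _
      by_cases hx : p.2 ∈ Ioc 0 X
      · have hι1 : ι (Ioc 0 X) p.2 = 1 := indicator_of_mem hx _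
        rw [hι1, mul_one]
        by_cases hx2 : p.2 ∈ Ioc 0 (2 * ε)
        · have hι2 : ι (Ioc 0 (2 * ε)) p.2 = 1 := indicator_of_mem hx2 _
          rw [hι2, mul_one, ← sub_mul]
          have : (D p - 2 * C) * κ p.1 ≤ 0 :=
            mul_nonpos_of_nonpos_of_nonneg (by linarith [bD p]) hk0
          linarith
        · have hx3 : 2 * ε < p.2 := by
            by_contra hc
            exact hx2 ⟨hx.1, not_lt.1 hc⟩
          have hψ1 : ψ p.2 = 1 := Real.smoothTransition.one_of_one_le (by
            rw [le_sub_iff_add_le, le_div_iff₀ hε]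
            linarith)
          have hθ1 : θ p = 1 := Real.smoothTransition.one_of_one_le (by
            have : N * p.1 ≤ N * T := mul_le_mul_of_nonneg_left (hk'.trans ht₀.2) hN0
            linarith [hx.2])
          rw [hψ1, hθ1, mul_one, mul_one]
          have := mul_nonneg (mul_nonneg zero_le_two hC0)
            (mul_nonneg hk0 (ι0 (Ioc 0 (2 * ε)) p.2))
          linarith
      · have hι1 : ι (Ioc 0 X) p.2 = 0 := indicator_of_notMem hx _
        rw [hι1, mul_zero, mul_zero]
        have := mul_nonneg (mul_nonneg zero_le_two hC0)
          (mul_nonneg hk0 (ι0 (Ioc 0 (2 * ε)) p.2))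
        linarith
    have s3 : V p.1 * q p * (χ p.1 * layer ε p.2 * θ p)
        = V p.1 * q p * ((Icc 0 T).indicator χ p.1 * layer ε p.2) := by
      by_cases ht : p.1 ∈ Icc 0 T
      · rw [indicator_of_mem ht]
        rcases le_or_gt p.2 (2 * ε) with hx | hx
        · have hθ1 : θ p = 1 := Real.smoothTransition.one_of_one_le (by
            have : N * p.1 ≤ N * T := mul_le_mul_of_nonneg_left ht.2 hN0
            linarith)
          rw [hθ1, mul_one]
        · rw [layer_of_gt hε hx]
          ring
      · rw [hV0 _ ht]
        ring
    -- `|V q| ≤ N D`, so the moving edge only loses mass.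
    have s4 : 0 ≤ χ p.1 * ψ p.2 * θ' p * (N * D p + V p.1 * q p) :=
      mul_nonneg (mul_nonneg (mul_nonneg (χ0 _) (ψ0 _)) (deriv_ramp_nonneg _))
        (by linarith [(abs_le.1 (bVq p)).1])
    rw [d1, d2]
    calc D p * ((deriv ramp (p.1 + 2) - κ p.1) * ψ p.2 * θ p - N * (χ p.1 * ψ p.2 * θ' p))
          + V p.1 * q p * (χ p.1 * layer ε p.2 * θ p - χ p.1 * ψ p.2 * θ' p)
        = D p * (deriv ramp (p.1 + 2) * ψ p.2 * θ p) - D p * (κ p.1 * ψ p.2 * θ p)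
          + V p.1 * q p * (χ p.1 * layer ε p.2 * θ p)
          - χ p.1 * ψ p.2 * θ' p * (N * D p + V p.1 * q p) := by ring
      _ ≤ _ := by rw [s3]; linarith
  have i31 : Integrable fun p : ℝ × ℝ =>
      deriv ramp (p.1 + 2) * (Ioi 0).indicator (fun x => |a x - a' x|) p.2
        - D p * (κ p.1 * ι (Ioc 0 X) p.2) := i3.sub i1
  have i312 : Integrable fun p : ℝ × ℝ =>
      deriv ramp (p.1 + 2) * (Ioi 0).indicator (fun x => |a x - a' x|) p.2
        - D p * (κ p.1 * ι (Ioc 0 X) p.2) + 2 * C * (κ p.1 * ι (Ioc 0 (2 * ε)) p.2) :=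
    i31.add (i2.const_mul _)
  have hsum := kato.trans (integral_mono iK (i312.add i4) hpt)
  simp only [Pi.add_apply] at hsum
  rw [integral_add i312 i4, integral_add i31 (i2.const_mul _), integral_sub i3 i1] at hsum
  have v1 : ∫ p : ℝ × ℝ, D p * (κ p.1 * ι (Ioc 0 X) p.2)
      = ∫ t, κ t * ∫ x in Ioc 0 X, |U (t, x) - U' (t, x)| := by
    rw [Measure.volume_eq_prod, integral_prod _ i1]
    refine integral_congr_ae (Eventually.of_forall fun t => ?_)
    simp only
    rw [← integral_indicator measurableSet_Ioc, ← integral_const_mul]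
    refine integral_congr_ae (Eventually.of_forall fun x => ?_)
    simp only [hD, hι, indicator]
    split_ifs <;> ring
  have v2 : ∫ p : ℝ × ℝ, 2 * C * (κ p.1 * ι (Ioc 0 (2 * ε)) p.2) = 4 * C * ε := by
    rw [integral_const_mul, Measure.volume_eq_prod, integral_prod_mul κ (ι (Ioc 0 (2 * ε))), vκ,
      hι, integral_indicator measurableSet_Ioc, setIntegral_const, smul_eq_mul,
      Real.volume_real_Ioc_of_le (by linarith)]
    ring
  have v3 : ∫ p : ℝ × ℝ, deriv ramp (p.1 + 2) * (Ioi 0).indicator (fun x => |a x - a' x|) p.2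
      = ∫ x in Ioi 0, |a x - a' x| := by
    rw [Measure.volume_eq_prod, integral_prod_mul (fun t => deriv ramp (t + 2))
      ((Ioi 0).indicator fun x => |a x - a' x|), integral_add_right_eq_self (deriv ramp) 2,
      integral_deriv_ramp, one_mul, integral_indicator measurableSet_Ioi]
  have v4 : ∫ p : ℝ × ℝ, V p.1 * q p * ((Icc 0 T).indicator χ p.1 * layer ε p.2)
      = ∫ t in Icc 0 T, χ t * (V t * ∫ x, layer ε x * kflux g (U (t, x)) (U' (t, x))) := by
    rw [Measure.volume_eq_prod, integral_prod _ i4, ← integral_indicator measurableSet_Icc]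
    refine integral_congr_ae (Eventually.of_forall fun t => ?_)
    simp only
    by_cases ht : t ∈ Icc 0 T
    · rw [indicator_of_mem ht, indicator_of_mem ht, ← mul_assoc, ← integral_const_mul]
      refine integral_congr_ae (Eventually.of_forall fun x => ?_)
      simp only [hq]
      ring
    · rw [indicator_of_notMem ht, indicator_of_notMem ht]
      simp
  rw [v1, v2, v3, v4] at hsum
  linarith

/-- Stability estimate for the averages in time, with the flux of the traces at the boundary. -/
theorem IsKruzkovSolution.average_le (hU : IsKruzkovSolution g V C U)
    (hU' : IsKruzkovSolution g V C U') (hg : ContDiff ℝ 1 g) (hVm : Measurable V)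
    (hVb : ∀ t, |V t| ≤ Cv) (hVi : Integrable V) (hV0 : ∀ t, t ∉ Icc 0 T → V t = 0)
    (ha : ∀ t < 0, ∀ x, U (t, x) = a x) (ha' : ∀ t < 0, ∀ x, U' (t, x) = a' x)
    (hai : IntegrableOn (fun x => |a x - a' x|) (Ioi 0)) (hτ : IsTrace T U τ)
    (hτ' : IsTrace T U' τ') (hτC : ∀ᵐ t ∂(volume.restrict (Icc 0 T)), |τ t| ≤ C)
    (hτC' : ∀ᵐ t ∂(volume.restrict (Icc 0 T)), |τ' t| ≤ C) {t₀ h X : ℝ} (ht₀ : t₀ ∈ Icc 0 T)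
    (hh : 0 < h) (hh1 : h ≤ 1) (hX : 1 ≤ X) (hβi : IntegrableOn β (Icc 0 t₀))
    (hβ0 : ∀ t, 0 ≤ β t)
    (hβ : ∀ᵐ t ∂(volume.restrict (Icc 0 t₀)), V t * kflux g (τ t) (τ' t) ≤ β t) :
    (∫ t, layer h (t₀ + h - t) * ∫ x in Ioc 0 X, |U (t, x) - U' (t, x)|) ≤
      (∫ x in Ioi 0, |a x - a' x|) + ∫ t in Icc 0 t₀, β t := by
  obtain ⟨N₀, hN₀, hN⟩ := exists_lipschitz_bound hg C
  have hC0 : 0 ≤ C := (abs_nonneg _).trans (hU.bdd 0)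
  have hCv0 : 0 ≤ Cv := (abs_nonneg _).trans (hVb 0)
  have r0 := Real.smoothTransition.nonneg
  have r1 := Real.smoothTransition.le_one
  set χ : ℝ → ℝ := fun t => ramp (t + 2) * ramp ((t₀ + h - t) / h - 1) with hχ
  have cχ : ContDiff ℝ 1 χ :=
    (contDiff_ramp.comp (by fun_prop)).mul (contDiff_ramp.comp (by fun_prop))
  have χ0 : ∀ t, 0 ≤ χ t := fun t => mul_nonneg (r0 _) (r0 _)
  have χ1 : ∀ t, χ t ≤ 1 := fun t => mul_le_one₀ (r1 _) (r0 _) (r1 _)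
  set q : ℝ × ℝ → ℝ := fun p => kflux g (U p) (U' p) with hq
  have mq : Measurable q :=
    (continuous_kflux hg.continuous).measurable.comp (hU.measurable.prodMk hU'.measurable)
  have bq : ∀ p, |q p| ≤ N₀ * (2 * C) := fun p =>
    (abs_kflux_le hN (hU.bdd p) (hU'.bdd p)).trans (mul_le_mul_of_nonneg_left
      ((abs_sub _ _).trans (by linarith [hU.bdd p, hU'.bdd p])) hN₀)
  have mτ := hτ.aestronglyMeasurable hU.measurable hU.bdd
  have mτ' := hτ'.aestronglyMeasurable hU'.measurable hU'.bdd
  -- Dominated convergence in time. The limit flux is that of the two traces, the bound on the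
  -- integrands being uniform in `ε`.
  have hlim : Tendsto (fun ε => ∫ t in Icc 0 T, χ t * (V t * ∫ x, layer ε x * q (t, x)))
      (𝓝[>] 0) (𝓝 (∫ t in Icc 0 T, χ t * (V t * kflux g (τ t) (τ' t)))) := by
    refine tendsto_integral_filter_of_dominated_convergence
      (fun t => 1 * (Cv * (N₀ * (2 * C)))) ?_ ?_ ?_ ?_
    · refine Eventually.of_forall fun ε => ?_
      exact (cχ.continuous.measurable.mul
        (hVm.mul (measurable_integral_layer_mul mq ε))).aestronglyMeasurable
    · filter_upwards [self_mem_nhdsWithin] with ε (hε : 0 < ε)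
      refine Eventually.of_forall fun t => ?_
      have : |∫ x, layer ε x * q (t, x)| ≤ N₀ * (2 * C) := by
        calc |∫ x, layer ε x * q (t, x)| ≤ ∫ x, layer ε x * (N₀ * (2 * C)) := by
              refine (abs_integral_le_integral_abs).trans (integral_mono_of_nonneg
                (Eventually.of_forall fun x => abs_nonneg _) ((integrable_layer hε).mul_const _)
                (Eventually.of_forall fun x => ?_))
              simp only
              rw [abs_mul, abs_of_nonneg (layer_nonneg hε x)]
              exact mul_le_mul_of_nonneg_left (bq _) (layer_nonneg hε x)
          _ = _ := by rw [integral_mul_const, integral_layer hε, one_mul]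
      rw [norm_mul, norm_mul (V t)]
      refine mul_le_mul ?_ (mul_le_mul (hVb t) this (norm_nonneg _) hCv0) (by positivity)
        zero_le_one
      rw [Real.norm_eq_abs, abs_of_nonneg (χ0 t)]
      exact χ1 t
    · exact integrableOn_const measure_Icc_lt_top.ne
    · filter_upwards [hτ, hτ', hτC, hτC'] with t ht ht' hb hb'
      refine Tendsto.const_mul _ (Tendsto.const_mul _ ?_)
      refine tendsto_integral_layer_mul (mq.comp measurable_prodMk_left) (fun x => bq _) ?_
      exact tendsto_average_of_le (a := fun x => U (t, x)) (b := fun x => U' (t, x))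
        (α := τ t) (β := τ' t) (N := 2 * N₀) (hU.measurable.comp measurable_prodMk_left)
        (hU'.measurable.comp measurable_prodMk_left) (fun x => hU.bdd _) (fun x => hU'.bdd _)
        (fun x => abs_kflux_sub_le hN₀ hN (hU.bdd _) (hU'.bdd _) hb hb') ht ht'
  have hlim2 : Tendsto (fun ε : ℝ => 4 * C * ε + (∫ x in Ioi 0, |a x - a' x|)
      + ∫ t in Icc 0 T, χ t * (V t * ∫ x, layer ε x * q (t, x))) (𝓝[>] 0)
      (𝓝 (4 * C * 0 + (∫ x in Ioi 0, |a x - a' x|)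
        + ∫ t in Icc 0 T, χ t * (V t * kflux g (τ t) (τ' t)))) :=
    (((tendsto_id.const_mul (4 * C)).add_const _).mono_left nhdsWithin_le_nhds).add hlim
  have hle := ge_of_tendsto hlim2 (by
    filter_upwards [Ioo_mem_nhdsGT (show (0 : ℝ) < 1 / 2 by norm_num)] with ε hε
    exact hU.average_le_add_layer hU' hg hVm hVb hVi hV0 ha ha' hai ht₀ hh hh1 hX hε.1
      (by linarith [hε.2]))
  refine hle.trans ?_
  rw [mul_zero, zero_add]
  refine add_le_add le_rfl ?_
  have hsub : Icc 0 t₀ ⊆ Icc 0 T := Icc_subset_Icc_right ht₀.2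
  -- The cut-off has reached zero at `t₀`, so boundary data after `t₀` do not enter. On `[0, t₀]`,
  -- `χ ≤ 1` and `β ≥ 0` allow `χ` to be dropped.
  have hz : ∀ t, t ∉ Icc 0 t₀ → t ∈ Icc 0 T → χ t * (V t * kflux g (τ t) (τ' t)) = 0 := by
    intro t h1 h2
    have h3 : t₀ < t := by
      by_contra hc
      exact h1 ⟨h2.1, not_lt.1 hc⟩
    have : ramp ((t₀ + h - t) / h - 1) = 0 := Real.smoothTransition.zero_of_nonpos (by
      rw [sub_nonpos, div_le_one hh]
      linarith)
    simp [hχ, this]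
  have hint : IntegrableOn (fun t => χ t * (V t * kflux g (τ t) (τ' t))) (Icc 0 T) := by
    refine Integrable.of_bound (C := 1 * (Cv * (N₀ * (2 * C)))) ?_ ?_
    · exact cχ.continuous.aestronglyMeasurable.mul (hVm.aestronglyMeasurable.mul
        ((continuous_kflux hg.continuous).comp_aestronglyMeasurable (mτ.prodMk mτ')))
    · filter_upwards [hτC, hτC'] with t hb hb'
      have : |kflux g (τ t) (τ' t)| ≤ N₀ * (2 * C) :=
        (abs_kflux_le hN hb hb').trans (mul_le_mul_of_nonneg_left
          ((abs_sub _ _).trans (by linarith)) hN₀)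
      rw [norm_mul, norm_mul (V t)]
      refine mul_le_mul ?_ (mul_le_mul (hVb t) this (norm_nonneg _) hCv0) (by positivity)
        zero_le_one
      rw [Real.norm_eq_abs, abs_of_nonneg (χ0 t)]
      exact χ1 t
  rw [setIntegral_eq_of_subset_of_forall_sdiff_eq_zero measurableSet_Icc hsub
    (fun t ht => hz t ht.2 ht.1)]
  refine integral_mono_ae (hint.mono_set hsub) hβi ?_
  filter_upwards [hβ] with t ht
  have h1 := mul_le_mul_of_nonneg_left ht (χ0 t)
  have h2 := mul_le_mul_of_nonneg_right (χ1 t) (hβ0 t)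
  linarith

end Estimate

/-! ### Weak-* continuity in time -/

theorem IsKruzkovSolution.exists_abs_comp_le {g V : ℝ → ℝ} {C : ℝ} {U : ℝ × ℝ → ℝ}
    (hU : IsKruzkovSolution g V C U) (hg : Continuous g) : ∃ G, ∀ p, |g (U p)| ≤ G := by
  obtain ⟨G, hG⟩ := (isCompact_Icc (a := -C) (b := C)).exists_bound_of_continuousOn hg.continuousOn
  exact ⟨G, fun p => hG _ (abs_le.1 (hU.bdd p))⟩

/-- At the extreme levels `±C` the sign of `U - k` is constant. The two entropy inequalities are
then the two inequalities of the weak equation, the constant parts integrating to zero. -/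
theorem IsKruzkovSolution.integral_eq_zero {g V : ℝ → ℝ} {C Cv : ℝ} {U : ℝ × ℝ → ℝ}
    (hU : IsKruzkovSolution g V C U) (hg : ContDiff ℝ 1 g) (hVm : Measurable V)
    (hVb : ∀ t, |V t| ≤ Cv) {φ : ℝ × ℝ → ℝ} (hφ : ContDiff ℝ 1 φ) (hφc : HasCompactSupport φ)
    (hφ0 : ∀ p, 0 ≤ φ p) (hφε : ∃ ε > 0, ∀ p : ℝ × ℝ, p.2 < ε → φ p = 0) :
    ∫ p, (U p * derivFst φ p + V p.1 * g (U p) * derivSnd φ p) = 0 := by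
  obtain ⟨G, hgb⟩ := hU.exists_abs_comp_le hg.continuous
  have hCv0 : 0 ≤ Cv := (abs_nonneg _).trans (hVb 0)
  have hgm : Measurable fun p => g (U p) := hg.continuous.measurable.comp hU.measurable
  have hi1 : Integrable fun p => U p * derivFst φ p :=
    integrable_bdd_mul hU.measurable.aestronglyMeasurable hU.bdd (continuous_derivFst hφ)
      (hasCompactSupport_derivFst hφ hφc)
  have hi2 : Integrable fun p : ℝ × ℝ => V p.1 * g (U p) * derivSnd φ p :=
    integrable_bdd_mul (C := Cv * G)
      ((hVm.comp measurable_fst).mul hgm).aestronglyMeasurable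
      (fun p => by
        rw [abs_mul]
        exact mul_le_mul (hVb _) (hgb p) (abs_nonneg _) hCv0)
      (continuous_derivSnd hφ) (hasCompactSupport_derivSnd hφ hφc)
  have hi3 : ∀ c : ℝ, Integrable fun p => c * derivFst φ p := fun c =>
    ((continuous_derivFst hφ).integrable_of_hasCompactSupport
      (hasCompactSupport_derivFst hφ hφc)).const_mul c
  have hb4 : ∀ (c t : ℝ), |V t * c| ≤ Cv * |c| := fun c t => by
    rw [abs_mul]
    exact mul_le_mul_of_nonneg_right (hVb t) (abs_nonneg _)
  have hi4 : ∀ c : ℝ, Integrable fun p : ℝ × ℝ => V p.1 * c * derivSnd φ p := fun c =>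
    integrable_bdd_mul ((hVm.comp measurable_fst).mul_const c).aestronglyMeasurable
      (fun p => hb4 c p.1) (continuous_derivSnd hφ) (hasCompactSupport_derivSnd hφ hφc)
  have hz4 : ∀ c : ℝ, ∫ p : ℝ × ℝ, V p.1 * c * derivSnd φ p = 0 := fun c =>
    integral_mul_derivSnd_eq_zero (hVm.mul_const c) (hb4 c) hφ hφc
  have hsplit : ∀ c d : ℝ, ∫ p : ℝ × ℝ, (c * derivFst φ p + V p.1 * d * derivSnd φ p) = 0 :=
    fun c d => by
      rw [integral_add (hi3 c) (hi4 d), hz4, integral_derivFst_eq_zero hφ hφc]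
      ring
  have hI : Integrable fun p : ℝ × ℝ => U p * derivFst φ p + V p.1 * g (U p) * derivSnd φ p :=
    hi1.add hi2
  have hJ : ∀ c d : ℝ, Integrable fun p : ℝ × ℝ =>
    c * derivFst φ p + V p.1 * d * derivSnd φ p := fun c d => (hi3 c).add (hi4 d)
  have hup := hU.entropy C φ hφ hφc hφ0 hφε
  have hlo := hU.entropy (-C) φ hφ hφc hφ0 hφε
  have e1 : ∀ p : ℝ × ℝ, |U p - C| * derivFst φ p + V p.1 * kflux g (U p) C * derivSnd φ p
      = (C * derivFst φ p + V p.1 * g C * derivSnd φ p)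
        - (U p * derivFst φ p + V p.1 * g (U p) * derivSnd φ p) := fun p => by
    have h := (abs_le.1 (hU.bdd p)).2
    rw [kflux, max_eq_right h, min_eq_left h, abs_of_nonpos (by linarith)]
    ring
  have e2 : ∀ p : ℝ × ℝ, |U p - -C| * derivFst φ p + V p.1 * kflux g (U p) (-C) * derivSnd φ p
      = (U p * derivFst φ p + V p.1 * g (U p) * derivSnd φ p)
        - ((-C) * derivFst φ p + V p.1 * g (-C) * derivSnd φ p) := fun p => by
    have h := (abs_le.1 (hU.bdd p)).1
    rw [kflux, max_eq_left h, min_eq_right h, abs_of_nonneg (by linarith)]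
    ring
  rw [integral_congr_ae (Eventually.of_forall e1), integral_sub (hJ _ _) hI, hsplit] at hup
  rw [integral_congr_ae (Eventually.of_forall e2), integral_sub hI (hJ _ _), hsplit] at hlo
  linarith

/-- A bounded function with a bounded distributional derivative has a Lipschitz representative. -/
theorem exists_lipschitzWith_ae_eq {A : ℝ → ℝ} {C K : ℝ} (hA : Measurable A)
    (hAC : ∀ t, |A t| ≤ C)
    (h : ∀ χ : ℝ → ℝ, ContDiff ℝ 1 χ → HasCompactSupport χ → (∀ t, 0 ≤ χ t) →
      |∫ t, deriv χ t * A t| ≤ K * ∫ t, χ t) :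
    ∃ F : ℝ → ℝ, LipschitzWith K.toNNReal F ∧ A =ᵐ[volume] F := by
  have hAl : LocallyIntegrable A := by
    intro x
    refine ⟨Icc (x - 1) (x + 1), Icc_mem_nhds (by linarith) (by linarith), ?_⟩
    exact Measure.integrableOn_of_bounded (M := C) (by simp) hA.aestronglyMeasurable
      (Eventually.of_forall hAC)
  let b : ℕ → ContDiffBump (0 : ℝ) := fun n =>
    ⟨1 / (n + 1 : ℝ) / 2, 1 / (n + 1 : ℝ), by positivity, half_lt_self (by positivity)⟩
  have h1 : Tendsto (fun n => (b n).rOut) atTop (𝓝 0) := tendsto_one_div_add_atTop_nhds_zero_nat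
  have h2 : ∀ᶠ n in atTop, (b n).rOut ≤ 2 * (b n).rIn := Eventually.of_forall fun n => by
    change 1 / (n + 1 : ℝ) ≤ 2 * (1 / (n + 1 : ℝ) / 2)
    linarith
  have hae := ContDiffBump.ae_convolution_tendsto_right_of_locallyIntegrable (μ := volume) h1 h2
    hAl
  -- The derivative of a mollification is, up to sign, the pairing of `A` with the derivative of a
  -- translated kernel of mass one, so the hypothesis bounds it by `K`.
  have hlip : ∀ n, LipschitzWith K.toNNReal
      (convolution ((b n).normed volume) A (ContinuousLinearMap.lsmul ℝ ℝ) volume) := by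
    intro n
    have hd := fun x => (b n).hasCompactSupport_normed (μ := volume)
      |>.hasDerivAt_convolution_left (ContinuousLinearMap.lsmul ℝ ℝ) (b n).contDiff_normed hAl x
    refine lipschitzWith_of_nnnorm_deriv_le (fun x => (hd x).differentiableAt) fun x => ?_
    rw [(hd x).deriv, ← NNReal.coe_le_coe, coe_nnnorm, Real.norm_eq_abs, convolution_eq_swap]
    refine le_trans ?_ (Real.le_coe_toNNReal K)
    have hc := h (fun s => (b n).normed volume (x - s))
      ((b n).contDiff_normed.comp (contDiff_const.sub contDiff_id))
      ((b n).hasCompactSupport_normed.comp_homeomorph (Homeomorph.subLeft x))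
      (fun s => (b n).nonneg_normed _)
    rw [integral_sub_left_eq_self (fun s => (b n).normed volume s) volume x,
      (b n).integral_normed, mul_one] at hc
    refine le_trans (le_of_eq ?_) hc
    rw [← abs_neg, ← integral_neg]
    congr 1
    refine integral_congr_ae (Eventually.of_forall fun s => ?_)
    simp only [ContinuousLinearMap.lsmul_apply, smul_eq_mul]
    rw [deriv_comp_const_sub]
    ring
  -- The Lipschitz bound passes to `A` on the conull set where the mollifications converge, and from
  -- there extends to the line.
  have hon : LipschitzOnWith K.toNNReal A {t | Tendsto (fun n =>
      (convolution ((b n).normed volume) A (ContinuousLinearMap.lsmul ℝ ℝ) volume) t) atTop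
        (𝓝 (A t))} := by
    refine LipschitzOnWith.of_dist_le_mul fun x hx y hy => ?_
    exact le_of_tendsto (Tendsto.dist hx hy) (Eventually.of_forall fun n =>
      (hlip n).dist_le_mul x y)
  obtain ⟨F, hF, hFA⟩ := hon.extend_real
  exact ⟨F, hF, by filter_upwards [hae] with t ht using hFA ht⟩

theorem le_of_ae_le_of_continuous {f g : ℝ → ℝ} (hf : Continuous f) (hg : Continuous g)
    (h : ∀ᵐ t, f t ≤ g t) (t : ℝ) : f t ≤ g t :=
  (isClosed_le hf hg).closure_subset ((Measure.dense_of_ae h) t)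

/-- An almost everywhere uniform limit of continuous functions has a continuous representative. -/
theorem exists_continuous_ae_eq {A : ℝ → ℝ}
    (h : ∀ η > 0, ∃ A' : ℝ → ℝ, Continuous A' ∧ ∀ᵐ t, |A t - A' t| ≤ η) :
    ∃ F : ℝ → ℝ, Continuous F ∧ A =ᵐ[volume] F := by
  choose B hBc hB using fun n : ℕ => h (1 / (n + 1 : ℝ)) (by positivity)
  have hlim : Tendsto (fun n : ℕ => 2 * (1 / (n + 1 : ℝ))) atTop (𝓝 0) := by
    simpa using tendsto_one_div_add_atTop_nhds_zero_nat.const_mul (2 : ℝ)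
  have hBB : ∀ n m N : ℕ, N ≤ n → N ≤ m → ∀ t, dist (B n t) (B m t) ≤ 2 * (1 / (N + 1 : ℝ)) := by
    intro n m N hn hm
    refine le_of_ae_le_of_continuous ((hBc n).dist (hBc m)) continuous_const ?_
    filter_upwards [hB n, hB m] with t h1 h2
    have h3 := Nat.one_div_le_one_div (α := ℝ) hn
    have h4 := Nat.one_div_le_one_div (α := ℝ) hm
    rw [Real.dist_eq]
    have := abs_sub_le (B n t) (A t) (B m t)
    have h5 := abs_sub_comm (B n t) (A t)
    linarith
  have hex : ∀ t, ∃ ℓ, Tendsto (fun n => B n t) atTop (𝓝 ℓ) := fun t =>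
    cauchySeq_tendsto_of_complete
      (cauchySeq_of_le_tendsto_0 _ (fun n m N hn hm => hBB n m N hn hm t) hlim)
  choose F hF using hex
  refine ⟨F, continuous_of_uniform_approx_of_continuous ?_, ?_⟩
  · rw [Metric.uniformity_basis_dist_le.forall_iff (fun _ _ hst h => by
      obtain ⟨G, h1, h2⟩ := h
      exact ⟨G, h1, fun y => hst (h2 y)⟩)]
    intro ε hε
    obtain ⟨N, hN⟩ := (hlim.eventually_le_const hε).exists
    refine ⟨B N, hBc N, fun t => ?_⟩
    rw [Set.mem_ofPred_eq, dist_comm]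
    exact (le_of_tendsto (tendsto_const_nhds.dist (hF t)) ((eventually_ge_atTop N).mono
      fun m hm => hBB N m N le_rfl hm t)).trans hN
  · filter_upwards [ae_all_iff.2 hB] with t ht
    refine tendsto_nhds_unique (tendsto_iff_dist_tendsto_zero.2 ?_) (hF t)
    refine squeeze_zero (fun _ => dist_nonneg) (fun n => ?_)
      tendsto_one_div_add_atTop_nhds_zero_nat
    rw [dist_comm, Real.dist_eq]
    exact ht n

/-- Testing the weak equation with `χ(t) ψ(x)` shows that the distributional time derivative of the
pairing with `ψ` is bounded by `Cv G ∫ |ψ'|`. -/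
theorem IsKruzkovSolution.exists_lipschitzWith_integral_mul {g V : ℝ → ℝ} {C Cv : ℝ}
    {U : ℝ × ℝ → ℝ} (hU : IsKruzkovSolution g V C U) (hg : ContDiff ℝ 1 g) (hVm : Measurable V)
    (hVb : ∀ t, |V t| ≤ Cv) {ψ : ℝ → ℝ} (hψ : ContDiff ℝ 1 ψ) (hψc : HasCompactSupport ψ)
    (hψ0 : ∀ x, 0 ≤ ψ x) {ε : ℝ} (hε : 0 < ε) (hψε : ∀ x < ε, ψ x = 0) :
    ∃ F : ℝ → ℝ, Continuous F ∧ ∀ᵐ t, ∫ x, U (t, x) * ψ x = F t := by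
  obtain ⟨G, hgb⟩ := hU.exists_abs_comp_le hg.continuous
  have hCv0 : 0 ≤ Cv := (abs_nonneg _).trans (hVb 0)
  have hψi : Integrable ψ := hψ.continuous.integrable_of_hasCompactSupport hψc
  have hψ'i : Integrable (deriv ψ) :=
    (hψ.continuous_deriv le_rfl).integrable_of_hasCompactSupport hψc.deriv
  have hm : Measurable fun t => ∫ x, U (t, x) * ψ x :=
    ((hU.measurable.mul (hψ.continuous.measurable.comp
      measurable_snd)).stronglyMeasurable.integral_prod_right).measurable
  have hb : ∀ t, |∫ x, U (t, x) * ψ x| ≤ C * ∫ x, |ψ x| := fun t => by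
    rw [← integral_const_mul, ← Real.norm_eq_abs]
    refine norm_integral_le_of_norm_le (hψi.abs.const_mul C) (Eventually.of_forall fun x => ?_)
    rw [Real.norm_eq_abs, abs_mul]
    exact mul_le_mul_of_nonneg_right (hU.bdd _) (abs_nonneg _)
  obtain ⟨F, hF, hAF⟩ := exists_lipschitzWith_ae_eq hm hb (K := Cv * G * ∫ x, |deriv ψ x|) (by
    intro χ hχ hχc hχ0
    have hφ : ContDiff ℝ 1 fun p : ℝ × ℝ => χ p.1 * ψ p.2 :=
      (hχ.comp contDiff_fst).mul (hψ.comp contDiff_snd)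
    have hφc := hasCompactSupport_mul_prod hχc hψc
    have e1 : ∀ p, derivFst (fun p : ℝ × ℝ => χ p.1 * ψ p.2) p = deriv χ p.1 * ψ p.2 := fun p => by
      change deriv (fun s => χ s * ψ p.2) p.1 = _
      exact ((hχ.differentiable one_ne_zero p.1).hasDerivAt.mul_const _).deriv
    have e2 : ∀ p, derivSnd (fun p : ℝ × ℝ => χ p.1 * ψ p.2) p = χ p.1 * deriv ψ p.2 := fun p => by
      change deriv (fun y => χ p.1 * ψ y) p.2 = _
      exact ((hψ.differentiable one_ne_zero p.2).hasDerivAt.const_mul _).deriv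
    have h0 := hU.integral_eq_zero hg hVm hVb hφ hφc (fun p => mul_nonneg (hχ0 _) (hψ0 _))
      ⟨ε, hε, fun p hp => by rw [hψε _ hp, mul_zero]⟩
    have hi1 : Integrable fun p => U p * derivFst (fun p : ℝ × ℝ => χ p.1 * ψ p.2) p :=
      integrable_bdd_mul hU.measurable.aestronglyMeasurable hU.bdd (continuous_derivFst hφ)
        (hasCompactSupport_derivFst hφ hφc)
    have hi2 : Integrable fun p : ℝ × ℝ =>
        V p.1 * g (U p) * derivSnd (fun p : ℝ × ℝ => χ p.1 * ψ p.2) p :=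
      integrable_bdd_mul (C := Cv * G)
        ((hVm.comp measurable_fst).mul
          (hg.continuous.measurable.comp hU.measurable)).aestronglyMeasurable
        (fun p => by
          rw [abs_mul]
          exact mul_le_mul (hVb _) (hgb p) (abs_nonneg _) hCv0)
        (continuous_derivSnd hφ) (hasCompactSupport_derivSnd hφ hφc)
    rw [integral_add hi1 hi2] at h0
    have h1 : ∫ t, deriv χ t * ∫ x, U (t, x) * ψ x
        = ∫ p, U p * derivFst (fun p : ℝ × ℝ => χ p.1 * ψ p.2) p := by
      rw [Measure.volume_eq_prod, integral_prod _ hi1]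
      refine integral_congr_ae (Eventually.of_forall fun t => ?_)
      simp only [e1]
      rw [← integral_const_mul]
      refine integral_congr_ae (Eventually.of_forall fun x => ?_)
      simp only
      ring
    rw [h1, eq_neg_of_add_eq_zero_left h0, abs_neg, ← Real.norm_eq_abs]
    have hχi : Integrable χ := hχ.continuous.integrable_of_hasCompactSupport hχc
    have hi3 : Integrable fun p : ℝ × ℝ => Cv * G * (χ p.1 * |deriv ψ p.2|) :=
      (hχi.mul_prod hψ'i.abs).const_mul _
    refine (norm_integral_le_of_norm_le hi3 (Eventually.of_forall fun p => ?_)).trans ?_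
    · rw [e2, Real.norm_eq_abs, abs_mul, abs_mul, abs_mul, abs_of_nonneg (hχ0 _)]
      refine mul_le_mul_of_nonneg_right ?_ (mul_nonneg (hχ0 _) (abs_nonneg _))
      exact mul_le_mul (hVb _) (hgb p) (abs_nonneg _) hCv0
    · rw [integral_const_mul, Measure.volume_eq_prod,
        integral_prod_mul (fun t => χ t) (fun x => |deriv ψ x|)]
      exact le_of_eq (by ring))
  exact ⟨F, hF.continuous, hAF⟩

/-- Lipschitz functions are absolutely continuous, so integration by parts holds on a compact
interval slightly larger than the support of `ψ`, with no boundary terms. -/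
theorem integral_deriv_mul_eq_neg {f ψ : ℝ → ℝ} {K : NNReal} (hf : LipschitzWith K f)
    (hψ : ContDiff ℝ 1 ψ) (hψc : HasCompactSupport ψ) :
    ∫ x, deriv f x * ψ x = - ∫ x, f x * deriv ψ x := by
  obtain ⟨R, hR⟩ := hψc.isCompact.isBounded.subset_closedBall 0
  have hR' : tsupport ψ ⊆ Icc (-R) R := by simpa [Real.closedBall_eq_Icc] using hR
  set S := max R 0 + 1 with hS
  have hRS : R < S := (le_max_left _ _).trans_lt (lt_add_one _)
  have hS0 : 0 < S := (le_max_right R 0).trans_lt (lt_add_one _)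
  have hz : ∀ x, x ∉ Ioc (-S) S → ψ x = 0 := fun x hx => by
    by_contra h
    have := hR' (subset_tsupport _ h)
    exact hx ⟨by linarith [this.1], by linarith [this.2]⟩
  have hz' : ∀ x, x ∉ Ioc (-S) S → deriv ψ x = 0 := fun x hx => by
    by_contra h
    have := hR' (support_deriv_subset h)
    exact hx ⟨by linarith [this.1], by linarith [this.2]⟩
  have hψS : ψ S = 0 := by
    by_contra h
    linarith [(hR' (subset_tsupport _ h)).2]
  have e1 : ∫ x, deriv f x * ψ x = ∫ x in (-S)..S, deriv f x * ψ x := by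
    rw [intervalIntegral.integral_of_le (by linarith)]
    exact (setIntegral_eq_integral_of_forall_compl_eq_zero fun x hx => by
      rw [hz x hx, mul_zero]).symm
  have e2 : ∫ x, f x * deriv ψ x = ∫ x in (-S)..S, f x * deriv ψ x := by
    rw [intervalIntegral.integral_of_le (by linarith)]
    exact (setIntegral_eq_integral_of_forall_compl_eq_zero fun x hx => by
      rw [hz' x hx, mul_zero]).symm
  obtain ⟨K', hK'⟩ := hψ.lipschitzWith_of_hasCompactSupport hψc one_ne_zero
  have h := AbsolutelyContinuousOnInterval.integral_mul_deriv_eq_deriv_mul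
    (hf.lipschitzOnWith (s := uIcc (-S) S)).absolutelyContinuousOnInterval
    (hK'.lipschitzOnWith (s := uIcc (-S) S)).absolutelyContinuousOnInterval
  rw [e1, e2, h, hψS, hz (-S) (fun h => lt_irrefl _ h.1)]
  ring

/-- For smooth `θ` the derivative is moved onto `θ`, and `|F x t| ≤ K |x|` gives dominated
convergence. General `ψ` follows by density in `L¹`, uniformly in `t` because `|∂ₓF| ≤ K`. -/
theorem continuous_integral_deriv_mul {F : ℝ → ℝ → ℝ} {K : NNReal} (hF : ∀ x, Continuous (F x))
    (hL : ∀ t, LipschitzWith K fun x => F x t) (hF0 : ∀ t, F 0 t = 0) {ψ : ℝ → ℝ}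
    (hψ : Integrable ψ) : Continuous fun t => ∫ x, deriv (fun x => F x t) x * ψ x := by
  have hb : ∀ t x, ‖deriv (fun x => F x t) x‖ ≤ K := fun t x => norm_deriv_le_of_lipschitz (hL t)
  have hi : ∀ t {ψ : ℝ → ℝ}, Integrable ψ → Integrable fun x => deriv (fun x => F x t) x * ψ x :=
    fun t ψ h => h.bdd_mul (measurable_deriv _).aestronglyMeasurable (Eventually.of_forall (hb t))
  refine continuous_of_uniform_approx_of_continuous ?_
  rw [Metric.uniformity_basis_dist_le.forall_iff (fun _ _ hst h => by
    obtain ⟨G, h1, h2⟩ := h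
    exact ⟨G, h1, fun y => hst (h2 y)⟩)]
  intro ε hε
  have hδ : 0 < ε / (K + 1) := by positivity
  obtain ⟨θ, hθc, hθ, hθε⟩ := (memLp_one_iff_integrable.2 hψ).exist_eLpNorm_sub_le
    ENNReal.one_ne_top le_rfl hδ
  have hθ1 : ContDiff ℝ 1 θ := hθ.of_le (by exact_mod_cast le_top)
  have hθi : Integrable θ := hθ.continuous.integrable_of_hasCompactSupport hθc
  have hdi : Integrable fun x => ψ x - θ x := hψ.sub hθi
  refine ⟨fun t => ∫ x, deriv (fun x => F x t) x * θ x, ?_, fun t => ?_⟩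
  · simp_rw [fun t => integral_deriv_mul_eq_neg (hL t) hθ1 hθc]
    refine Continuous.neg (continuous_of_dominated (bound := fun x => K * |x| * |deriv θ x|)
      (fun t => ?_) (fun t => Eventually.of_forall fun x => ?_) ?_
      (Eventually.of_forall fun x => (hF x).mul continuous_const))
    · exact ((hL t).continuous.mul (hθ1.continuous_deriv le_rfl)).aestronglyMeasurable
    · rw [norm_mul, Real.norm_eq_abs, Real.norm_eq_abs]
      refine mul_le_mul_of_nonneg_right ?_ (abs_nonneg _)
      have := (hL t).dist_le_mul x 0
      simpa [hF0, Real.dist_eq] using this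
    · refine Continuous.integrable_of_hasCompactSupport ?_ ?_
      · have := hθ1.continuous_deriv le_rfl
        fun_prop
      · exact (hθc.deriv.comp_left (g := fun s => |s|) abs_zero).mul_left
  · rw [Set.mem_ofPred_eq, Real.dist_eq, ← integral_sub (hi t hψ) (hi t hθi)]
    have h1 : ∫ x, ‖ψ x - θ x‖ ≤ ε / (K + 1) := by
      have := hθε
      rw [eLpNorm_one_eq_lintegral_enorm] at this
      have h2 : ENNReal.ofReal (∫ x, ‖ψ x - θ x‖) ≤ ENNReal.ofReal (ε / (K + 1)) := by
        rw [ofReal_integral_norm_eq_lintegral_enorm hdi]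
        exact this
      exact (ENNReal.ofReal_le_ofReal_iff hδ.le).1 h2
    have h3 : |∫ x, (deriv (fun x => F x t) x * ψ x - deriv (fun x => F x t) x * θ x)|
        ≤ ∫ x, K * ‖ψ x - θ x‖ := by
      rw [← Real.norm_eq_abs]
      refine norm_integral_le_of_norm_le (hdi.norm.const_mul _) (Eventually.of_forall fun x => ?_)
      rw [← mul_sub, norm_mul]
      exact mul_le_mul_of_nonneg_right (hb t x) (norm_nonneg _)
    rw [integral_const_mul] at h3
    refine h3.trans ((mul_le_mul_of_nonneg_left h1 K.coe_nonneg).trans ?_)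
    rw [← mul_div_assoc, div_le_iff₀ (by positivity), mul_add, mul_one, mul_comm]
    linarith

/-- The indicator of `(0, x]` is an `L¹` limit of cut-offs admissible in the weak equation. As `U`
is bounded, the convergence of the pairings is uniform in time. -/
theorem IsKruzkovSolution.exists_continuous_setIntegral {g V : ℝ → ℝ} {C Cv : ℝ}
    {U : ℝ × ℝ → ℝ} (hU : IsKruzkovSolution g V C U) (hg : ContDiff ℝ 1 g) (hVm : Measurable V)
    (hVb : ∀ t, |V t| ≤ Cv) (x : ℝ) :
    ∃ F : ℝ → ℝ, Continuous F ∧ ∀ᵐ t, ∫ y in Ioc 0 x, U (t, y) = F t := by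
  have hC0 : 0 ≤ C := (abs_nonneg _).trans (hU.bdd 0)
  refine exists_continuous_ae_eq fun η hη => ?_
  obtain ⟨δ, hδ, hδη⟩ : ∃ δ > 0, C * (3 * δ) ≤ η :=
    ⟨η / (3 * (C + 1)), by positivity, by
      rw [mul_div_assoc', mul_div_assoc', div_le_iff₀ (by positivity)]
      nlinarith⟩
  -- It differs from the indicator of `(0, x]` only on `(0, 2δ]` and `(x - δ, x]`, of total length
  -- at most `3δ`.
  set ψ : ℝ → ℝ := fun y => ramp (y / δ - 1) * ramp ((x - y) / δ) with hψdef
  have hψ : ContDiff ℝ 1 ψ :=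
    (contDiff_ramp.comp ((contDiff_id.div_const δ).sub contDiff_const)).mul
      (contDiff_ramp.comp ((contDiff_const.sub contDiff_id).div_const δ))
  have hψ0 : ∀ y, 0 ≤ ψ y := fun y =>
    mul_nonneg (Real.smoothTransition.nonneg _) (Real.smoothTransition.nonneg _)
  have hψ1 : ∀ y, ψ y ≤ 1 := fun y =>
    mul_le_one₀ (Real.smoothTransition.le_one _) (Real.smoothTransition.nonneg _)
      (Real.smoothTransition.le_one _)
  have hψl : ∀ y ≤ δ, ψ y = 0 := fun y hy => by
    have : y / δ ≤ 1 := (div_le_one hδ).2 hy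
    simp only [hψdef]
    rw [ramp, Real.smoothTransition.zero_of_nonpos (by linarith), zero_mul]
  have hψr : ∀ y, x ≤ y → ψ y = 0 := fun y hy => by
    have : (x - y) / δ ≤ 0 := div_nonpos_of_nonpos_of_nonneg (by linarith) hδ.le
    simp only [hψdef]
    rw [ramp, Real.smoothTransition.zero_of_nonpos this, mul_zero]
  have hψm : ∀ y, 2 * δ ≤ y → y ≤ x - δ → ψ y = 1 := fun y h1 h2 => by
    have h3 : 2 ≤ y / δ := (le_div_iff₀ hδ).2 h1
    have h4 : 1 ≤ (x - y) / δ := (le_div_iff₀ hδ).2 (by linarith)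
    simp only [hψdef]
    rw [ramp, Real.smoothTransition.one_of_one_le (by linarith),
      Real.smoothTransition.one_of_one_le h4, mul_one]
  have hψc : HasCompactSupport ψ :=
    HasCompactSupport.intro (isCompact_Icc (a := δ) (b := x)) fun y hy => by
      rw [Set.mem_Icc, not_and_or, not_le, not_le] at hy
      exact hy.elim (fun h => hψl y h.le) (fun h => hψr y h.le)
  obtain ⟨F, hF, hFU⟩ := hU.exists_lipschitzWith_integral_mul hg hVm hVb hψ hψc hψ0 hδ
    (fun y hy => hψl y hy.le)
  refine ⟨F, hF, ?_⟩
  filter_upwards [hFU] with t ht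
  have hUm : Measurable fun y => U (t, y) := hU.measurable.comp measurable_prodMk_left
  have hi1 : Integrable ((Ioc 0 x).indicator fun y => U (t, y)) :=
    (integrable_indicator_iff measurableSet_Ioc).2
      (Measure.integrableOn_of_bounded (M := C) (by simp) hUm.aestronglyMeasurable
        (Eventually.of_forall fun y => hU.bdd _))
  have hi2 : Integrable fun y => U (t, y) * ψ y :=
    integrable_bdd_mul hUm.aestronglyMeasurable (fun y => hU.bdd _) hψ.continuous hψc
  have hi3 : ∀ a b : ℝ, Integrable ((Ioc a b).indicator fun _ => (1 : ℝ)) := fun a b =>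
    (integrable_indicator_iff measurableSet_Ioc).2 (integrableOn_const (by simp))
  have hi4 : Integrable fun y => C * ((Ioc 0 (2 * δ)).indicator (fun _ => (1 : ℝ)) y
      + (Ioc (x - δ) x).indicator (fun _ => (1 : ℝ)) y) := ((hi3 _ _).add (hi3 _ _)).const_mul C
  rw [← ht, ← integral_indicator measurableSet_Ioc, ← integral_sub hi1 hi2, ← Real.norm_eq_abs]
  refine (norm_integral_le_of_norm_le hi4 (Eventually.of_forall fun y => ?_)).trans ?_
  · have h1 := hU.bdd (t, y)
    have hA : 0 ≤ (Ioc 0 (2 * δ)).indicator (fun _ => (1 : ℝ)) y :=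
      indicator_nonneg (fun _ _ => zero_le_one) y
    have hB : 0 ≤ (Ioc (x - δ) x).indicator (fun _ => (1 : ℝ)) y :=
      indicator_nonneg (fun _ _ => zero_le_one) y
    rw [Real.norm_eq_abs]
    by_cases hy : y ∈ Ioc 0 x
    · rw [indicator_of_mem hy]
      have h2 : |U (t, y) - U (t, y) * ψ y| = |U (t, y)| * (1 - ψ y) := by
        rw [← mul_one_sub, abs_mul, abs_of_nonneg (sub_nonneg.2 (hψ1 y))]
      rw [h2]
      refine mul_le_mul h1 ?_ (sub_nonneg.2 (hψ1 y)) hC0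
      by_cases h3 : y ≤ 2 * δ
      · rw [indicator_of_mem (show y ∈ Ioc 0 (2 * δ) from ⟨hy.1, h3⟩)]
        linarith [hψ0 y]
      · by_cases h4 : x - δ < y
        · rw [indicator_of_mem (show y ∈ Ioc (x - δ) x from ⟨h4, hy.2⟩)]
          linarith [hψ0 y]
        · rw [hψm y (not_le.1 h3).le (not_lt.1 h4)]
          linarith
    · have h2 : ψ y = 0 := by
        rw [Set.mem_Ioc, not_and_or, not_lt, not_le] at hy
        exact hy.elim (fun h => hψl y (h.trans hδ.le)) fun h => hψr y h.le
      rw [indicator_of_notMem hy, h2, mul_zero, sub_zero, abs_zero]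
      exact mul_nonneg hC0 (add_nonneg hA hB)
  · rw [integral_const_mul, integral_add (hi3 _ _) (hi3 _ _),
      integral_indicator_const _ measurableSet_Ioc, integral_indicator_const _ measurableSet_Ioc]
    simp only [smul_eq_mul, mul_one, Real.volume_real_Ioc, sub_zero, sub_sub_cancel]
    rw [max_eq_left (by positivity), max_eq_left hδ.le]
    linarith

/-- `W` is a version of `U` which is bounded by `C` and weakly-* continuous in time. -/
structure IsWeakStarVersion (C : ℝ) (U : ℝ × ℝ → ℝ) (W : ℝ → ℝ → ℝ) : Prop where
  meas : ∀ t, Measurable (W t)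
  bdd : ∀ t x, |W t x| ≤ C
  ae_eq : ∀ᵐ t, ∀ᵐ x ∂(volume.restrict (Ioi 0)), W t x = U (t, x)
  continuous : ∀ ψ : ℝ → ℝ, IntegrableOn ψ (Ioi 0) →
    Continuous fun t => ∫ x in Ioi 0, W t x * ψ x

/-- Kružkov solutions are weakly-* continuous in time, up to a modification on a null set of
times. -/
theorem IsKruzkovSolution.exists_weakStar_continuous {g V : ℝ → ℝ} {C Cv : ℝ}
    {U : ℝ × ℝ → ℝ} (hU : IsKruzkovSolution g V C U) (hg : ContDiff ℝ 1 g) (hVm : Measurable V)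
    (hVb : ∀ t, |V t| ≤ Cv) :
    ∃ W : ℝ → ℝ → ℝ, IsWeakStarVersion C U W := by
  have hC0 : 0 ≤ C := (abs_nonneg _).trans (hU.bdd 0)
  -- `F x t` is the time-continuous version of the primitive `∫₀ˣ U(t, y) dy`. The desired slice at
  -- `t` is its derivative in `x`, which makes sense at every time.
  choose F hFc hFU using hU.exists_continuous_setIntegral hg hVm hVb
  set Z : ℝ → ℝ → ℝ := fun t => (Ioi 0).indicator fun y => U (t, y) with hZ
  have hZm : ∀ t, Measurable (Z t) := fun t =>
    (hU.measurable.comp measurable_prodMk_left).indicator measurableSet_Ioi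
  have hZb : ∀ t y, ‖Z t y‖ ≤ C := fun t y =>
    (norm_indicator_le_norm_self _ _).trans (hU.bdd _)
  have hZi : ∀ t a b, IntervalIntegrable (Z t) volume a b := fun t a b =>
    intervalIntegrable_iff.2 (Measure.integrableOn_of_bounded (M := C) (by simp)
      (hZm t).aestronglyMeasurable (Eventually.of_forall (hZb t)))
  have hZl : ∀ t, LocallyIntegrable (Z t) := fun t x =>
    ⟨Icc (x - 1) (x + 1), Icc_mem_nhds (by linarith) (by linarith),
      Measure.integrableOn_of_bounded (M := C) (by simp) (hZm t).aestronglyMeasurable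
        (Eventually.of_forall (hZb t))⟩
  have hprim : ∀ t x, ∫ y in (0 : ℝ)..x, Z t y = ∫ y in Ioc 0 x, U (t, y) := fun t x => by
    rcases le_total 0 x with hx | hx
    · rw [intervalIntegral.integral_of_le hx]
      exact setIntegral_congr_fun measurableSet_Ioc fun y hy => indicator_of_mem hy.1 _
    · rw [intervalIntegral.integral_of_ge hx, Ioc_eq_empty (not_lt.2 hx), setIntegral_empty,
        neg_eq_zero]
      exact setIntegral_eq_zero_of_forall_eq_zero fun y hy =>
        indicator_of_notMem (not_lt.2 hy.2) _
  have hFZ : ∀ x, ∀ᵐ t, ∫ y in (0 : ℝ)..x, Z t y = F x t := fun x => by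
    filter_upwards [hFU x] with t ht
    rw [hprim, ht]
  have hZL : ∀ t x y, dist (∫ z in (0 : ℝ)..x, Z t z) (∫ z in (0 : ℝ)..y, Z t z)
      ≤ C * dist x y := fun t x y => by
    rw [dist_eq_norm, intervalIntegral.integral_interval_sub_left (hZi _ _ _) (hZi _ _ _),
      Real.dist_eq]
    exact intervalIntegral.norm_integral_le_of_norm_le_const fun z _ => hZb t z
  -- The null set of times depends on `x` and `y`, but a closed inequality between functions
  -- continuous in `t` holds for all `t` once it holds almost everywhere.
  have hFL : ∀ t, LipschitzWith C.toNNReal fun x => F x t := fun t =>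
    LipschitzWith.of_dist_le_mul fun x y => by
      rw [Real.coe_toNNReal C hC0]
      refine le_of_ae_le_of_continuous ((hFc x).dist (hFc y)) continuous_const ?_ t
      filter_upwards [hFZ x, hFZ y] with s h1 h2
      rw [← h1, ← h2]
      exact hZL s x y
  have hF0 : ∀ t, F 0 t = 0 := fun t => by
    have h : ∀ᵐ t, F 0 t = 0 := by
      filter_upwards [hFZ 0] with t ht
      rw [← ht, intervalIntegral.integral_same]
    exact le_antisymm (le_of_ae_le_of_continuous (hFc 0) continuous_const
      (h.mono fun _ => le_of_eq) t)
      (le_of_ae_le_of_continuous continuous_const (hFc 0) (h.mono fun _ h => h.ge) t)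
  refine ⟨fun t x => deriv (fun x => F x t) x, fun t => measurable_deriv _, fun t x => ?_, ?_, ?_⟩
  · have := norm_deriv_le_of_lipschitz (x₀ := x) (hFL t)
    rwa [Real.coe_toNNReal C hC0] at this
  -- Off one null set of times the primitives agree at all rational `x`, hence at all `x` by
  -- continuity; Lebesgue differentiation then identifies the slice.
  · filter_upwards [ae_all_iff.2 fun q : ℚ => hFZ q] with t ht
    have heq : (fun x => F x t) = fun x => ∫ y in (0 : ℝ)..x, Z t y := by
      refine Continuous.ext_on Rat.denseRange_cast (hFL t).continuous ?_ ?_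
      · exact (LipschitzWith.of_dist_le_mul (K := C.toNNReal) fun x y => by
          rw [Real.coe_toNNReal C hC0]
          exact hZL t x y).continuous
      · rintro _ ⟨q, rfl⟩
        exact (ht q).symm
    rw [heq, ae_restrict_iff' measurableSet_Ioi]
    filter_upwards [LocallyIntegrable.ae_hasDerivAt_integral (hZl t)] with x hx hx0
    rw [(hx 0).deriv]
    exact indicator_of_mem hx0 _
  · intro ψ hψ
    have h := continuous_integral_deriv_mul hFc hFL hF0
      ((integrable_indicator_iff measurableSet_Ioi).2 hψ)
    refine h.congr fun t => ?_
    rw [← integral_indicator measurableSet_Ioi]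
    congr 1
    ext x
    by_cases hx : x ∈ Ioi (0 : ℝ) <;> simp [hx]

/-! ### Slices of the weakly-* continuous version -/

theorem IsWeakStarVersion.integrable {C : ℝ} {U : ℝ × ℝ → ℝ} {W : ℝ → ℝ → ℝ}
    (hW : IsWeakStarVersion C U W) (t : ℝ) {ψ : ℝ → ℝ} (hψ : IntegrableOn ψ (Ioi 0)) :
    IntegrableOn (fun x => W t x * ψ x) (Ioi 0) :=
  hψ.bdd_mul (hW.meas t).aestronglyMeasurable (Eventually.of_forall fun x => hW.bdd t x)

/-- After `T` the slices are `c` for almost every time, so weak-* continuity from the right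
identifies the one at `T`. The test function is the bounded difference itself, made integrable by
the weight `e^{-x}`; this gives `∫ d² e^{-x} = 0`. -/
theorem IsWeakStarVersion.ae_eq_final {C T : ℝ} {U : ℝ × ℝ → ℝ} {W : ℝ → ℝ → ℝ} {c : ℝ → ℝ}
    (hW : IsWeakStarVersion C U W) (hc : Measurable c) (hcC : ∀ x, |c x| ≤ C)
    (h : ∀ t > T, ∀ x, U (t, x) = c x) : W T =ᵐ[volume.restrict (Ioi 0)] c := by
  set d : ℝ → ℝ := fun x => W T x - c x with hd
  have hdm : Measurable d := (hW.meas T).sub hc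
  have hdb : ∀ x, |d x| ≤ 2 * C := fun x =>
    (abs_sub _ _).trans (by linarith [hW.bdd T x, hcC x])
  have hψ : IntegrableOn (fun x => d x * Real.exp (-x)) (Ioi 0) :=
    (integrableOn_exp_neg_Ioi 0).bdd_mul hdm.aestronglyMeasurable
      (Eventually.of_forall fun x => hdb x)
  have hci : IntegrableOn (fun x => c x * (d x * Real.exp (-x))) (Ioi 0) :=
    hψ.bdd_mul hc.aestronglyMeasurable (Eventually.of_forall fun x => hcC x)
  have hlim : Tendsto (fun t => ∫ x in Ioi 0, W t x * (d x * Real.exp (-x))) (𝓝[>] T)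
      (𝓝 (∫ x in Ioi 0, W T x * (d x * Real.exp (-x)))) :=
    ((hW.continuous _ hψ).tendsto T).mono_left nhdsWithin_le_nhds
  have hae : ∀ᵐ t ∂(volume.restrict (Ioi T)), ∫ x in Ioi 0, W t x * (d x * Real.exp (-x))
      = ∫ x in Ioi 0, c x * (d x * Real.exp (-x)) := by
    filter_upwards [ae_restrict_of_ae hW.ae_eq, ae_restrict_mem measurableSet_Ioi] with t h1 h2
    refine integral_congr_ae ?_
    filter_upwards [h1] with x hx
    rw [hx, h t h2 x]
  have heq : ∫ x in Ioi 0, W T x * (d x * Real.exp (-x))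
      = ∫ x in Ioi 0, c x * (d x * Real.exp (-x)) := by
    have hfr : ∃ᶠ t in 𝓝[>] T, ∫ x in Ioi 0, W t x * (d x * Real.exp (-x))
        = ∫ x in Ioi 0, c x * (d x * Real.exp (-x)) := by
      intro hev
      obtain ⟨s, hs, hsub⟩ := mem_nhdsGT_iff_exists_Ioo_subset.1 hev
      have h1 := ae_restrict_of_ae_restrict_of_subset
        (Ioo_subset_Ioi_self : Ioo T s ⊆ Ioi T) hae
      have h2 : ∀ᵐ t ∂(volume.restrict (Ioo T s)), False := by
        filter_upwards [h1, ae_restrict_mem measurableSet_Ioo] with t h3 h4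
        exact hsub h4 h3
      have h3 : volume (Ioo T s) = 0 := by
        rw [eventually_false_iff_eq_bot, ae_eq_bot, Measure.restrict_eq_zero] at h2
        exact h2
      rw [Real.volume_Ioo, ENNReal.ofReal_eq_zero] at h3
      linarith [mem_Ioi.1 hs]
    exact isClosed_singleton.mem_of_frequently_of_tendsto hfr hlim
  have h0 : ∫ x in Ioi 0, d x ^ 2 * Real.exp (-x) = 0 := by
    rw [← sub_eq_zero, ← integral_sub (hW.integrable T hψ) hci] at heq
    refine Eq.trans (integral_congr_ae ?_) heq
    refine (Eventually.of_forall fun x => ?_)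
    simp only [hd]
    ring
  have hdi : IntegrableOn (fun x => d x ^ 2 * Real.exp (-x)) (Ioi 0) :=
    (hψ.bdd_mul hdm.aestronglyMeasurable (Eventually.of_forall fun x => hdb x)).congr
      (Eventually.of_forall fun x => by simp only; ring)
  rw [integral_eq_zero_iff_of_nonneg (fun x => by positivity) hdi] at h0
  filter_upwards [h0] with x hx
  have hx' : d x ^ 2 * Real.exp (-x) = 0 := hx
  have := (mul_eq_zero.1 hx').resolve_right (Real.exp_ne_zero _)
  exact sub_eq_zero.1 (pow_eq_zero_iff two_ne_zero |>.1 this)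

theorem IsWeakStarVersion.isTimeVersion {C T m M : ℝ} {uo a c : ℝ → ℝ} {u : ℝ → ℝ → ℝ}
    {U : ℝ × ℝ → ℝ} {W : ℝ → ℝ → ℝ} (hW : IsWeakStarVersion C U W)
    (hU : IsExtension T uo u m M a c U) (hUC : ∀ p, |U p| ≤ C) : IsTimeVersion T u W where
  ae_eq := by
    filter_upwards [hU.ae_slice_eq, ae_restrict_of_ae hW.ae_eq] with t h1 h2
    filter_upwards [h1, h2] with x h3 h4
    rw [h4, h3]
  final_eq := (hW.ae_eq_final hU.meas_final
    (fun x => by rw [← hU.final (T + 1) (lt_add_one T) x]; exact hUC _) hU.final).trans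
    hU.final_ae_eq
  memLp t _ := memLp_top_of_bound (hW.meas t).aestronglyMeasurable C
    (Eventually.of_forall fun x => hW.bdd t x)
  continuousOn ψ hψ := (hW.continuous ψ hψ).continuousOn

/-- A bound for the averages over short time intervals is inherited by the slices of the weakly-*
continuous versions. -/
theorem IsWeakStarVersion.setIntegral_abs_sub_le {C B t₀ X : ℝ} {U U' : ℝ × ℝ → ℝ}
    {W W' : ℝ → ℝ → ℝ} (hW : IsWeakStarVersion C U W) (hW' : IsWeakStarVersion C U' W')
    (hUm : Measurable U) (hUm' : Measurable U') (hUC : ∀ p, |U p| ≤ C) (hUC' : ∀ p, |U' p| ≤ C)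
    (h : ∀ h, 0 < h → h ≤ 1 →
      (∫ t, layer h (t₀ + h - t) * ∫ x in Ioc 0 X, |U (t, x) - U' (t, x)|) ≤ B) :
    ∫ x in Ioc 0 X, |W t₀ x - W' t₀ x| ≤ B := by
  classical
  -- The sign is frozen at `t₀`. The pairing `A` with it is continuous in time, equals the `L¹(0,X)`
  -- norm of the difference at `t₀`, and is at most that norm at almost every other time.
  set s : ℝ → ℝ := fun x => if 0 ≤ W t₀ x - W' t₀ x then 1 else -1 with hs
  have hsm : Measurable s := Measurable.ite
    (measurableSet_le measurable_const ((hW.meas t₀).sub (hW'.meas t₀))) measurable_const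
    measurable_const
  have hs1 : ∀ x, |s x| ≤ 1 := fun x => by
    simp only [hs]
    split_ifs <;> simp
  set ψ : ℝ → ℝ := (Ioc 0 X).indicator s with hψ
  have hψi : IntegrableOn ψ (Ioi 0) := Integrable.integrableOn <|
    (integrable_indicator_iff measurableSet_Ioc).2 (Measure.integrableOn_of_bounded (M := 1)
      (by simp) hsm.aestronglyMeasurable (Eventually.of_forall hs1))
  have hset : ∀ f : ℝ → ℝ, ∫ x in Ioi 0, f x * ψ x = ∫ x in Ioc 0 X, f x * s x := fun f => by
    have : (fun x => f x * ψ x) = (Ioc 0 X).indicator fun x => f x * s x := by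
      ext x
      by_cases hx : x ∈ Ioc 0 X <;> simp [hψ, hx]
    rw [this, setIntegral_indicator measurableSet_Ioc,
      inter_eq_self_of_subset_right Ioc_subset_Ioi_self]
  set A : ℝ → ℝ := fun t => (∫ x in Ioi 0, W t x * ψ x) - ∫ x in Ioi 0, W' t x * ψ x with hA
  have hAc : Continuous A := (hW.continuous ψ hψi).sub (hW'.continuous ψ hψi)
  have hAset : ∀ t, A t = ∫ x in Ioc 0 X, (W t x - W' t x) * s x := fun t => by
    simp only [hA]
    rw [← integral_sub (hW.integrable t hψi) (hW'.integrable t hψi), ← hset]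
    refine integral_congr_ae (Eventually.of_forall fun x => ?_)
    simp only
    ring
  have hA0 : A t₀ = ∫ x in Ioc 0 X, |W t₀ x - W' t₀ x| := by
    rw [hAset]
    refine integral_congr_ae (Eventually.of_forall fun x => ?_)
    simp only [hs]
    split_ifs with h0
    · rw [abs_of_nonneg h0, mul_one]
    · rw [abs_of_neg (not_le.1 h0)]
      ring
  have hDb : ∀ p, |U p - U' p| ≤ 2 * C := fun p =>
    (abs_sub _ _).trans (by linarith [hUC p, hUC' p])
  have hDm : Measurable fun p => |U p - U' p| := continuous_abs.measurable.comp (hUm.sub hUm')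
  have hDi : ∀ t, IntegrableOn (fun x => |U (t, x) - U' (t, x)|) (Ioc 0 X) := fun t =>
    Measure.integrableOn_of_bounded (M := 2 * C) (by simp)
      (hDm.comp measurable_prodMk_left).aestronglyMeasurable
      (Eventually.of_forall fun x => by rw [Real.norm_eq_abs, abs_abs]; exact hDb _)
  set D : ℝ → ℝ := fun t => ∫ x in Ioc 0 X, |U (t, x) - U' (t, x)| with hD
  have hDM : Measurable D := (hDm.stronglyMeasurable.integral_prod_right).measurable
  have hDB : ∀ t, |D t| ≤ 2 * C * volume.real (Ioc 0 X) := fun t => by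
    rw [← Real.norm_eq_abs]
    exact norm_setIntegral_le_of_norm_le_const (by simp) fun x _ => by
      rw [Real.norm_eq_abs, abs_abs]; exact hDb _
  have hAD : ∀ᵐ t, A t ≤ D t := by
    filter_upwards [hW.ae_eq, hW'.ae_eq] with t h1 h2
    rw [hAset]
    refine integral_mono_ae ?_ (hDi t) ?_
    · exact Measure.integrableOn_of_bounded (M := 2 * C) (by simp)
        ((((hW.meas t).sub (hW'.meas t)).mul hsm).aestronglyMeasurable)
        (Eventually.of_forall fun x => by
          rw [norm_mul, Real.norm_eq_abs, Real.norm_eq_abs]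
          have h3 : |W t x - W' t x| ≤ 2 * C :=
            (abs_sub _ _).trans (by linarith [hW.bdd t x, hW'.bdd t x])
          have h4 := mul_le_mul h3 (hs1 x) (abs_nonneg _) ((abs_nonneg _).trans h3)
          rwa [mul_one] at h4)
    · filter_upwards [ae_restrict_of_ae_restrict_of_subset Ioc_subset_Ioi_self h1,
        ae_restrict_of_ae_restrict_of_subset Ioc_subset_Ioi_self h2] with x h3 h4
      rw [h3, h4]
      refine (le_abs_self _).trans ?_
      rw [abs_mul]
      exact mul_le_of_le_one_right (abs_nonneg _) (hs1 x)
  rw [← hA0]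
  refine le_of_forall_pos_sub_le fun ε hε => ?_
  -- The kernel lives on `[t₀ - r, t₀]`, where `A ≥ A t₀ - ε` by continuity; its mass is one.
  obtain ⟨δ, hδ, hδA⟩ := Metric.continuousAt_iff.1 hAc.continuousAt ε hε
  obtain ⟨r, hr0, hr⟩ : ∃ r, 0 < r ∧ r < min δ 1 := exists_between (lt_min hδ one_pos)
  have hrδ := hr.trans_le (min_le_left _ _)
  refine le_trans ?_ (h r hr0 (hr.le.trans (min_le_right _ _)))
  have hki : Integrable fun t => layer r (t₀ + r - t) :=
    (integrable_layer hr0).comp_sub_left _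
  have e : A t₀ - ε = ∫ t, layer r (t₀ + r - t) * (A t₀ - ε) := by
    rw [integral_mul_const, integral_sub_left_eq_self (fun t => layer r t) volume (t₀ + r),
      integral_layer hr0, one_mul]
  rw [e]
  refine integral_mono_ae (hki.mul_const _) ?_ ?_
  · exact hki.mul_bdd (c := 2 * C * volume.real (Ioc 0 X)) hDM.aestronglyMeasurable
      (Eventually.of_forall hDB)
  · filter_upwards [hAD] with t ht
    by_cases h1 : t₀ + r - t < r
    · simp only [layer_of_lt hr0 h1, zero_mul, le_refl]
    by_cases h2 : 2 * r < t₀ + r - t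
    · simp only [layer_of_gt hr0 h2, zero_mul, le_refl]
    refine mul_le_mul_of_nonneg_left ?_ (layer_nonneg hr0 _)
    have h3 : dist t t₀ < δ := by
      rw [Real.dist_eq, abs_lt]
      constructor <;> linarith
    have h4 := hδA h3
    rw [Real.dist_eq, abs_lt] at h4
    linarith

theorem eLpNorm_one_Ioi_le {f : ℝ → ℝ} {B C : ℝ} (hf : Measurable f) (hfC : ∀ x, |f x| ≤ C)
    (h : ∀ X, 1 ≤ X → ∫ x in Ioc 0 X, |f x| ≤ B) :
    eLpNorm f 1 (volume.restrict (Ioi 0)) ≤ ENNReal.ofReal B := by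
  have hU : ⋃ n : ℕ, Ioc (0 : ℝ) (n + 1) = Ioi 0 := by
    ext x
    simp only [mem_iUnion, Set.mem_Ioc, Set.mem_Ioi]
    refine ⟨fun ⟨_, h, _⟩ => h, fun hx => ?_⟩
    obtain ⟨n, hn⟩ := exists_nat_ge x
    exact ⟨n, hx, by linarith⟩
  rw [eLpNorm_one_eq_lintegral_enorm, ← hU, setLIntegral_iUnion_of_directed]
  · refine iSup_le fun n => ?_
    rw [← ofReal_integral_norm_eq_lintegral_enorm
      (Measure.integrableOn_of_bounded (M := C) (by simp) hf.aestronglyMeasurable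
        (Eventually.of_forall hfC))]
    exact ENNReal.ofReal_le_ofReal (h _ (by linarith [n.cast_nonneg (α := ℝ)]))
  · refine Monotone.directed_le fun n m hnm => Ioc_subset_Ioc_right ?_
    have : (n : ℝ) ≤ m := by exact_mod_cast hnm
    linarith

/-! ### The data -/

/-- A function of bounded variation stays within its total variation of its value at one reference
point. -/
theorem MemL1BV.exists_ae_abs_le {w : ℝ → ℝ} {I : Set ℝ} (h : MemL1BV w I)
    (hI : MeasurableSet I) : ∃ C, ∀ᵐ x ∂(volume.restrict I), |w x| ≤ C := by
  obtain ⟨-, w', hw, hv⟩ := h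
  rcases I.eq_empty_or_nonempty with rfl | ⟨y, hy⟩
  · exact ⟨0, by simp⟩
  refine ⟨|w' y| + (eVariationOn w' I).toReal, ?_⟩
  filter_upwards [hw, ae_restrict_mem hI] with x h1 h2
  rw [← h1]
  have h3 := hv.dist_le h2 hy
  rw [Real.dist_eq] at h3
  linarith [abs_sub_abs_le_abs_sub (w' x) (w' y)]

theorem ae_mem_Icc_essInf_essSup {α : Type*} [MeasurableSpace α] {μ : Measure α} {w : α → ℝ}
    {C : ℝ} (h : ∀ᵐ x ∂μ, |w x| ≤ C) : ∀ᵐ x ∂μ, w x ∈ Icc (essInf w μ) (essSup w μ) := by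
  have h1 : IsBoundedUnder (· ≤ ·) (ae μ) w := ⟨C, by
    rw [eventually_map]
    exact h.mono fun x hx => (abs_le.1 hx).2⟩
  have h2 : IsBoundedUnder (· ≥ ·) (ae μ) w := ⟨-C, by
    rw [eventually_map]
    exact h.mono fun x hx => (abs_le.1 hx).1⟩
  filter_upwards [ae_le_essSup h1, ae_essInf_le h2] with x h3 h4 using ⟨h4, h3⟩

theorem ae_mem_essHull_left {w₁ w₂ : ℝ → ℝ} {I₁ I₂ : Set ℝ} {C : ℝ}
    (h : ∀ᵐ x ∂(volume.restrict I₁), |w₁ x| ≤ C) :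
    ∀ᵐ x ∂(volume.restrict I₁), w₁ x ∈ essHull w₁ I₁ w₂ I₂ := by
  filter_upwards [ae_mem_Icc_essInf_essSup h] with x hx
  exact ⟨(min_le_left _ _).trans hx.1, hx.2.trans (le_max_left _ _)⟩

theorem ae_mem_essHull_right {w₁ w₂ : ℝ → ℝ} {I₁ I₂ : Set ℝ} {C : ℝ}
    (h : ∀ᵐ x ∂(volume.restrict I₂), |w₂ x| ≤ C) :
    ∀ᵐ x ∂(volume.restrict I₂), w₂ x ∈ essHull w₁ I₁ w₂ I₂ := by
  filter_upwards [ae_mem_Icc_essInf_essSup h] with x hx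
  exact ⟨(min_le_right _ _).trans hx.1, hx.2.trans (le_max_right _ _)⟩

theorem eLpNorm_top_lt_top_of_continuousOn {f : ℝ → ℝ} {p q : ℝ} (hf : ContinuousOn f (Icc p q)) :
    eLpNorm f ∞ (volume.restrict (Icc p q)) < ∞ := by
  obtain ⟨C, hC⟩ := isCompact_Icc.exists_bound_of_continuousOn hf
  rw [eLpNorm_exponent_top]
  exact eLpNormEssSup_lt_top_of_ae_bound (C := C) (by
    filter_upwards [ae_restrict_mem measurableSet_Icc] with x hx using hC x hx)

theorem ae_abs_le_toReal_eLpNorm_top {α : Type*} [MeasurableSpace α] {μ : Measure α} {f : α → ℝ}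
    (hf : eLpNorm f ∞ μ < ∞) : ∀ᵐ x ∂μ, |f x| ≤ (eLpNorm f ∞ μ).toReal := by
  rw [eLpNorm_exponent_top] at hf ⊢
  filter_upwards [ae_le_eLpNormEssSup (f := f) (μ := μ)] with x hx
  have := ENNReal.toReal_mono hf.ne hx
  rwa [toReal_enorm, Real.norm_eq_abs] at this

/-- The fundamental theorem of calculus needs `g'` only up to null sets. If `p = q` the norm is
zero, but then `x = y`. -/
theorem abs_sub_le_eLpNorm_deriv_mul {g : ℝ → ℝ} (hg : ContDiff ℝ 1 g) {p q x y : ℝ}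
    (hx : x ∈ Icc p q) (hy : y ∈ Icc p q) :
    |g x - g y| ≤ (eLpNorm (deriv g) ∞ (volume.restrict (Icc p q))).toReal * |x - y| := by
  have hc := hg.continuous_deriv le_rfl
  have hae := ae_abs_le_toReal_eLpNorm_top (eLpNorm_top_lt_top_of_continuousOn
    (hc.continuousOn (s := Icc p q)))
  rw [ae_restrict_iff' measurableSet_Icc] at hae
  rw [← intervalIntegral.integral_deriv_eq_sub (fun z _ => hg.differentiable one_ne_zero z)
    (hc.intervalIntegrable _ _), ← Real.norm_eq_abs]
  refine intervalIntegral.norm_integral_le_of_norm_le_const_ae ?_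
  filter_upwards [hae] with z hz hzI
  refine hz (uIcc_subset_Icc hy hx (uIoc_subset_uIcc hzI))

theorem exists_isProblem {T : ℝ} {v g uo ub : ℝ → ℝ} (hT : 0 < T)
    (hv : ContinuousOn v (Icc 0 T)) (hg : ContDiff ℝ 1 g) (huo : MemL1BV uo (Ioi 0))
    (hub : MemL1BV ub (Icc 0 T)) :
    ∃ Cv m M, IsProblem T Cv v ((Icc 0 T).indicator v) g uo ub m M := by
  obtain ⟨Cv, hCv⟩ := isCompact_Icc.exists_bound_of_continuousOn hv
  obtain ⟨C₁, h₁⟩ := huo.exists_ae_abs_le measurableSet_Ioi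
  obtain ⟨C₂, h₂⟩ := hub.exists_ae_abs_le measurableSet_Icc
  refine ⟨Cv, _, _, hT, fun t ht => indicator_of_mem ht _, fun t ht => indicator_of_notMem ht _,
    ?_, fun t => ?_, hg, rfl, ae_mem_essHull_left h₁, huo.1.aestronglyMeasurable,
    ae_mem_essHull_right h₂, hub.1.aestronglyMeasurable⟩
  · classical
    rw [← piecewise_eq_indicator]
    exact hv.measurable_piecewise continuousOn_const measurableSet_Icc
  · by_cases ht : t ∈ Icc 0 T
    · rw [indicator_of_mem ht]
      exact hCv t ht
    · rw [indicator_of_notMem ht, abs_zero]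
      exact (norm_nonneg _).trans (hCv 0 ⟨le_rfl, hT.le⟩)

/-- Slicewise equality yields equality in the product only for a measurable set; hence the passage
through measurable representatives. -/
theorem ae_eq_prod_of_ae_ae_eq {μ ν : Measure ℝ} [SFinite μ] [SFinite ν] {f f' : ℝ × ℝ → ℝ}
    (hf : AEStronglyMeasurable f (μ.prod ν)) (hf' : AEStronglyMeasurable f' (μ.prod ν))
    (h : ∀ᵐ t ∂μ, ∀ᵐ x ∂ν, f (t, x) = f' (t, x)) : f =ᵐ[μ.prod ν] f' := by
  have h1 : hf.mk f =ᵐ[μ.prod ν] hf'.mk f' := by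
    refine (Measure.ae_prod_iff_ae_ae (measurableSet_eq_fun hf.stronglyMeasurable_mk.measurable
      hf'.stronglyMeasurable_mk.measurable)).2 ?_
    filter_upwards [h, Measure.ae_ae_of_ae_prod hf.ae_eq_mk,
      Measure.ae_ae_of_ae_prod hf'.ae_eq_mk] with t h1 h2 h3
    filter_upwards [h1, h2, h3] with x h4 h5 h6
    rw [← h5, ← h6, h4]
  exact hf.ae_eq_mk.trans (h1.trans hf'.ae_eq_mk.symm)

/-- The `L¹` stability estimate for the weakly-* continuous versions. -/
theorem exists_isTimeVersion_eLpNorm_sub_le {T vmin : ℝ} (hT : 0 < T) (hvmin : 0 < vmin)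
    {v : ℝ → ℝ} (hvc : ContinuousOn v (Icc 0 T)) (hv : ∀ t ∈ Icc 0 T, vmin ≤ v t) {g : ℝ → ℝ}
    (hg : ContDiff ℝ 1 g) {uo uo' ub ub' : ℝ → ℝ} (huo : MemL1BV uo (Ioi 0))
    (huo' : MemL1BV uo' (Ioi 0)) (hub : MemL1BV ub (Icc 0 T)) (hub' : MemL1BV ub' (Icc 0 T))
    {u u' : ℝ → ℝ → ℝ} (hu : IsSolution T (fun t r => v t * g r) uo ub u)
    (hu' : IsSolution T (fun t r => v t * g r) uo' ub' u') (htr : HasTrace T u)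
    (htr' : HasTrace T u') :
    ∃ w w' : ℝ → ℝ → ℝ, IsTimeVersion T u w ∧ IsTimeVersion T u' w' ∧
      ∀ t ∈ Icc 0 T,
        eLpNorm (fun x => w t x - w' t x) 1 (volume.restrict (Ioi 0)) ≤
          eLpNorm (fun x => uo x - uo' x) 1 (volume.restrict (Ioi 0)) +
            eLpNorm v ∞ (volume.restrict (Icc 0 t)) *
              eLpNorm (deriv g) ∞ (volume.restrict (essHull ub (Icc 0 t) ub' (Icc 0 t))) *
              eLpNorm (fun s => ub s - ub' s) 1 (volume.restrict (Icc 0 t)) := by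
  obtain ⟨Cv, m, M, hP⟩ := exists_isProblem hT hvc hg huo hub
  obtain ⟨Cv', m', M', hP'⟩ := exists_isProblem hT hvc hg huo' hub'
  obtain ⟨a, c, U, hU⟩ := hu.exists_isExtension hP
  obtain ⟨a', c', U', hU'⟩ := hu'.exists_isExtension hP'
  set V := (Icc 0 T).indicator v with hV
  -- The two problems may have different ranges. One common bound makes both extensions Kružkov
  -- solutions with the same constant, as the doubling requires.
  set C := max (max |m| |M|) (max |m'| |M'|) with hC
  have hm : |m| ≤ C := (le_max_left _ _).trans (le_max_left _ _)
  have hM : |M| ≤ C := (le_max_right _ _).trans (le_max_left _ _)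
  have hm' : |m'| ≤ C := (le_max_left _ _).trans (le_max_right _ _)
  have hM' : |M'| ≤ C := (le_max_right _ _).trans (le_max_right _ _)
  have hK := hu.isKruzkovSolution hP hU hm hM
  have hK' := hu'.isKruzkovSolution hP' hU' hm' hM'
  obtain ⟨W, hW⟩ := hK.exists_weakStar_continuous hg hP.meas hP.bdd
  obtain ⟨W', hW'⟩ := hK'.exists_weakStar_continuous hg hP.meas hP.bdd
  obtain ⟨τ, hτ⟩ := hU.exists_isTrace htr
  obtain ⟨τ', hτ'⟩ := hU'.exists_isTrace htr'
  have hτm := hτ.mem_Icc hU.meas hU.mem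
  have hτm' := hτ'.mem_Icc hU'.meas hU'.mem
  have hv0 : ∀ t ∈ Icc 0 T, 0 < v t := fun t ht => hvmin.trans_le (hv t ht)
  have had := hu.isAdmissibleTrace hP hv0 hU hτ
  have had' := hu'.isAdmissibleTrace hP' hv0 hU' hτ'
  refine ⟨W, W', hW.isTimeVersion hU hK.bdd, hW'.isTimeVersion hU' hK'.bdd, fun t₀ ht₀ => ?_⟩
  have hsub : Icc 0 t₀ ⊆ Icc 0 T := Icc_subset_Icc_right ht₀.2
  have hVi : Integrable V := (integrable_indicator_iff measurableSet_Icc).2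
    (hvc.integrableOn_compact isCompact_Icc)
  have hoi : IntegrableOn (fun x => uo x - uo' x) (Ioi 0) := huo.1.sub huo'.1
  have hbi : IntegrableOn (fun x => ub x - ub' x) (Icc 0 t₀) := (hub.1.sub hub'.1).mono_set hsub
  have haae : (fun x => |a x - a' x|) =ᵐ[volume.restrict (Ioi 0)] fun x => |uo x - uo' x| := by
    filter_upwards [hU.init_ae_eq, hU'.init_ae_eq] with x h1 h2
    rw [h1, h2]
  have hai : IntegrableOn (fun x => |a x - a' x|) (Ioi 0) := hoi.abs.congr haae.symm
  set Vn := eLpNorm v ∞ (volume.restrict (Icc 0 t₀)) with hVn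
  set Gn := eLpNorm (deriv g) ∞ (volume.restrict (essHull ub (Icc 0 t₀) ub' (Icc 0 t₀))) with hGn
  have hVf : Vn < ∞ := eLpNorm_top_lt_top_of_continuousOn (hvc.mono hsub)
  have hGf : Gn < ∞ :=
    eLpNorm_top_lt_top_of_continuousOn (hg.continuous_deriv le_rfl).continuousOn
  have hV0 : 0 ≤ Vn.toReal := ENNReal.toReal_nonneg
  have hG0 : 0 ≤ Gn.toReal := ENNReal.toReal_nonneg
  obtain ⟨C₁, h₁⟩ := hub.exists_ae_abs_le measurableSet_Icc
  obtain ⟨C₂, h₂⟩ := hub'.exists_ae_abs_le measurableSet_Icc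
  -- Only `g` between the two boundary values at time `t` matters, so the Lipschitz constant is
  -- taken on the hull of the boundary data over `[0, t₀]`, not on the larger ranges of the
  -- solutions.
  have hβ : ∀ᵐ t ∂(volume.restrict (Icc 0 t₀)),
      V t * kflux g (τ t) (τ' t) ≤ Vn.toReal * Gn.toReal * |ub t - ub' t| := by
    filter_upwards [ae_restrict_of_ae_restrict_of_subset hsub had,
      ae_restrict_of_ae_restrict_of_subset hsub had',
      ae_restrict_of_ae_restrict_of_subset hsub hτm,
      ae_restrict_of_ae_restrict_of_subset hsub hτm',
      ae_restrict_of_ae_restrict_of_subset hsub hP.ub_mem,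
      ae_restrict_of_ae_restrict_of_subset hsub hP'.ub_mem,
      ae_mem_essHull_left (w₂ := ub') (I₂ := Icc 0 t₀)
        (ae_restrict_of_ae_restrict_of_subset hsub h₁),
      ae_mem_essHull_right (w₁ := ub) (I₁ := Icc 0 t₀)
        (ae_restrict_of_ae_restrict_of_subset hsub h₂),
      ae_abs_le_toReal_eLpNorm_top hVf, ae_restrict_mem measurableSet_Icc]
      with t d1 d2 d3 d4 d5 d6 d7 d8 d9 d10
    have hvt := hv0 t (hsub d10)
    have hk := d1.kflux_le d2 d5 d3 d6 d4 hG0 fun x hx y hy =>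
      abs_sub_le_eLpNorm_deriv_mul hg (uIcc_subset_Icc d7 d8 hx) (uIcc_subset_Icc d7 d8 hy)
    rw [hP.eq_of_mem t (hsub d10), mul_assoc]
    refine (mul_le_mul_of_nonneg_left hk hvt.le).trans
      (mul_le_mul_of_nonneg_right ((le_abs_self _).trans d9) ?_)
    exact mul_nonneg hG0 (abs_nonneg _)
  have hτC : ∀ᵐ t ∂(volume.restrict (Icc 0 T)), |τ t| ≤ C :=
    hτm.mono fun t ht => abs_le_of_mem_Icc hm hM ht
  have hτC' : ∀ᵐ t ∂(volume.restrict (Icc 0 T)), |τ' t| ≤ C :=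
    hτm'.mono fun t ht => abs_le_of_mem_Icc hm' hM' ht
  have hβi : IntegrableOn (fun t => Vn.toReal * Gn.toReal * |ub t - ub' t|) (Icc 0 t₀) :=
    hbi.abs.const_mul _
  have hmain : eLpNorm (fun x => W t₀ x - W' t₀ x) 1 (volume.restrict (Ioi 0)) ≤
      ENNReal.ofReal ((∫ x in Ioi 0, |a x - a' x|)
        + ∫ t in Icc 0 t₀, Vn.toReal * Gn.toReal * |ub t - ub' t|) := by
    refine eLpNorm_one_Ioi_le (C := 2 * C) ((hW.meas t₀).sub (hW'.meas t₀))
      (fun x => (abs_sub _ _).trans (by linarith [hW.bdd t₀ x, hW'.bdd t₀ x])) fun X hX => ?_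
    refine hW.setIntegral_abs_sub_le hW' hU.meas hU'.meas hK.bdd hK'.bdd fun h hh hh1 => ?_
    exact hK.average_le hK' hg hP.meas hP.bdd hVi hP.eq_zero hU.init hU'.init hai hτ hτ' hτC hτC'
      ht₀ hh hh1 hX hβi (fun t => by positivity) hβ
  refine hmain.trans (le_of_eq ?_)
  rw [ENNReal.ofReal_add (integral_nonneg fun x => abs_nonneg _)
    (integral_nonneg fun x => by positivity), integral_congr_ae haae, integral_const_mul,
    ENNReal.ofReal_mul (mul_nonneg hV0 hG0), ENNReal.ofReal_mul hV0, ENNReal.ofReal_toReal hVf.ne,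
    ENNReal.ofReal_toReal hGf.ne, eLpNorm_one_eq_lintegral_enorm, eLpNorm_one_eq_lintegral_enorm,
    ← ofReal_integral_norm_eq_lintegral_enorm hoi, ← ofReal_integral_norm_eq_lintegral_enorm hbi]
  rfl

end HalfLineIBVP

/-! ### Stability and uniqueness -/

theorem proposition2p1
    (T vmin : ℝ) (hT : 0 < T) (hvmin : 0 < vmin)
    (v : ℝ → ℝ) (hvLip : ∃ K, LipschitzOnWith K v (Icc 0 T)) (hv : ∀ t ∈ Icc 0 T, vmin ≤ v t)
    (g : ℝ → ℝ) (hg : ContDiff ℝ 1 g)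
    (uo uo' ub ub' : ℝ → ℝ)
    (huo : HalfLineIBVP.MemL1BV uo (Ioi 0)) (huo' : HalfLineIBVP.MemL1BV uo' (Ioi 0))
    (hub : HalfLineIBVP.MemL1BV ub (Icc 0 T)) (hub' : HalfLineIBVP.MemL1BV ub' (Icc 0 T))
    (u u' : ℝ → ℝ → ℝ)
    (hu : HalfLineIBVP.IsSolution T (fun t r => v t * g r) uo ub u)
    (hu' : HalfLineIBVP.IsSolution T (fun t r => v t * g r) uo' ub' u')
    (htr : HalfLineIBVP.HasTrace T u) (htr' : HalfLineIBVP.HasTrace T u') :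
    (∃ w w' : ℝ → ℝ → ℝ, HalfLineIBVP.IsTimeVersion T u w ∧ HalfLineIBVP.IsTimeVersion T u' w' ∧
      ∀ t ∈ Icc 0 T,
        eLpNorm (fun x => w t x - w' t x) 1 (volume.restrict (Ioi 0)) ≤
          eLpNorm (fun x => uo x - uo' x) 1 (volume.restrict (Ioi 0)) +
            eLpNorm v ∞ (volume.restrict (Icc 0 t)) *
              eLpNorm (deriv g) ∞
                (volume.restrict (HalfLineIBVP.essHull ub (Icc 0 t) ub' (Icc 0 t))) *
              eLpNorm (fun s => ub s - ub' s) 1 (volume.restrict (Icc 0 t))) ∧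
    (uo =ᵐ[volume.restrict (Ioi 0)] uo' → ub =ᵐ[volume.restrict (Icc 0 T)] ub' →
      (fun p : ℝ × ℝ => u p.1 p.2) =ᵐ[volume.restrict (Icc 0 T ×ˢ Ioi 0)]
        (fun p : ℝ × ℝ => u' p.1 p.2)) := by
  obtain ⟨w, w', hw, hw', hle⟩ := HalfLineIBVP.exists_isTimeVersion_eLpNorm_sub_le hT hvmin
    hvLip.choose_spec.continuousOn hv hg huo huo' hub hub' hu hu' htr htr'
  refine ⟨⟨w, w', hw, hw', hle⟩, fun ho hb => ?_⟩
  have hslice : ∀ t ∈ Icc 0 T, w t =ᵐ[volume.restrict (Ioi 0)] w' t := fun t ht => by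
    have h := hle t ht
    have h1 : (fun x => uo x - uo' x) =ᵐ[volume.restrict (Ioi 0)] 0 := by
      filter_upwards [ho] with x hx using sub_eq_zero.2 hx
    have h2 : (fun s => ub s - ub' s) =ᵐ[volume.restrict (Icc 0 t)] 0 := by
      filter_upwards [ae_restrict_of_ae_restrict_of_subset (Icc_subset_Icc_right ht.2) hb]
        with s hs using sub_eq_zero.2 hs
    rw [eLpNorm_congr_ae h1, eLpNorm_congr_ae h2, eLpNorm_zero, eLpNorm_zero, mul_zero, add_zero,
      nonpos_iff_eq_zero] at h
    filter_upwards [(eLpNorm_eq_zero_iff ((hw.memLp t ht).1.sub (hw'.memLp t ht).1)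
      one_ne_zero).1 h] with x hx using sub_eq_zero.1 hx
  have hm := hu.memLp.1
  have hm' := hu'.memLp.1
  -- The versions coincide at every time and represent `u` and `u'` at almost every time, so it
  -- remains to pass from slices to the product.
  rw [Measure.volume_eq_prod, ← Measure.prod_restrict] at hm hm' ⊢
  refine HalfLineIBVP.ae_eq_prod_of_ae_ae_eq hm hm' ?_
  filter_upwards [hw.ae_eq, hw'.ae_eq, ae_restrict_mem measurableSet_Icc] with t h1 h2 h3
  filter_upwards [h1, h2, hslice t h3] with x h4 h5 h6
  rw [← h4, ← h5, h6]
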